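/- Let $\mathbb{R}^3_-=\{x\in\mathbb{R}^3: x_3<0\}$ and $\varrho(x)=(1+|x|^2)^{1/2}$. For an integer $m\ge 0$ and $\alpha\in\mathbb{R}$ let $H^m_\alpha(\mathbb{R}^3_-)$ be the space of real distributions $v$ on $\mathbb{R}^3_-$ with $\varrho^{\alpha-m+|\kappa|}\partial^\kappa v\in L^2(\mathbb{R}^3_-)$ for all multi-indices $|\kappa|\le m$, with norm $\|v\|^2_{H^m_\alpha}=\sum_{|\kappa|\le m}\|\varrho^{\alpha-m+|\kappa|}\partial^\kappa v\|_{L^2}^2$; for vector fields, componentwise. Let $\lambda,\mu$ be Lipschitz on $\mathbb{R}^3_-$ such that, for positive constants $M,K,\alpha_0,\beta_0$, $$\|\mu\|_{L^\infty}+\|\nabla\mu\|_{L^\infty}+\|\lambda\|_{L^\infty}+\|\nabla\lambda\|_{L^\infty}\le M,\qquad |\nabla\lambda|\le \frac{K}{\varrho},\quad |\nabla\mu|\le\frac{K}{\varrho}\ \text{ a.e. in } \mathbb{R}^3_-,$$ $$\mu(x)\ge\alpha_0,\qquad 3\lambda(x)+2\mu(x)\ge\beta_0\qquad\text{for all } x\in\mathbb{R}^3_-.$$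 Let $\widehat\nabla u=\frac12(\nabla u+\nabla u^T)$ and $\mathbb{C}\widehat\nabla u=\lambda\,(\operatorname{div}u)\,I+2\mu\,\widehat\nabla u$, and consider the problem $$\operatorname{div}(\mathbb{C}\widehat\nabla u)=f\ \text{ in }\mathbb{R}^3_-,\qquad (\mathbb{C}\widehat\nabla u)e_3=0\ \text{ on }\{x_3=0\}.\tag{P}$$ A weak solution of (P) is a $u\in H^1_0(\mathbb{R}^3_-)$ with $\int_{\mathbb{R}^3_-}\mathbb{C}\widehat\nabla u:\widehat\nabla v\,dx=-\int_{\mathbb{R}^3_-}f\cdot v\,dx$ for all $v\in H^1_0(\mathbb{R}^3_-)$. A strong solution is a $u\in H^2_1(\mathbb{R}^3_-)$ for which the equation holds almost everywhere and the boundary condition holds in the sense of traces. Then there is a constant $C$ depending only on $M,K,\alpha_0,\beta_0$ such that, for every vector field $f\in H^0_1(\mathbb{R}^3_-)$, problem (P) has a unique strong solution $u\in H^2_1(\mathbb{R}^3_-)$. This $u$ is also the unique weak solution of (P) in $H^1_0(\mathbb{R}^3_-)$, and $$\|u\|_{H^2_1(\mathbb{R}^3_-)}\le C\,\|f\|_{H^0_1(\mathbb{R}^3_-)}.$$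 -/

import Mathlib

open MeasureTheory
open scoped ContDiff ENNReal

noncomputable section

namespace LameHalfSpace

/-- Three-dimensional Euclidean space. The coordinates `x₁, x₂, x₃` are `x 0, x 1, x 2`. -/
abbrev E3 : Type := EuclideanSpace ℝ (Fin 3)

/-- The boundary plane `ℝ²`. -/
abbrev E2 : Type := EuclideanSpace ℝ (Fin 2)

/-- The open lower half space `{x₃ < 0}`. -/
def halfSpace : Set E3 := {x | x 2 < 0}

/-- The identification of `ℝ²` with `{x₃ = 0}`. -/
def bdry (y : E2) : E3 := !₂[y 0, y 1, 0]

/-- The weight `(1 + |x|²)^{1/2}`. -/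
def rho (x : E3) : ℝ := Real.sqrt (1 + ‖x‖ ^ 2)

/-! ### Weak derivatives -/

/-- The classical partial derivative in the direction `e_j`. -/
def pderiv (j : Fin 3) (φ : E3 → ℝ) : E3 → ℝ :=
  fun x => fderiv ℝ φ x (EuclideanSpace.single j 1)

/-- The classical derivative `∂^κ` for a multi-index `κ`. -/
def mderiv (κ : Fin 3 → ℕ) (φ : E3 → ℝ) : E3 → ℝ :=
  (pderiv 0)^[κ 0] ((pderiv 1)^[κ 1] ((pderiv 2)^[κ 2] φ))

/-- The length `|κ|` of a multi-index. -/
def mlen (κ : Fin 3 → ℕ) : ℕ := ∑ i, κ i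

/-- Test functions on `Ω`: smooth, with compact support inside `Ω`. -/
def IsTest (Ω : Set E3) (φ : E3 → ℝ) : Prop :=
  ContDiff ℝ ∞ φ ∧ HasCompactSupport φ ∧ tsupport φ ⊆ Ω

/-- `g` is the weak (distributional) derivative `∂^κ f` on the open set `Ω`. -/
def IsWeakDeriv (Ω : Set E3) (κ : Fin 3 → ℕ) (f g : E3 → ℝ) : Prop :=
  LocallyIntegrableOn f Ω ∧ LocallyIntegrableOn g Ω ∧
    ∀ φ, IsTest Ω φ →
      ∫ x in Ω, f x * mderiv κ φ x = (-1) ^ mlen κ * ∫ x in Ω, g x * φ x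

open Classical in
/-- A representative of the weak derivative `∂^κ f` on `Ω`, which is unique almost everywhere
(`0` if there is none; it is used only for functions that have this weak derivative). -/
def weakDeriv (Ω : Set E3) (κ : Fin 3 → ℕ) (f : E3 → ℝ) : E3 → ℝ :=
  if h : ∃ g, IsWeakDeriv Ω κ f g then h.choose else 0

/-- The multi-index of `∂_j`. -/
def idx (j : Fin 3) : Fin 3 → ℕ := Pi.single j 1

/-! ### Weighted Sobolev spaces -/

/-- Membership in `H^m_α(Ω)`: `ϱ^{α-m+|κ|} ∂^κ f ∈ L²(Ω)` for all `|κ| ≤ m`. -/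
def MemH (m : ℕ) (α : ℝ) (Ω : Set E3) (f : E3 → ℝ) : Prop :=
  ∀ κ : Fin 3 → ℕ, mlen κ ≤ m → ∃ g, IsWeakDeriv Ω κ f g ∧
    MemLp (fun x => rho x ^ (α - m + mlen κ) * g x) 2 (volume.restrict Ω)

/-- The square of the norm of `H^m_α(Ω)`: the sum over all multi-indices `κ` with `|κ| ≤ m` of
`‖ϱ^{α-m+|κ|} ∂^κ f‖²` in `L²(Ω)`. -/
def normSqH (m : ℕ) (α : ℝ) (Ω : Set E3) (f : E3 → ℝ) : ℝ :=
  ∑ k ∈ Finset.range (m + 1), ∑ κ ∈ Finset.piAntidiag (Finset.univ : Finset (Fin 3)) k,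
    (eLpNorm (fun x => rho x ^ (α - m + mlen κ) * weakDeriv Ω κ f x) 2
      (volume.restrict Ω)).toReal ^ 2

/-- A vector field belongs to `H^m_α(Ω)` if each of its components does. -/
def MemHVec (m : ℕ) (α : ℝ) (Ω : Set E3) (u : E3 → E3) : Prop :=
  ∀ i, MemH m α Ω (fun x => u x i)

/-- The norm of a vector field in `H^m_α(Ω)`. -/
def normHVec (m : ℕ) (α : ℝ) (Ω : Set E3) (u : E3 → E3) : ℝ :=
  Real.sqrt (∑ i, normSqH m α Ω (fun x => u x i))

/-- `w ∈ H^1_α(ℝ³₋)` has the trace `g` on `{x₃ = 0}`, in the sense of Green's formula (with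
outward normal `e₃`) against all smooth functions on the closed half space with bounded support,
that is, restrictions of smooth compactly supported functions on the whole space. -/
def HasTrace (α : ℝ) (w : E3 → ℝ) (g : E2 → ℝ) : Prop :=
  MemH 1 α halfSpace w ∧ LocallyIntegrable g ∧
    ∀ φ : E3 → ℝ, ContDiff ℝ ∞ φ → HasCompactSupport φ →
      ∫ x in halfSpace, (w x * pderiv 2 φ x + weakDeriv halfSpace (idx 2) w x * φ x)
        = ∫ y : E2, g y * φ (bdry y)

/-! ### The Lamé system -/

/-- `g` is Lipschitz on the half space. -/
def IsLip (g : E3 → ℝ) : Prop := ∃ L, LipschitzOnWith L g halfSpace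

/-- The norm `‖g‖_{L^∞} + ‖∇g‖_{L^∞}` over the half space (for Lipschitz `g`, which are
differentiable almost everywhere; the operator norm of the differential is `|∇g|`). -/
def normC01 (g : E3 → ℝ) : ℝ≥0∞ :=
  eLpNorm g ⊤ (volume.restrict halfSpace) + eLpNorm (fderiv ℝ g) ⊤ (volume.restrict halfSpace)

/-- The strain, i.e. the symmetric part of the weak gradient `(∇u)_{ij} = ∂_j u_i`. -/
def strain (u : E3 → E3) (x : E3) : Matrix (Fin 3) (Fin 3) ℝ :=
  Matrix.of fun i j =>
    (weakDeriv halfSpace (idx j) (fun y => u y i) x +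
      weakDeriv halfSpace (idx i) (fun y => u y j) x) / 2

/-- The isotropic elasticity tensor `λ I ⊗ I + 2 μ 𝕀` applied to a symmetric matrix. -/
def elasticity (l m : ℝ) (A : Matrix (Fin 3) (Fin 3) ℝ) : Matrix (Fin 3) (Fin 3) ℝ :=
  (l * A.trace) • (1 : Matrix (Fin 3) (Fin 3) ℝ) + (2 * m) • A

/-- The stress `ℂ ∇̂u`. -/
def stress (lam mu : E3 → ℝ) (u : E3 → E3) (x : E3) : Matrix (Fin 3) (Fin 3) ℝ :=
  elasticity (lam x) (mu x) (strain u x)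

/-- `u ∈ H^1_0(ℝ³₋)` is the weak solution of `div(ℂ∇̂u) = f` in the half space with
`(ℂ∇̂u) e₃ = 0` on the boundary:
`∫ ℂ∇̂u : ∇̂v = - ∫ f · v` for all `v ∈ H^1_0(ℝ³₋)`. -/
def IsWeakSolution (lam mu : E3 → ℝ) (f u : E3 → E3) : Prop :=
  MemHVec 1 0 halfSpace u ∧ ∀ v, MemHVec 1 0 halfSpace v →
    ∫ x in halfSpace, ∑ i, ∑ j, stress lam mu u x i j * strain v x i j
      = - ∫ x in halfSpace, ∑ i, f x i * v x i

/-- `u ∈ H^2_1(ℝ³₋)` is a strong solution: the stress is weakly differentiable,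
`div(ℂ∇̂u) = f` almost everywhere in the half space, and `(ℂ∇̂u) e₃` has zero trace. -/
def IsStrongSolution (lam mu : E3 → ℝ) (f u : E3 → E3) : Prop :=
  MemHVec 2 1 halfSpace u ∧
    (∃ d : Fin 3 → Fin 3 → E3 → ℝ,
      (∀ i j, IsWeakDeriv halfSpace (idx j) (fun x => stress lam mu u x i j) (d i j)) ∧
      ∀ i, ∀ᵐ x ∂(volume.restrict halfSpace), ∑ j, d i j x = f x i) ∧
    ∀ i, HasTrace 1 (fun x => stress lam mu u x i 2) 0

end LameHalfSpace

end

open LameHalfSpace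

/-! The energy form is coercive on `H^1_0`, so weak solutions come from Lax–Milgram. Pointwise,
splitting the strain into deviator and trace bounds the energy density below by `min (2α₀) β₀` times
the squared strain (`density_lower`). Korn's inequality (`korn`) passes from the strain to the full
gradient, and Hardy's inequality (`hardy`) from the gradient to `u/ϱ`. Both are integrations by
parts on the whole space. They reach the half space through a two-reflection extension; for Korn its
coefficients differ for tangential and normal components, so that the strain of the extended field
is controlled by the strain of the original one.

For second derivatives, the tangential directions are treated by difference quotients. The test
field is `D_{-h}(w² D_h u)` with bounded weights `w ≤ ϱ` satisfying `|∂_j w| ≤ 1`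
(`weighted_dq_estimate`). The commutator with the coefficients involves `D_h λ` and `D_h μ`, and the
decay `|∇λ|, |∇μ| ≤ K/ϱ` is what absorbs one factor of the weight. The bounds do not depend on `w`
or `h`; letting `w ↑ ϱ` and `h → 0` puts `ϱ ∂_k ∇u` in `L²` for tangential `k`.

The remaining derivatives are recovered from the equation (`exists_regularity`): the normal
derivative of the traction equals `f` minus tangential derivatives of the stress. Since `μ ≥ α₀` and
`λ + 2μ ≥ α₀`, the normal derivatives of `u` are combinations of the traction and of tangential
derivatives of `u`, with coefficients that have the same decay.

Strong and weak solutions coincide. Smooth functions of bounded support, not required to vanish at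
the boundary, are dense in `H^1_0(ℝ³₋)` (`H1.exists_approx`), and for them the boundary term in
Green's formula is the trace of the traction. Hence the zero traction condition is the natural one,
and uniqueness of strong solutions follows from uniqueness of weak ones. -/

noncomputable section

namespace LameHalfSpace

open Set Filter Topology

/-! ### Real-valued `L²` seminorm -/

section L2
variable {α : Type*} [MeasurableSpace α] {μ : Measure α} {f g : α → ℝ}

/-- The `L²` norm as a real number. -/
def nrm (μ : Measure α) (f : α → ℝ) : ℝ := (eLpNorm f 2 μ).toReal

theorem nrm_nonneg (μ : Measure α) (f : α → ℝ) : 0 ≤ nrm μ f := ENNReal.toReal_nonneg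

theorem nrm_congr (h : f =ᵐ[μ] g) : nrm μ f = nrm μ g := by
  unfold nrm; rw [eLpNorm_congr_ae h]

theorem nrm_add_le (hf : MemLp f 2 μ) (hg : MemLp g 2 μ) :
    nrm μ (fun x => f x + g x) ≤ nrm μ f + nrm μ g := by
  unfold nrm
  rw [← ENNReal.toReal_add hf.2.ne hg.2.ne]
  exact ENNReal.toReal_mono (ENNReal.add_lt_top.2 ⟨hf.2, hg.2⟩).ne
    (eLpNorm_add_le hf.1 hg.1 (by norm_num))

theorem nrm_sub_le (hf : MemLp f 2 μ) (hg : MemLp g 2 μ) :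
    nrm μ (fun x => f x - g x) ≤ nrm μ f + nrm μ g := by
  unfold nrm
  rw [← ENNReal.toReal_add hf.2.ne hg.2.ne]
  exact ENNReal.toReal_mono (ENNReal.add_lt_top.2 ⟨hf.2, hg.2⟩).ne
    (eLpNorm_sub_le hf.1 hg.1 (by norm_num))

theorem nrm_const_mul (c : ℝ) (f : α → ℝ) : nrm μ (fun x => c * f x) = |c| * nrm μ f := by
  unfold nrm
  have := eLpNorm_const_smul c f 2 μ
  have h2 : (c • f) = fun x => c * f x := rfl
  rw [h2] at this
  rw [this, ENNReal.toReal_mul]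
  simp

theorem nrm_mono (hg : MemLp g 2 μ) (h : ∀ᵐ x ∂μ, |f x| ≤ |g x|) : nrm μ f ≤ nrm μ g :=
  ENNReal.toReal_mono hg.2.ne (eLpNorm_mono_ae h)

theorem nrm_le_const_mul {c : ℝ} (hc : 0 ≤ c) (hg : MemLp g 2 μ)
    (h : ∀ᵐ x ∂μ, |f x| ≤ c * |g x|) : nrm μ f ≤ c * nrm μ g := by
  rw [← abs_of_nonneg hc, ← nrm_const_mul]
  refine nrm_mono (hg.const_mul c) ?_
  filter_upwards [h] with x hx
  rwa [abs_mul, abs_of_nonneg hc]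

theorem nrm_abs (f : α → ℝ) : nrm μ (fun x => |f x|) = nrm μ f := by
  unfold nrm
  congr 1
  exact eLpNorm_norm f

theorem nrm_sq (hf : MemLp f 2 μ) : nrm μ f ^ 2 = ∫ x, f x ^ 2 ∂μ := by
  have h := hf.eLpNorm_eq_integral_rpow_norm (by norm_num) (by norm_num)
  have h0 : 0 ≤ ∫ x, f x ^ 2 ∂μ := integral_nonneg fun x => sq_nonneg _
  unfold nrm
  rw [h, ENNReal.toReal_ofReal (by positivity)]
  simp only [ENNReal.toReal_ofNat, Real.norm_eq_abs]
  have : ∀ x, |f x| ^ (2:ℝ) = f x ^ 2 := fun x => by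
    rw [Real.rpow_two, sq_abs]
  simp only [this]
  rw [← Real.rpow_natCast, ← Real.rpow_mul h0]
  norm_num

theorem integrable_mul (hf : MemLp f 2 μ) (hg : MemLp g 2 μ) :
    Integrable (fun x => f x * g x) μ := MemLp.integrable_mul hf hg

theorem integrable_sq (hf : MemLp f 2 μ) : Integrable (fun x => f x ^ 2) μ := by
  simpa [sq] using integrable_mul hf hf

theorem integral_mul_eq_inner (hf : MemLp f 2 μ) (hg : MemLp g 2 μ) :
    ∫ x, f x * g x ∂μ = inner ℝ (hf.toLp f) (hg.toLp g) := by
  rw [L2.inner_def]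
  refine integral_congr_ae ?_
  filter_upwards [hf.coeFn_toLp, hg.coeFn_toLp] with x h1 h2
  simp [h1, h2, mul_comm]

theorem norm_toLp_eq_nrm (hf : MemLp f 2 μ) : ‖hf.toLp f‖ = nrm μ f := by
  rw [Lp.norm_toLp]; rfl

theorem abs_integral_mul_le (hf : MemLp f 2 μ) (hg : MemLp g 2 μ) :
    |∫ x, f x * g x ∂μ| ≤ nrm μ f * nrm μ g := by
  rw [integral_mul_eq_inner hf hg, ← norm_toLp_eq_nrm hf, ← norm_toLp_eq_nrm hg]
  exact abs_real_inner_le_norm _ _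

theorem memLp_sum {ι : Type*} (s : Finset ι) {f : ι → α → ℝ} (h : ∀ i ∈ s, MemLp (f i) 2 μ) :
    MemLp (fun x => ∑ i ∈ s, f i x) 2 μ := memLp_finsetSum s h

theorem nrm_sum_le {ι : Type*} (s : Finset ι) {f : ι → α → ℝ} (h : ∀ i, MemLp (f i) 2 μ) :
    nrm μ (fun x => ∑ i ∈ s, f i x) ≤ ∑ i ∈ s, nrm μ (f i) := by
  classical
  induction s using Finset.induction_on with
  | empty => simp [nrm]
  | insert a s ha ih =>
    simp only [Finset.sum_insert ha]
    exact (nrm_add_le (h a) (memLp_sum s fun i _ => h i)).trans (by gcongr)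

/-- An `L²` function dominated almost everywhere by a multiple of an `L²` function. -/
theorem memLp_of_le {c : ℝ} (hg : MemLp g 2 μ) (hf : AEStronglyMeasurable f μ)
    (h : ∀ᵐ x ∂μ, |f x| ≤ c * |g x|) : MemLp f 2 μ := hg.of_le_mul hf h

theorem nrm_sub_tendsto {f : ℕ → α → ℝ} (hf : ∀ n, MemLp (f n) 2 μ) (hg : MemLp g 2 μ)
    (h : Tendsto (fun n => nrm μ (fun x => f n x - g x)) atTop (𝓝 0)) :
    Tendsto (fun n => nrm μ (f n)) atTop (𝓝 (nrm μ g)) := by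
  rw [tendsto_iff_dist_tendsto_zero]
  refine squeeze_zero (fun _ => dist_nonneg) (fun n => ?_) h
  rw [Real.dist_eq, abs_sub_le_iff]
  constructor
  · have := nrm_add_le ((hf n).sub hg) hg
    simp only [Pi.sub_apply, sub_add_cancel] at this
    change nrm μ (f n) ≤ nrm μ (fun x => f n x - g x) + _ at this
    linarith
  · have := nrm_sub_le (hf n) ((hf n).sub hg)
    simp only [Pi.sub_apply, sub_sub_cancel] at this
    change nrm μ g ≤ _ + nrm μ (fun x => f n x - g x) at this
    linarith

/-- Fatou's lemma in `L²`. -/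
theorem memLp_of_tendsto_ae {f : ℕ → α → ℝ} {B : ℝ} (hf : ∀ n, MemLp (f n) 2 μ)
    (hB : ∀ n, nrm μ (f n) ≤ B) (h : ∀ᵐ x ∂μ, Tendsto (fun n => f n x) atTop (𝓝 (g x))) :
    MemLp g 2 μ ∧ nrm μ g ≤ B := by
  have hB0 : 0 ≤ B := (nrm_nonneg _ _).trans (hB 0)
  have h1 : eLpNorm g 2 μ ≤ ENNReal.ofReal B := by
    refine (Lp.eLpNorm_lim_le_liminf_eLpNorm (fun n => (hf n).1) g h).trans ?_
    refine (liminf_le_liminf (v := fun _ => ENNReal.ofReal B)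
      (Eventually.of_forall fun n => ?_)).trans (by simp)
    rw [← ENNReal.ofReal_toReal (hf n).2.ne]
    exact ENNReal.ofReal_le_ofReal (hB n)
  refine ⟨⟨aestronglyMeasurable_of_tendsto_ae atTop (fun n => (hf n).1) h,
    h1.trans_lt ENNReal.ofReal_lt_top⟩, ?_⟩
  exact ENNReal.toReal_le_of_le_ofReal hB0 h1

theorem exists_subseq_ae {f : ℕ → α → ℝ} (hf : ∀ n, MemLp (f n) 2 μ) (hg : MemLp g 2 μ)
    (h : Tendsto (fun n => nrm μ (fun x => f n x - g x)) atTop (𝓝 0)) :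
    ∃ ns : ℕ → ℕ, StrictMono ns ∧
      ∀ᵐ x ∂μ, Tendsto (fun n => f (ns n) x) atTop (𝓝 (g x)) := by
  refine TendstoInMeasure.exists_seq_tendsto_ae (tendstoInMeasure_of_tendsto_eLpNorm (p := 2)
    (by norm_num) (fun n => (hf n).1) hg.1 ?_)
  have := (ENNReal.tendsto_ofReal h)
  simp only [ENNReal.ofReal_zero] at this
  refine this.congr fun n => ?_
  exact ENNReal.ofReal_toReal ((hf n).sub hg).2.ne

/-- Limits of integrals of products against a fixed `L²` function. -/
theorem tendsto_integral_mul {f : ℕ → α → ℝ} {k : α → ℝ} (hf : ∀ n, MemLp (f n) 2 μ)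
    (hg : MemLp g 2 μ) (hk : MemLp k 2 μ)
    (h : Tendsto (fun n => nrm μ (fun x => f n x - g x)) atTop (𝓝 0)) :
    Tendsto (fun n => ∫ x, k x * f n x ∂μ) atTop (𝓝 (∫ x, k x * g x ∂μ)) := by
  rw [tendsto_iff_dist_tendsto_zero]
  have h2 : Tendsto (fun n => nrm μ k * nrm μ (fun x => f n x - g x)) atTop (𝓝 0) := by
    simpa using h.const_mul (nrm μ k)
  refine squeeze_zero (fun _ => dist_nonneg) (fun n => ?_) h2
  rw [Real.dist_eq, ← integral_sub (integrable_mul hk (hf n)) (integrable_mul hk hg)]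
  simp only [← mul_sub]
  exact abs_integral_mul_le hk ((hf n).sub hg)

end L2

/-! ### Elementary facts on the domain and the weight -/

theorem isOpen_halfSpace : IsOpen halfSpace :=
  isOpen_lt (by fun_prop) continuous_const

theorem measurableSet_halfSpace : MeasurableSet halfSpace := isOpen_halfSpace.measurableSet

/-- Lebesgue measure on the half space. -/
abbrev hsVol : Measure E3 := volume.restrict halfSpace

theorem rho_sq (x : E3) : rho x ^ 2 = 1 + ‖x‖ ^ 2 := Real.sq_sqrt (by positivity)

theorem one_le_rho (x : E3) : 1 ≤ rho x := by
  unfold rho; rw [Real.one_le_sqrt]; nlinarith [sq_nonneg ‖x‖]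

theorem rho_pos (x : E3) : 0 < rho x := lt_of_lt_of_le one_pos (one_le_rho x)

theorem norm_le_rho (x : E3) : ‖x‖ ≤ rho x :=
  Real.le_sqrt_of_sq_le (by linarith)

theorem contDiff_rho : ContDiff ℝ ∞ rho := by
  unfold rho
  refine ContDiff.sqrt (contDiff_const.add (contDiff_norm_sq ℝ)) fun x => ?_
  positivity

theorem continuous_rho : Continuous rho := contDiff_rho.continuous

theorem rho_inv_le_one (x : E3) : (rho x)⁻¹ ≤ 1 := inv_le_one_of_one_le₀ (one_le_rho x)

theorem rho_inv_pos (x : E3) : 0 < (rho x)⁻¹ := inv_pos.2 (rho_pos x)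

theorem contDiff_rho_inv : ContDiff ℝ ∞ (fun x => (rho x)⁻¹) :=
  contDiff_rho.inv fun x => (rho_pos x).ne'

theorem continuous_rho_inv : Continuous (fun x => (rho x)⁻¹) := contDiff_rho_inv.continuous

/-- All difference quotients below use steps of length at most one, so a weight can be moved along a
step at the price of a factor two. -/
theorem rho_le_two_mul (x y : E3) (h : ‖x - y‖ ≤ 1) : rho x ≤ 2 * rho y := by
  have h1 : ‖x‖ ≤ ‖y‖ + 1 := by
    have := norm_le_norm_add_norm_sub y x
    rw [norm_sub_rev] at this; linarith
  have h2 := rho_sq x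
  have h3 := rho_sq y
  have h4 := rho_pos x
  have h5 := rho_pos y
  have h6 := norm_nonneg x
  have h7 := norm_nonneg y
  refine abs_le_of_sq_le_sq' (by nlinarith [sq_nonneg (‖y‖-1)]) (by positivity) |>.2

/-! ### Classical partial derivatives -/

theorem mlen_idx (j : Fin 3) : mlen (idx j) = 1 := by
  simp [mlen, idx]

theorem mderiv_idx (j : Fin 3) (φ : E3 → ℝ) : mderiv (idx j) φ = pderiv j φ := by
  fin_cases j <;> simp [mderiv, idx]

theorem contDiff_pderiv {φ : E3 → ℝ} (h : ContDiff ℝ ∞ φ) (j : Fin 3) :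
    ContDiff ℝ ∞ (pderiv j φ) :=
  (h.fderiv_right (m := ∞) (by simp)).clm_apply contDiff_const

theorem tsupport_pderiv {φ : E3 → ℝ} (j : Fin 3) : tsupport (pderiv j φ) ⊆ tsupport φ :=
  tsupport_fderiv_apply_subset ℝ _

theorem hasCompactSupport_pderiv {φ : E3 → ℝ} (h : HasCompactSupport φ) (j : Fin 3) :
    HasCompactSupport (pderiv j φ) := h.fderiv_apply ℝ _

theorem IsTest.pderiv {Ω : Set E3} {φ : E3 → ℝ} (h : IsTest Ω φ) (j : Fin 3) :
    IsTest Ω (pderiv j φ) :=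
  ⟨contDiff_pderiv h.1 j, hasCompactSupport_pderiv h.2.1 j, (tsupport_pderiv j).trans h.2.2⟩

theorem pderiv_mul {φ ψ : E3 → ℝ} {x : E3} (hφ : DifferentiableAt ℝ φ x)
    (hψ : DifferentiableAt ℝ ψ x) (j : Fin 3) :
    pderiv j (fun y => φ y * ψ y) x = φ x * pderiv j ψ x + pderiv j φ x * ψ x := by
  unfold LameHalfSpace.pderiv
  rw [fderiv_fun_mul hφ hψ]
  simp [mul_comm]

theorem pderiv_add {φ ψ : E3 → ℝ} {x : E3} (hφ : DifferentiableAt ℝ φ x)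
    (hψ : DifferentiableAt ℝ ψ x) (j : Fin 3) :
    pderiv j (fun y => φ y + ψ y) x = pderiv j φ x + pderiv j ψ x := by
  unfold LameHalfSpace.pderiv
  rw [fderiv_fun_add hφ hψ]; rfl

theorem pderiv_const_mul {φ : E3 → ℝ} {x : E3} (c : ℝ) (hφ : DifferentiableAt ℝ φ x)
    (j : Fin 3) : pderiv j (fun y => c * φ y) x = c * pderiv j φ x := by
  unfold LameHalfSpace.pderiv
  rw [fderiv_const_mul hφ]; rfl

theorem pderiv_comm {φ : E3 → ℝ} (h : ContDiff ℝ ∞ φ) (j k : Fin 3) :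
    pderiv j (pderiv k φ) = pderiv k (pderiv j φ) := by
  have key : ∀ (v w : E3) x, fderiv ℝ (fun y => fderiv ℝ φ y v) x w
      = fderiv ℝ (fderiv ℝ φ) x w v := fun v w x => by
    have hd : DifferentiableAt ℝ (fderiv ℝ φ) x :=
      ((h.fderiv_right (m := ∞) (by simp)).differentiable (by simp)) x
    rw [fderiv_clm_apply hd (differentiableAt_const _)]
    simp
  ext x
  unfold LameHalfSpace.pderiv
  rw [key, key]
  have hs : IsSymmSndFDerivAt ℝ φ x := by
    apply ContDiffAt.isSymmSndFDerivAt (n := ∞) h.contDiffAt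
    rw [minSmoothness_of_isRCLikeNormedField]
    exact WithTop.coe_le_coe.2 le_top
  exact hs.eq _ _

theorem pderiv_comp_linear {φ : E3 → ℝ} (h : ContDiff ℝ ∞ φ) (L : E3 →L[ℝ] E3) (j : Fin 3)
    (x : E3) : pderiv j (fun y => φ (L y)) x = fderiv ℝ φ (L x) (L (EuclideanSpace.single j 1)) := by
  unfold LameHalfSpace.pderiv
  have := (h.differentiable (by simp)).differentiableAt (x := L x)
  have h2 := (this.hasFDerivAt.comp x L.hasFDerivAt).fderiv
  change fderiv ℝ (φ ∘ L) x _ = _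
  rw [h2]; rfl

theorem pderiv_translate (φ : E3 → ℝ) (a : E3) (j : Fin 3) :
    pderiv j (fun y => φ (y + a)) = fun x => pderiv j φ (x + a) := by
  ext x; unfold LameHalfSpace.pderiv; rw [fderiv_comp_add_right]

/-- Integration by parts for smooth functions. -/
theorem integral_pderiv_mul {φ ψ : E3 → ℝ} (hφ : ContDiff ℝ ∞ φ) (hψ : ContDiff ℝ ∞ ψ)
    (hc : HasCompactSupport ψ) (j : Fin 3) :
    ∫ x, φ x * pderiv j ψ x = - ∫ x, pderiv j φ x * ψ x := by
  refine integral_mul_fderiv_eq_neg_fderiv_mul_of_integrable ?_ ?_ ?_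
    (fun x _ => (hφ.differentiable (by simp)) x) (fun x _ => (hψ.differentiable (by simp)) x)
  · exact ((contDiff_pderiv hφ j).continuous.mul hψ.continuous).integrable_of_hasCompactSupport
      hc.mul_left
  · exact (hφ.continuous.mul (contDiff_pderiv hψ j).continuous).integrable_of_hasCompactSupport
      (hasCompactSupport_pderiv hc j).mul_left
  · exact (hφ.continuous.mul hψ.continuous).integrable_of_hasCompactSupport hc.mul_left

/-! ### Calculus of weak derivatives -/

section Weak
variable {Ω : Set E3} {f g h f' g' : E3 → ℝ} {j k : Fin 3} {κ : Fin 3 → ℕ}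

theorem integrableOn_mul_of_tsupport_subset (hf : LocallyIntegrableOn f Ω) {φ : E3 → ℝ}
    (hφ : Continuous φ) (hc : HasCompactSupport φ) (hs : tsupport φ ⊆ Ω) :
    IntegrableOn (fun x => f x * φ x) Ω := by
  have h1 : IntegrableOn f (tsupport φ) := hf.integrableOn_compact_subset hs hc
  have h2 : IntegrableOn (fun x => f x * φ x) (tsupport φ) :=
    h1.mul_continuousOn hφ.continuousOn hc
  refine ((integrableOn_iff_integrable_of_support_subset ?_).1 h2).integrableOn
  intro x hx
  exact subset_tsupport _ (right_ne_zero_of_mul hx)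

theorem isWeakDeriv_idx : IsWeakDeriv Ω (idx j) f g ↔ LocallyIntegrableOn f Ω ∧
    LocallyIntegrableOn g Ω ∧ ∀ φ, IsTest Ω φ →
      ∫ x in Ω, f x * pderiv j φ x = - ∫ x in Ω, g x * φ x := by
  simp [IsWeakDeriv, mderiv_idx, mlen_idx]

/-- The fundamental lemma of the calculus of variations, applied to `g - h`. It makes the chosen
representative `weakDeriv` interchangeable with any explicit weak derivative. -/
theorem IsWeakDeriv.unique (hΩ : IsOpen Ω) (h1 : IsWeakDeriv Ω κ f g)
    (h2 : IsWeakDeriv Ω κ f h) : g =ᵐ[volume.restrict Ω] h := by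
  have hl : LocallyIntegrableOn (fun x => g x - h x) Ω := h1.2.1.sub h2.2.1
  have := hΩ.ae_eq_zero_of_integral_contDiff_smul_eq_zero hl fun φ hφ hc hs => by
    have e1 := h1.2.2 φ ⟨hφ, hc, hs⟩
    rw [h2.2.2 φ ⟨hφ, hc, hs⟩] at e1
    have e2 := mul_left_cancel₀ (by simp) e1
    have i1 := integrableOn_mul_of_tsupport_subset h1.2.1 hφ.continuous hc hs
    have i2 := integrableOn_mul_of_tsupport_subset h2.2.1 hφ.continuous hc hs
    have hsupp : ∫ x in Ω, (g x - h x) * φ x = ∫ x, φ x • (g x - h x) := by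
      simp only [smul_eq_mul, mul_comm (φ _)]
      refine setIntegral_eq_integral_of_forall_compl_eq_zero fun x hx => ?_
      rw [image_eq_zero_of_notMem_tsupport fun hx' => hx (hs hx'), mul_zero]
    rw [← hsupp]
    simp only [sub_mul]
    rw [integral_sub i1 i2, e2, sub_self]
  rw [EventuallyEq, ae_restrict_iff' hΩ.measurableSet]
  filter_upwards [this] with x hx hxΩ
  exact sub_eq_zero.1 (hx hxΩ)

theorem IsWeakDeriv.weakDeriv (h1 : IsWeakDeriv Ω κ f g) :
    IsWeakDeriv Ω κ f (weakDeriv Ω κ f) := by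
  have hex : ∃ g, IsWeakDeriv Ω κ f g := ⟨g, h1⟩
  rw [LameHalfSpace.weakDeriv, dif_pos hex]
  exact hex.choose_spec

theorem IsWeakDeriv.weakDeriv_ae (hΩ : IsOpen Ω) (h1 : IsWeakDeriv Ω κ f g) :
    LameHalfSpace.weakDeriv Ω κ f =ᵐ[volume.restrict Ω] g := h1.weakDeriv.unique hΩ h1

theorem IsWeakDeriv.congr (h1 : IsWeakDeriv Ω κ f g) (hf : f =ᵐ[volume.restrict Ω] f')
    (hg : g =ᵐ[volume.restrict Ω] g') : IsWeakDeriv Ω κ f' g' := by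
  refine ⟨h1.1.congr hf, h1.2.1.congr hg, fun φ hφ => ?_⟩
  have e1 : ∫ x in Ω, f' x * mderiv κ φ x = ∫ x in Ω, f x * mderiv κ φ x :=
    integral_congr_ae (hf.symm.mono fun x hx => by simp only [hx])
  have e2 : ∫ x in Ω, g' x * φ x = ∫ x in Ω, g x * φ x :=
    integral_congr_ae (hg.symm.mono fun x hx => by simp only [hx])
  rw [e1, e2, h1.2.2 φ hφ]

theorem IsWeakDeriv.add (h1 : IsWeakDeriv Ω (idx j) f g) (h2 : IsWeakDeriv Ω (idx j) f' g') :
    IsWeakDeriv Ω (idx j) (fun x => f x + f' x) (fun x => g x + g' x) := by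
  rw [isWeakDeriv_idx] at *
  refine ⟨h1.1.add h2.1, h1.2.1.add h2.2.1, fun φ hφ => ?_⟩
  have hd := hφ.pderiv j
  simp only [add_mul]
  rw [integral_add (integrableOn_mul_of_tsupport_subset h1.1 hd.1.continuous hd.2.1 hd.2.2)
    (integrableOn_mul_of_tsupport_subset h2.1 hd.1.continuous hd.2.1 hd.2.2),
    integral_add (integrableOn_mul_of_tsupport_subset h1.2.1 hφ.1.continuous hφ.2.1 hφ.2.2)
    (integrableOn_mul_of_tsupport_subset h2.2.1 hφ.1.continuous hφ.2.1 hφ.2.2),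
    h1.2.2 φ hφ, h2.2.2 φ hφ]
  ring

theorem IsWeakDeriv.const_mul (h1 : IsWeakDeriv Ω (idx j) f g) (c : ℝ) :
    IsWeakDeriv Ω (idx j) (fun x => c * f x) (fun x => c * g x) := by
  rw [isWeakDeriv_idx] at *
  refine ⟨h1.1.smul c, h1.2.1.smul c, fun φ hφ => ?_⟩
  simp only [mul_assoc, integral_const_mul, h1.2.2 φ hφ]
  ring

theorem _root_.MeasureTheory.LocallyIntegrableOn.mul_cont (hΩ : IsOpen Ω)
    (hf : LocallyIntegrableOn f Ω) {w : E3 → ℝ}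
    (hw : ContinuousOn w Ω) : LocallyIntegrableOn (fun x => w x * f x) Ω :=
  hf.continuousOn_mul hw hΩ.isLocallyClosed

theorem IsTest.mul_smooth {φ w : E3 → ℝ} (hφ : IsTest Ω φ) (hw : ContDiff ℝ ∞ w) :
    IsTest Ω (fun x => w x * φ x) :=
  ⟨hw.mul hφ.1, hφ.2.1.mul_left, (tsupport_mul_subset_right).trans hφ.2.2⟩

/-- Leibniz rule: `w φ` is again a test function, so the defining identity of `g` may be used with
it. -/
theorem IsWeakDeriv.smooth_mul (hΩ : IsOpen Ω) (h1 : IsWeakDeriv Ω (idx j) f g) {w : E3 → ℝ}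
    (hw : ContDiff ℝ ∞ w) :
    IsWeakDeriv Ω (idx j) (fun x => w x * f x) (fun x => w x * g x + pderiv j w x * f x) := by
  rw [isWeakDeriv_idx] at *
  have hc1 : LocallyIntegrableOn (fun x => w x * g x) Ω :=
    h1.2.1.mul_cont hΩ hw.continuous.continuousOn
  have hc2 : LocallyIntegrableOn (fun x => pderiv j w x * f x) Ω :=
    h1.1.mul_cont hΩ (contDiff_pderiv hw j).continuous.continuousOn
  have hc0 : LocallyIntegrableOn (fun x => w x * f x) Ω :=
    h1.1.mul_cont hΩ hw.continuous.continuousOn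
  refine ⟨hc0, hc1.add hc2, fun φ hφ => ?_⟩
  have e := h1.2.2 _ (hφ.mul_smooth hw)
  have e1 : ∀ x, pderiv j (fun y => w y * φ y) x = w x * pderiv j φ x + pderiv j w x * φ x :=
    fun x => pderiv_mul ((hw.differentiable (by simp)) x) ((hφ.1.differentiable (by simp)) x) j
  simp only [e1, mul_add] at e
  have hd := hφ.pderiv j
  have i0 := integrableOn_mul_of_tsupport_subset hc0 hd.1.continuous hd.2.1 hd.2.2
  have i1 := integrableOn_mul_of_tsupport_subset hc1 hφ.1.continuous hφ.2.1 hφ.2.2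
  have i2 := integrableOn_mul_of_tsupport_subset hc2 hφ.1.continuous hφ.2.1 hφ.2.2
  simp only [add_mul]
  rw [integral_add i1 i2]
  rw [integral_add (by simpa [IntegrableOn, mul_assoc, mul_comm, mul_left_comm] using i0)
    (by simpa [IntegrableOn, mul_assoc, mul_comm, mul_left_comm] using i2)] at e
  have r0 : ∫ x in Ω, w x * f x * pderiv j φ x = ∫ x in Ω, f x * (w x * pderiv j φ x) := by
    congr 1; ext x; ring
  have r1 : ∫ x in Ω, w x * g x * φ x = ∫ x in Ω, g x * (w x * φ x) := by
    congr 1; ext x; ring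
  have r2 : ∫ x in Ω, pderiv j w x * f x * φ x = ∫ x in Ω, f x * (pderiv j w x * φ x) := by
    congr 1; ext x; ring
  rw [r0, r1, r2]
  linarith

theorem mderiv_idx_add {φ : E3 → ℝ} (hφ : ContDiff ℝ ∞ φ) (j k : Fin 3) :
    mderiv (idx j + idx k) φ = pderiv j (pderiv k φ) := by
  fin_cases j <;> fin_cases k <;> simp [mderiv, idx] <;> exact pderiv_comm hφ _ _

theorem mlen_idx_add (j k : Fin 3) : mlen (idx j + idx k) = 2 := by
  simp [mlen, idx, Finset.sum_add_distrib]

theorem IsWeakDeriv.comp (h1 : IsWeakDeriv Ω (idx j) f g) (h2 : IsWeakDeriv Ω (idx k) g h) :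
    IsWeakDeriv Ω (idx j + idx k) f h := by
  refine ⟨h1.1, h2.2.1, fun φ hφ => ?_⟩
  rw [mderiv_idx_add hφ.1, mlen_idx_add, (isWeakDeriv_idx.1 h1).2.2 _ (hφ.pderiv k),
    (isWeakDeriv_idx.1 h2).2.2 _ hφ]
  norm_num

/-- Together with `IsWeakDeriv.comp` and commutativity of `idx j + idx k`, this exchanges the order
of two weak derivatives: if one order exists, so does the other. -/
theorem IsWeakDeriv.of_comp (h1 : IsWeakDeriv Ω (idx j) f g)
    (h2 : IsWeakDeriv Ω (idx j + idx k) f h) : IsWeakDeriv Ω (idx k) g h := by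
  refine isWeakDeriv_idx.2 ⟨h1.2.1, h2.2.1, fun φ hφ => ?_⟩
  have e := h2.2.2 φ hφ
  rw [mderiv_idx_add hφ.1, mlen_idx_add, (isWeakDeriv_idx.1 h1).2.2 _ (hφ.pderiv k)] at e
  norm_num at e
  linarith

theorem isWeakDeriv_zero_idx (hf : LocallyIntegrableOn f Ω) : IsWeakDeriv Ω 0 f f :=
  ⟨hf, hf, fun φ _ => by simp [mderiv, mlen]⟩

/-- The spaces `MemH` quantify over multi-indices, while the analysis uses iterated first
derivatives; this translates between them up to order two. -/
theorem multiindex_cases {κ : Fin 3 → ℕ} (h : mlen κ ≤ 2) :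
    κ = 0 ∨ (∃ j, κ = idx j) ∨ ∃ j k, κ = idx j + idx k := by
  have key : ∀ a b c : ℕ, a + b + c ≤ 2 → κ 0 = a → κ 1 = b → κ 2 = c → κ = ![a, b, c] := by
    intro a b c _ h0 h1 h2
    ext i; fin_cases i <;> simp [h0, h1, h2]
  have hs : κ 0 + κ 1 + κ 2 ≤ 2 := by simpa [mlen, Fin.sum_univ_three] using h
  have := key _ _ _ hs rfl rfl rfl
  generalize κ 0 = a at *
  generalize κ 1 = b at *
  generalize κ 2 = c at *
  subst this
  by_cases h0 : a + b + c = 0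
  · left; ext i; fin_cases i <;> simp <;> omega
  by_cases h1 : a + b + c = 1
  · right; left
    rcases (show a = 1 ∨ b = 1 ∨ c = 1 by omega) with h | h | h
    · exact ⟨0, by ext i; fin_cases i <;> simp [idx] <;> omega⟩
    · exact ⟨1, by ext i; fin_cases i <;> simp [idx] <;> omega⟩
    · exact ⟨2, by ext i; fin_cases i <;> simp [idx] <;> omega⟩
  right; right
  have h2 : a + b + c = 2 := by omega
  rcases (show a = 2 ∨ b = 2 ∨ c = 2 ∨ (a = 1 ∧ b = 1) ∨ (a = 1 ∧ c = 1) ∨ (b = 1 ∧ c = 1)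
    by omega) with h | h | h | h | h | h
  · exact ⟨0, 0, by ext i; fin_cases i <;> simp [idx] <;> omega⟩
  · exact ⟨1, 1, by ext i; fin_cases i <;> simp [idx] <;> omega⟩
  · exact ⟨2, 2, by ext i; fin_cases i <;> simp [idx] <;> omega⟩
  · exact ⟨0, 1, by ext i; fin_cases i <;> simp [idx] <;> omega⟩
  · exact ⟨0, 2, by ext i; fin_cases i <;> simp [idx] <;> omega⟩
  · exact ⟨1, 2, by ext i; fin_cases i <;> simp [idx] <;> omega⟩

/-- Translation by a vector that preserves the domain. -/
theorem IsWeakDeriv.translate (h1 : IsWeakDeriv Ω (idx j) f g) (a : E3)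
    (ha : ∀ x, x + a ∈ Ω ↔ x ∈ Ω) :
    IsWeakDeriv Ω (idx j) (fun x => f (x + a)) (fun x => g (x + a)) := by
  have hmp : MeasurePreserving (fun x : E3 => x + a) (volume.restrict Ω) (volume.restrict Ω) := by
    have h0 := measurePreserving_add_right (volume : Measure E3) a
    have := h0.restrict_preimage_emb (Homeomorph.addRight a).measurableEmbedding Ω
    have hpre : (fun x : E3 => x + a) ⁻¹' Ω = Ω := by ext x; exact ha x
    rwa [hpre] at this
  have hloc : ∀ f : E3 → ℝ, LocallyIntegrableOn f Ω →
      LocallyIntegrableOn (fun x => f (x + a)) Ω := by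
    intro f hf x hx
    obtain ⟨s, hs, hfs⟩ := hf (x + a) ((ha x).2 hx)
    refine ⟨(fun x => x + a) ⁻¹' s, ?_, ?_⟩
    · refine (tendsto_nhdsWithin_iff.2 ⟨?_, ?_⟩ : Tendsto (fun x : E3 => x + a) (𝓝[Ω] x)
        (𝓝[Ω] (x + a))) hs
      · exact (continuous_add_const a).continuousAt.tendsto.mono_left nhdsWithin_le_nhds
      · filter_upwards [self_mem_nhdsWithin] with y hy
        exact (ha y).2 hy
    · have h0 := measurePreserving_add_right (volume : Measure E3) a
      exact (h0.integrableOn_comp_preimage (Homeomorph.addRight a).measurableEmbedding).2 hfs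
  rw [isWeakDeriv_idx] at *
  refine ⟨hloc _ h1.1, hloc _ h1.2.1, fun φ hφ => ?_⟩
  have hφ' : IsTest Ω (fun x => φ (x + -a)) := by
    refine ⟨hφ.1.comp (contDiff_id.add contDiff_const),
      hφ.2.1.comp_homeomorph (Homeomorph.addRight (-a)), ?_⟩
    have := tsupport_comp_eq_preimage φ (Homeomorph.addRight (-a))
    change tsupport (φ ∘ Homeomorph.addRight (-a)) ⊆ Ω
    rw [this]
    intro x hx
    have : x + -a ∈ Ω := hφ.2.2 hx
    have h2 := (ha (x + -a)).2 this
    simpa using h2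
  have e := h1.2.2 _ hφ'
  rw [pderiv_translate] at e
  have c1 := hmp.integral_comp (Homeomorph.addRight a).measurableEmbedding
    (fun x => f x * pderiv j φ (x + -a))
  have c2 := hmp.integral_comp (Homeomorph.addRight a).measurableEmbedding
    (fun x => g x * φ (x + -a))
  rw [← c1, ← c2] at e
  simpa using e

theorem memLp_locallyIntegrableOn (hΩ : IsOpen Ω) {w : E3 → ℝ} (hw : ContinuousOn w Ω)
    (hw0 : ∀ x ∈ Ω, w x ≠ 0)
    (h : MemLp (fun x => w x * f x) 2 (volume.restrict Ω)) : LocallyIntegrableOn f Ω := by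
  have h1 : LocallyIntegrableOn (fun x => w x * f x) Ω :=
    locallyIntegrableOn_of_locallyIntegrable_restrict (h.locallyIntegrable (by norm_num))
  refine (h1.mul_cont hΩ (hw.inv₀ hw0)).congr ?_
  filter_upwards [ae_restrict_mem hΩ.measurableSet] with x hx
  simp [hw0 x hx]

theorem _root_.MeasureTheory.MemLp.locInt (h : MemLp f 2 (volume.restrict Ω)) :
    LocallyIntegrableOn f Ω :=
  locallyIntegrableOn_of_locallyIntegrable_restrict (h.locallyIntegrable (by norm_num))

end Weak

/-! ### The space `H^1_0` -/

/-- `u ∈ H^1_0(Ω)` with weak gradient `G`. -/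
structure H1 (Ω : Set E3) (u : E3 → ℝ) (G : Fin 3 → E3 → ℝ) : Prop where
  deriv : ∀ j, IsWeakDeriv Ω (idx j) u (G j)
  mem : MemLp (fun x => (rho x)⁻¹ * u x) 2 (volume.restrict Ω)
  gmem : ∀ j, MemLp (G j) 2 (volume.restrict Ω)

section H1
variable {Ω : Set E3} {u v : E3 → ℝ} {G F : Fin 3 → E3 → ℝ}

theorem H1.add (h1 : H1 Ω u G) (h2 : H1 Ω v F) :
    H1 Ω (fun x => u x + v x) (fun j x => G j x + F j x) :=
  ⟨fun j => (h1.deriv j).add (h2.deriv j), by simp only [mul_add]; exact h1.mem.add h2.mem,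
    fun j => (h1.gmem j).add (h2.gmem j)⟩

theorem H1.const_mul (h1 : H1 Ω u G) (c : ℝ) :
    H1 Ω (fun x => c * u x) (fun j x => c * G j x) :=
  ⟨fun j => (h1.deriv j).const_mul c, by simpa [mul_left_comm] using h1.mem.const_mul c,
    fun j => (h1.gmem j).const_mul c⟩

theorem H1.sub (h1 : H1 Ω u G) (h2 : H1 Ω v F) :
    H1 Ω (fun x => u x - v x) (fun j x => G j x - F j x) := by
  simpa [sub_eq_add_neg] using h1.add (h2.const_mul (-1))

theorem H1.congr (h1 : H1 Ω u G) (hu : u =ᵐ[volume.restrict Ω] v)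
    (hG : ∀ j, G j =ᵐ[volume.restrict Ω] F j) : H1 Ω v F :=
  ⟨fun j => (h1.deriv j).congr hu (hG j),
    h1.mem.ae_eq (hu.mono fun x hx => by simp only [hx]), fun j => (h1.gmem j).ae_eq (hG j)⟩

theorem H1.smooth {φ : E3 → ℝ} (hφ : ContDiff ℝ ∞ φ) (hc : HasCompactSupport φ) :
    H1 Ω φ (fun j => pderiv j φ) := by
  have hmem : ∀ g : E3 → ℝ, Continuous g → HasCompactSupport g →
      MemLp g 2 (volume.restrict Ω) := fun g hg hgc =>
    (hg.memLp_of_hasCompactSupport hgc).restrict Ω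
  refine ⟨fun j => isWeakDeriv_idx.2 ⟨(hφ.continuous.locallyIntegrable).locallyIntegrableOn _,
    ((contDiff_pderiv hφ j).continuous.locallyIntegrable).locallyIntegrableOn _,
    fun ψ hψ => ?_⟩, ?_, fun j => ?_⟩
  · rw [setIntegral_eq_integral_of_forall_compl_eq_zero,
      setIntegral_eq_integral_of_forall_compl_eq_zero, integral_pderiv_mul hφ hψ.1 hψ.2.1]
    · intro x hx
      rw [image_eq_zero_of_notMem_tsupport fun hx' => hx (hψ.2.2 hx'), mul_zero]
    · intro x hx
      rw [image_eq_zero_of_notMem_tsupport fun hx' => hx (hψ.2.2 (tsupport_pderiv j hx')),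
        mul_zero]
  · exact hmem _ (continuous_rho_inv.mul hφ.continuous) hc.mul_left
  · exact hmem _ (contDiff_pderiv hφ j).continuous (hasCompactSupport_pderiv hc j)

/-- The exponent `α - m + |κ|` is `-1` for the function itself and `0` for its first derivatives. -/
theorem memH_one_zero (hΩ : IsOpen Ω) : MemH 1 0 Ω u ↔ ∃ G, H1 Ω u G := by
  constructor
  · intro h
    obtain ⟨g0, hg0, hm0⟩ := h 0 (by simp [mlen])
    choose G hG hGm using fun j : Fin 3 => h (idx j) (by simp [mlen_idx])
    refine ⟨G, hG, ?_, fun j => ?_⟩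
    · have := (isWeakDeriv_zero_idx hg0.1).unique hΩ hg0
      refine hm0.ae_eq (this.symm.mono fun x hx => ?_)
      simp [mlen, hx, Real.rpow_neg_one]
    · simpa [mlen_idx] using hGm j
  · rintro ⟨G, hG⟩ κ hκ
    rcases multiindex_cases (hκ.trans (by norm_num)) with rfl | ⟨j, rfl⟩ | ⟨j, k, rfl⟩
    · exact ⟨u, isWeakDeriv_zero_idx (hG.deriv 0).1, by simpa [mlen, Real.rpow_neg_one] using hG.mem⟩
    · exact ⟨G j, hG.deriv j, by simpa [mlen_idx] using hG.gmem j⟩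
    · simp [mlen_idx_add] at hκ

end H1

/-! ### Integration by parts up to the boundary -/

/-- A smooth function of `x₃` vanishing for `x₃ ≥ -1/(n+1)` and equal to one for
`x₃ ≤ -2/(n+1)`. -/
def layer (n : ℕ) (x : E3) : ℝ := Real.smoothTransition (-(n + 1) * x 2 - 1)

theorem contDiff_layer (n : ℕ) : ContDiff ℝ ∞ (layer n) := by
  unfold layer
  refine Real.smoothTransition.contDiff.comp ?_
  fun_prop

theorem abs_layer_le_one (n : ℕ) (x : E3) : |layer n x| ≤ 1 := by
  unfold layer
  rw [abs_of_nonneg (Real.smoothTransition.nonneg _)]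
  exact Real.smoothTransition.le_one _

theorem tsupport_layer (n : ℕ) : tsupport (layer n) ⊆ halfSpace := by
  have hcl : IsClosed {x : E3 | (1:ℝ) ≤ -(n + 1) * x 2} :=
    isClosed_le continuous_const (by fun_prop)
  have hsub : tsupport (layer n) ⊆ {x : E3 | (1:ℝ) ≤ -(n + 1) * x 2} := by
    refine closure_minimal (fun x hx => ?_) hcl
    by_contra hlt
    simp only [mem_ofPred_eq, not_le] at hlt
    exact hx (Real.smoothTransition.zero_of_nonpos (by linarith))
  intro x hx
  have h1 : (1:ℝ) ≤ -(n + 1) * x 2 := hsub hx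
  have : (0:ℝ) < n + 1 := by positivity
  simp only [halfSpace, mem_ofPred_eq]
  by_contra h
  push Not at h
  nlinarith

theorem pderiv_layer (n : ℕ) (j : Fin 3) (x : E3) : pderiv j (layer n) x =
    if j = 2 then deriv Real.smoothTransition (-(n + 1) * x 2 - 1) * -(n + 1) else 0 := by
  have hd : HasFDerivAt (fun x : E3 => (-((n:ℝ) + 1) * x 2 - 1))
      ((-((n:ℝ) + 1)) • (EuclideanSpace.proj (2 : Fin 3) : E3 →L[ℝ] ℝ)) x := by
    have := ((EuclideanSpace.proj (2 : Fin 3) : E3 →L[ℝ] ℝ).hasFDerivAt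
      (x := x)).const_mul (-((n:ℝ) + 1))
    exact this.sub_const 1
  have hs : HasDerivAt Real.smoothTransition (deriv Real.smoothTransition (-(n + 1) * x 2 - 1))
      (-(n + 1) * x 2 - 1) :=
    ((Real.smoothTransition.contDiff (n := 1)).differentiable (by simp) _).hasDerivAt
  have := (hs.comp_hasFDerivAt x hd).fderiv
  unfold LameHalfSpace.pderiv
  change fderiv ℝ (Real.smoothTransition ∘ fun x : E3 => (-((n:ℝ) + 1) * x 2 - 1)) x _ = _
  rw [this]
  fin_cases j <;> simp

theorem deriv_smoothTransition_eq_zero {t : ℝ} (h : t < 0 ∨ 1 < t) :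
    deriv Real.smoothTransition t = 0 := by
  rcases h with h | h
  · have : Real.smoothTransition =ᶠ[𝓝 t] fun _ => 0 := by
      filter_upwards [Iio_mem_nhds h] with s hs
      exact Real.smoothTransition.zero_of_nonpos (le_of_lt hs)
    rw [this.deriv_eq]; simp
  · have : Real.smoothTransition =ᶠ[𝓝 t] fun _ => 1 := by
      filter_upwards [Ioi_mem_nhds h] with s hs
      exact Real.smoothTransition.one_of_one_le (le_of_lt hs)
    rw [this.deriv_eq]; simp

theorem exists_deriv_smoothTransition_bound : ∃ D : ℝ, 0 ≤ D ∧
    ∀ t, |deriv Real.smoothTransition t| ≤ D := by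
  have hc : Continuous (deriv Real.smoothTransition) :=
    (Real.smoothTransition.contDiff (n := 1)).continuous_deriv (by simp)
  obtain ⟨D, hD⟩ := isCompact_Icc.exists_bound_of_continuousOn (s := Icc (0:ℝ) 1) hc.continuousOn
  refine ⟨max D 0, le_max_right _ _, fun t => ?_⟩
  by_cases ht : t ∈ Icc (0:ℝ) 1
  · exact (hD t ht).trans (le_max_left _ _)
  · rw [deriv_smoothTransition_eq_zero, abs_zero]
    · exact le_max_right _ _
    · simp only [mem_Icc, not_and_or, not_le] at ht
      exact ht

/-- The gradient of the layer is of size `n + 1`, but it lives only where `(n + 1)|x₃|` is between 1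
and 2; the product with `|x₃|` is thus bounded uniformly in `n`. -/
theorem abs_pderiv_layer_le : ∃ D : ℝ, 0 ≤ D ∧ ∀ n j x, x ∈ halfSpace →
    |pderiv j (layer n) x| * |x 2| ≤ D := by
  obtain ⟨D, hD0, hD⟩ := exists_deriv_smoothTransition_bound
  refine ⟨2 * D, by positivity, fun n j x hx => ?_⟩
  rw [pderiv_layer]
  split_ifs
  · have hx' : x 2 < 0 := hx
    rw [abs_mul, mul_assoc, ← abs_mul]
    by_cases h : -((n:ℝ) + 1) * x 2 ≤ 2
    · rw [mul_comm 2]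
      refine mul_le_mul (hD _) ?_ (abs_nonneg _) hD0
      rw [abs_of_nonneg]
      · exact h
      · have : (0:ℝ) < n + 1 := by positivity
        nlinarith
    · rw [deriv_smoothTransition_eq_zero (Or.inr (by push Not at h; linarith))]
      simp [hD0]
  · simp [hD0]

theorem layer_eventually {x : E3} (hx : x ∈ halfSpace) :
    ∀ᶠ n : ℕ in atTop, layer n x = 1 ∧ ∀ j, pderiv j (layer n) x = 0 := by
  have hx' : x 2 < 0 := hx
  have ht : Tendsto (fun n : ℕ => ((n:ℝ) + 1) * (-x 2)) atTop atTop :=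
    (tendsto_atTop_add_const_right _ _ tendsto_natCast_atTop_atTop).atTop_mul_const (by linarith)
  filter_upwards [ht.eventually_gt_atTop 2] with n hn
  refine ⟨Real.smoothTransition.one_of_one_le (by linarith), fun j => ?_⟩
  rw [pderiv_layer, deriv_smoothTransition_eq_zero (Or.inr (by linarith))]
  simp

theorem isTest_layer_mul {ψ : E3 → ℝ} (hψ : ContDiff ℝ ∞ ψ) (hc : HasCompactSupport ψ) (n : ℕ) :
    IsTest halfSpace (fun x => layer n x * ψ x) :=
  ⟨(contDiff_layer n).mul hψ, hc.mul_left, tsupport_mul_subset_left.trans (tsupport_layer n)⟩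

theorem integrable_mul_of_locallyIntegrable {μ : Measure E3} {u φ : E3 → ℝ}
    (hu : LocallyIntegrable u μ) (hφ : Continuous φ) (hc : HasCompactSupport φ) :
    Integrable (fun x => u x * φ x) μ := by
  simpa [mul_comm] using hu.integrable_smul_left_of_hasCompactSupport hφ hc

/-- Dominated convergence for the boundary layer cutoff. -/
theorem tendsto_integral_layer {u φ : E3 → ℝ} (hu : Integrable (fun x => u x * φ x) hsVol) :
    Tendsto (fun n => ∫ x in halfSpace, u x * (layer n x * φ x)) atTop
      (𝓝 (∫ x in halfSpace, u x * φ x)) := by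
  refine tendsto_integral_of_dominated_convergence (fun x => |u x * φ x|) (fun n => ?_) hu.abs
    (fun n => ?_) ?_
  · have := hu.1.mul ((contDiff_layer n).continuous.aestronglyMeasurable (μ := hsVol))
    refine this.congr (Eventually.of_forall fun x => ?_)
    simp only [Pi.mul_apply]; ring
  · refine Eventually.of_forall fun x => ?_
    have h1 : u x * (layer n x * φ x) = layer n x * (u x * φ x) := by ring
    rw [Real.norm_eq_abs, h1, abs_mul]
    exact mul_le_of_le_one_left (abs_nonneg _) (abs_layer_le_one n x)
  · filter_upwards [ae_restrict_mem measurableSet_halfSpace] with x hx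
    refine tendsto_const_nhds.congr' ?_
    filter_upwards [layer_eventually hx] with n hn
    rw [hn.1, one_mul]

/-- Integration by parts against functions that need not vanish near the boundary, provided
that the boundary layer contribution is bounded. -/
theorem integral_mul_pderiv_of_layer_bound {u g ψ : E3 → ℝ} {j : Fin 3}
    (hd : IsWeakDeriv halfSpace (idx j) u g)
    (hu : LocallyIntegrable u hsVol) (hg : LocallyIntegrable g hsVol)
    (hψ : ContDiff ℝ ∞ ψ) (hc : HasCompactSupport ψ) {C : ℝ}
    (hC : ∀ n, ∀ x ∈ halfSpace, |pderiv j (layer n) x * ψ x| ≤ C) :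
    ∫ x in halfSpace, u x * pderiv j ψ x = - ∫ x in halfSpace, g x * ψ x := by
  have hψd := contDiff_pderiv hψ j
  have i1 : Integrable (fun x => u x * pderiv j ψ x) hsVol :=
    integrable_mul_of_locallyIntegrable hu hψd.continuous (hasCompactSupport_pderiv hc j)
  have i2 : Integrable (fun x => g x * ψ x) hsVol :=
    integrable_mul_of_locallyIntegrable hg hψ.continuous hc
  have t1 := tendsto_integral_layer i1
  have t2 := tendsto_integral_layer i2
  have hK : Integrable ((tsupport ψ).indicator fun x => |u x| * C) hsVol := by
    rw [integrable_indicator_iff (isClosed_tsupport ψ).measurableSet]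
    exact ((hu.integrableOn_isCompact hc).abs).mul_const C
  have hbound : ∀ n, ∀ x ∈ halfSpace, |u x * (pderiv j (layer n) x * ψ x)| ≤
      (tsupport ψ).indicator (fun x => |u x| * C) x := by
    intro n x hx
    by_cases hxs : x ∈ tsupport ψ
    · rw [indicator_of_mem hxs, abs_mul]
      exact mul_le_mul_of_nonneg_left (hC n x hx) (abs_nonneg _)
    · rw [image_eq_zero_of_notMem_tsupport hxs]
      simp [hxs]
  have hmeas : ∀ n, AEStronglyMeasurable (fun x => u x * (pderiv j (layer n) x * ψ x)) hsVol :=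
    fun n => hu.aestronglyMeasurable.mul
      (((contDiff_pderiv (contDiff_layer n) j).continuous.mul hψ.continuous).aestronglyMeasurable)
  -- The extra term of the product rule. At each interior point it is eventually zero, and `hC`
  -- supplies the majorant `C |u|` on the compact support of `ψ`.
  have t3 : Tendsto (fun n => ∫ x in halfSpace, u x * (pderiv j (layer n) x * ψ x)) atTop
      (𝓝 (∫ _x in halfSpace, (0:ℝ))) := by
    refine tendsto_integral_of_dominated_convergence _ hmeas hK (fun n => ?_) ?_
    · filter_upwards [ae_restrict_mem measurableSet_halfSpace] with x hx
      exact hbound n x hx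
    · filter_upwards [ae_restrict_mem measurableSet_halfSpace] with x hx
      refine tendsto_const_nhds.congr' ?_
      filter_upwards [layer_eventually hx] with n hn
      rw [hn.2, zero_mul, mul_zero]
  have key : ∀ n, (∫ x in halfSpace, u x * (layer n x * pderiv j ψ x)) +
      ∫ x in halfSpace, u x * (pderiv j (layer n) x * ψ x) =
      - ∫ x in halfSpace, g x * (layer n x * ψ x) := by
    intro n
    rw [← (isWeakDeriv_idx.1 hd).2.2 _ (isTest_layer_mul hψ hc n), ← integral_add]
    · congr 1; ext x
      rw [pderiv_mul ((contDiff_layer n).differentiable (by simp) x)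
        (hψ.differentiable (by simp) x)]
      ring
    · exact integrable_mul_of_locallyIntegrable hu
        ((contDiff_layer n).continuous.mul hψd.continuous)
        (hasCompactSupport_pderiv hc j).mul_left
    · refine hK.mono' (hmeas n) ?_
      filter_upwards [ae_restrict_mem measurableSet_halfSpace] with x hx
      exact hbound n x hx
  have lim := tendsto_nhds_unique (t1.add t3) (t2.neg.congr fun n => (key n).symm)
  simpa using lim

/-- Tangential integration by parts. -/
theorem integral_mul_pderiv_tangential {u g ψ : E3 → ℝ} {j : Fin 3} (hj : j ≠ 2)
    (hd : IsWeakDeriv halfSpace (idx j) u g)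
    (hu : LocallyIntegrable u hsVol) (hg : LocallyIntegrable g hsVol)
    (hψ : ContDiff ℝ ∞ ψ) (hc : HasCompactSupport ψ) :
    ∫ x in halfSpace, u x * pderiv j ψ x = - ∫ x in halfSpace, g x * ψ x :=
  integral_mul_pderiv_of_layer_bound hd hu hg hψ hc (C := 0) fun n x _ => by
    simp [pderiv_layer, hj]

/-- Normal integration by parts against functions that vanish on the boundary. -/
theorem integral_mul_pderiv_normal {u g ψ : E3 → ℝ}
    (hd : IsWeakDeriv halfSpace (idx 2) u g)
    (hu : LocallyIntegrable u hsVol) (hg : LocallyIntegrable g hsVol)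
    (hψ : ContDiff ℝ ∞ ψ) (hc : HasCompactSupport ψ) (h0 : ∀ x : E3, x 2 = 0 → ψ x = 0) :
    ∫ x in halfSpace, u x * pderiv 2 ψ x = - ∫ x in halfSpace, g x * ψ x := by
  obtain ⟨D, hD0, hD⟩ := abs_pderiv_layer_le
  obtain ⟨L, hL⟩ := hψ.lipschitzWith_of_hasCompactSupport hc (by simp)
  refine integral_mul_pderiv_of_layer_bound hd hu hg hψ hc (C := D * L) fun n x hx => ?_
  -- Comparison of `x` with its projection onto the boundary, where `ψ` vanishes. This linear decay
  -- offsets the growth of the gradient of `layer n`.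
  have h1 : |ψ x| ≤ L * |x 2| := by
    have := hL.dist_le_mul x (x - EuclideanSpace.single 2 (x 2))
    rw [h0 (x - EuclideanSpace.single 2 (x 2)) (by simp)] at this
    simpa [Real.dist_eq, dist_eq_norm] using this
  rw [abs_mul]
  calc |pderiv 2 (layer n) x| * |ψ x| ≤ |pderiv 2 (layer n) x| * (L * |x 2|) := by gcongr
    _ = (|pderiv 2 (layer n) x| * |x 2|) * L := by ring
    _ ≤ D * L := by gcongr; exact hD n 2 x hx

/-! ### Reflection across the boundary -/

/-- The linear map `(x₁, x₂, x₃) ↦ (x₁, x₂, -a x₃)`. -/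
def refl (a : ℝ) : E3 →L[ℝ] E3 :=
  LinearMap.toContinuousLinearMap (Matrix.toLpLin 2 2 (Matrix.diagonal ![1, 1, -a]))

theorem refl_apply (a : ℝ) (x : E3) (i : Fin 3) :
    refl a x i = if i = 2 then -a * x 2 else x i := by
  fin_cases i <;> simp [refl, Matrix.ofLp_toLpLin, Matrix.mulVec_diagonal]

theorem refl_refl {a b : ℝ} (h : a * b = 1) (x : E3) : refl a (refl b x) = x := by
  ext i
  fin_cases i <;> simp [refl_apply]
  linear_combination h * x 2

theorem refl_single (a : ℝ) (j : Fin 3) : refl a (EuclideanSpace.single j 1) =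
    (if j = 2 then -a else 1) • EuclideanSpace.single j (1:ℝ) := by
  ext i
  fin_cases j <;> fin_cases i <;> simp [refl_apply]

/-- The reflection as a homeomorphism. -/
def reflHomeo (a : ℝ) (ha : a ≠ 0) : E3 ≃ₜ E3 where
  toFun := refl a
  invFun := refl a⁻¹
  left_inv x := refl_refl (inv_mul_cancel₀ ha) x
  right_inv x := refl_refl (mul_inv_cancel₀ ha) x
  continuous_toFun := (refl a).continuous
  continuous_invFun := (refl a⁻¹).continuous

theorem map_refl {a : ℝ} (ha : 0 < a) :
    Measure.map (refl a) (volume : Measure E3) = ENNReal.ofReal a⁻¹ • volume := by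
  have hdet : LinearMap.det (refl a : E3 →ₗ[ℝ] E3) = -a := by
    have : (refl a : E3 →ₗ[ℝ] E3) = Matrix.toLin (PiLp.basisFun 2 ℝ (Fin 3))
      (PiLp.basisFun 2 ℝ (Fin 3)) (Matrix.diagonal ![1, 1, -a]) := by
      rw [← Matrix.toLpLin_eq_toLin]; rfl
    rw [this, LinearMap.det_toLin]
    simp [Matrix.det_diagonal, Fin.prod_univ_three]
  have := Measure.map_linearMap_addHaar_eq_smul_addHaar (volume : Measure E3)
    (f := (refl a : E3 →ₗ[ℝ] E3)) (by rw [hdet]; simpa using ha.ne')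
  rw [hdet] at this
  have h2 : |(-a)⁻¹| = a⁻¹ := by rw [abs_inv, abs_neg, abs_of_pos ha]
  rw [h2] at this
  exact this

theorem integral_refl {a : ℝ} (ha : 0 < a) (F : E3 → ℝ) :
    ∫ x, F (refl a x) = a⁻¹ * ∫ x, F x := by
  have h := (reflHomeo a ha.ne').measurableEmbedding.integral_map (μ := volume) F
  change ∫ y, F y ∂Measure.map (refl a) volume = ∫ x, F (refl a x) at h
  rw [← h, map_refl ha, integral_smul_measure, ENNReal.toReal_ofReal (inv_nonneg.2 ha.le)]
  rfl

theorem memLp_refl {a : ℝ} (ha : 0 < a) {F : E3 → ℝ} (hF : MemLp F 2 volume) :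
    MemLp (fun x => F (refl a x)) 2 volume := by
  have : MemLp F 2 (Measure.map (refl a) (volume : Measure E3)) := by
    rw [map_refl ha]; exact hF.smul_measure ENNReal.ofReal_ne_top
  exact this.comp_of_map (refl a).continuous.aemeasurable

theorem nrm_refl_le {a : ℝ} (ha : 1 ≤ a) {F : E3 → ℝ} (hF : MemLp F 2 volume) :
    nrm volume (fun x => F (refl a x)) ≤ nrm volume F := by
  have ha0 : 0 < a := one_pos.trans_le ha
  refine abs_le_of_sq_le_sq' ?_ (nrm_nonneg _ _) |>.2
  rw [nrm_sq hF, nrm_sq (memLp_refl ha0 hF), integral_refl ha0 (fun x => F x ^ 2)]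
  exact mul_le_of_le_one_left (integral_nonneg fun x => sq_nonneg _) (inv_le_one_of_one_le₀ ha)

theorem locallyIntegrable_refl {a : ℝ} (ha : 0 < a) {F : E3 → ℝ}
    (hF : LocallyIntegrable F volume) : LocallyIntegrable (fun x => F (refl a x)) volume := by
  have : LocallyIntegrable F (Measure.map (reflHomeo a ha.ne') (volume : Measure E3)) := by
    change LocallyIntegrable F (Measure.map (refl a) (volume : Measure E3))
    rw [map_refl ha]
    intro x
    obtain ⟨s, hs, h⟩ := hF x
    refine ⟨s, hs, ?_⟩
    rw [IntegrableOn, Measure.restrict_smul]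
    exact Integrable.smul_measure h ENNReal.ofReal_ne_top
  exact (locallyIntegrable_map_homeomorph _).1 this

/-- Extension from the half space to the whole space by a combination of two reflections. -/
def extend (p q : ℝ) (g : E3 → ℝ) (x : E3) : ℝ :=
  halfSpace.indicator g x + p * halfSpace.indicator g (refl 1 x) +
    q * halfSpace.indicator g (refl 2 x)

theorem locallyIntegrable_indicator {g : E3 → ℝ} (hg : LocallyIntegrable g hsVol) :
    LocallyIntegrable (halfSpace.indicator g) volume := by
  intro x
  obtain ⟨s, hs, h⟩ := hg x
  refine ⟨s, hs, ?_⟩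
  rw [IntegrableOn, integrable_indicator_iff measurableSet_halfSpace, IntegrableOn,
    Measure.restrict_restrict measurableSet_halfSpace]
  rwa [IntegrableOn, Measure.restrict_restrict' measurableSet_halfSpace, inter_comm] at h

theorem locallyIntegrable_extend {g : E3 → ℝ} (hg : LocallyIntegrable g hsVol) (p q : ℝ) :
    LocallyIntegrable (extend p q g) volume := by
  have h := locallyIntegrable_indicator hg
  exact (h.add ((locallyIntegrable_refl one_pos h).smul p)).add
    ((locallyIntegrable_refl two_pos h).smul q)

theorem integral_indicator_refl_mul {a : ℝ} (ha : 0 < a) (g φ : E3 → ℝ) :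
    ∫ x, halfSpace.indicator g (refl a x) * φ x =
      a⁻¹ * ∫ x in halfSpace, g x * φ (refl a⁻¹ x) := by
  have h := integral_refl ha fun x => halfSpace.indicator g x * φ (refl a⁻¹ x)
  simp only [refl_refl (inv_mul_cancel₀ ha.ne')] at h
  rw [h, ← integral_indicator measurableSet_halfSpace]
  congr 2; ext x
  by_cases hx : x ∈ halfSpace <;> simp [hx]

theorem hasCompactSupport_comp_refl {φ : E3 → ℝ} (hc : HasCompactSupport φ) {a : ℝ} (ha : a ≠ 0) :
    HasCompactSupport (fun x => φ (refl a x)) := hc.comp_homeomorph (reflHomeo a ha)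

/-- By duality, reflecting `g` amounts to reflecting the test function; the factor `q / 2` and the
map `refl 2⁻¹` come from the change of variables by `refl 2`. Weak differentiability of an extension
thereby becomes an integration by parts on the half space. -/
theorem integral_extend_mul {g φ : E3 → ℝ} (hg : LocallyIntegrable g hsVol) (hφ : Continuous φ)
    (hc : HasCompactSupport φ) (p q : ℝ) :
    ∫ x, extend p q g x * φ x =
      ∫ x in halfSpace, g x * (φ x + p * φ (refl 1 x) + q / 2 * φ (refl 2⁻¹ x)) := by
  have h := locallyIntegrable_indicator hg
  have i0 := integrable_mul_of_locallyIntegrable h hφ hc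
  have i1 := integrable_mul_of_locallyIntegrable (locallyIntegrable_refl one_pos h) hφ hc
  have i2 := integrable_mul_of_locallyIntegrable (locallyIntegrable_refl two_pos h) hφ hc
  have j0 := integrable_mul_of_locallyIntegrable hg hφ hc
  have j1 : Integrable (fun x => g x * φ (refl 1 x)) hsVol :=
    integrable_mul_of_locallyIntegrable hg (hφ.comp (refl 1).continuous)
    (hasCompactSupport_comp_refl hc one_ne_zero)
  have j2 : Integrable (fun x => g x * φ (refl 2⁻¹ x)) hsVol :=
    integrable_mul_of_locallyIntegrable hg (hφ.comp (refl 2⁻¹).continuous)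
    (hasCompactSupport_comp_refl hc (by norm_num : (2:ℝ)⁻¹ ≠ 0))
  have e1 : ∀ x, extend p q g x * φ x = halfSpace.indicator g x * φ x +
      p * (halfSpace.indicator g (refl 1 x) * φ x) +
      q * (halfSpace.indicator g (refl 2 x) * φ x) := fun x => by unfold extend; ring
  have e2 : ∀ x, g x * (φ x + p * φ (refl 1 x) + q / 2 * φ (refl 2⁻¹ x)) =
      g x * φ x + p * (g x * φ (refl 1 x)) + q / 2 * (g x * φ (refl 2⁻¹ x)) := fun x => by ring
  simp only [e1, e2]
  have s1 : Integrable (fun x => halfSpace.indicator g x * φ x +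
      p * (halfSpace.indicator g (refl 1 x) * φ x)) := i0.add (i1.const_mul p)
  have s2 : Integrable (fun x => g x * φ x + p * (g x * φ (refl 1 x))) hsVol :=
    j0.add (j1.const_mul p)
  rw [integral_add s1 (i2.const_mul q),
    integral_add i0 (i1.const_mul p), integral_add s2 (j2.const_mul (q / 2)),
    integral_add j0 (j1.const_mul p), integral_const_mul, integral_const_mul, integral_const_mul,
    integral_const_mul, integral_indicator_refl_mul one_pos, integral_indicator_refl_mul two_pos]
  have e3 : ∫ x, halfSpace.indicator g x * φ x = ∫ x in halfSpace, g x * φ x := by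
    rw [← integral_indicator measurableSet_halfSpace]
    congr 1; ext x
    by_cases hx : x ∈ halfSpace <;> simp [hx]
  simp only [e3, inv_one]
  ring

theorem pderiv_comp_refl {φ : E3 → ℝ} (hφ : ContDiff ℝ ∞ φ) (a : ℝ) (j : Fin 3) (x : E3) :
    pderiv j (fun y => φ (refl a y)) x = (if j = 2 then -a else 1) * pderiv j φ (refl a x) := by
  rw [pderiv_comp_linear hφ, refl_single, map_smul]
  rfl

theorem contDiff_comp_refl {φ : E3 → ℝ} (hφ : ContDiff ℝ ∞ φ) (a : ℝ) :
    ContDiff ℝ ∞ (fun x => φ (refl a x)) := hφ.comp (refl a).contDiff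

section Extension
variable {u g : E3 → ℝ} (hu : LocallyIntegrable u hsVol) (hg : LocallyIntegrable g hsVol)
include hu hg

theorem isWeakDeriv_extend_aux {j : Fin 3} {p q p' q' : ℝ}
    (h : ∀ φ : E3 → ℝ, ContDiff ℝ ∞ φ → HasCompactSupport φ →
      ∫ x in halfSpace, u x * (pderiv j φ x + p * pderiv j φ (refl 1 x) +
        q / 2 * pderiv j φ (refl 2⁻¹ x)) =
      - ∫ x in halfSpace, g x * (φ x + p' * φ (refl 1 x) + q' / 2 * φ (refl 2⁻¹ x))) :
    IsWeakDeriv univ (idx j) (extend p q u) (extend p' q' g) := by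
  rw [isWeakDeriv_idx]
  refine ⟨(locallyIntegrable_extend hu p q).locallyIntegrableOn _,
    (locallyIntegrable_extend hg p' q').locallyIntegrableOn _, fun φ hφ => ?_⟩
  rw [setIntegral_univ, setIntegral_univ,
    integral_extend_mul hu (contDiff_pderiv hφ.1 j).continuous (hasCompactSupport_pderiv hφ.2.1 j),
    integral_extend_mul hg hφ.1.continuous hφ.2.1]
  exact h φ hφ.1 hφ.2.1

/-- Tangential derivatives commute with the reflections and see no boundary term, so `p` and `q` are
unrestricted and are kept by the derivative. -/
theorem isWeakDeriv_extend_tangential {j : Fin 3} (hj : j ≠ 2)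
    (hd : IsWeakDeriv halfSpace (idx j) u g) (p q : ℝ) :
    IsWeakDeriv univ (idx j) (extend p q u) (extend p q g) := by
  refine isWeakDeriv_extend_aux hu hg fun φ hφ hc => ?_
  have c1 := contDiff_comp_refl hφ 1
  have c2 := contDiff_comp_refl hφ 2⁻¹
  have := integral_mul_pderiv_tangential hj hd hu hg
    (ψ := fun x => φ x + p * φ (refl 1 x) + q / 2 * φ (refl 2⁻¹ x))
    ((hφ.add (contDiff_const.mul c1)).add (contDiff_const.mul c2))
    ((hc.add (hasCompactSupport_comp_refl hc one_ne_zero).mul_left).add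
      (hasCompactSupport_comp_refl hc (by norm_num)).mul_left)
  rw [← this]
  congr 1; ext x; congr 1
  have d0 := hφ.differentiable (by simp) x
  have d1 := c1.differentiable (by simp) x
  have d2 := c2.differentiable (by simp) x
  rw [pderiv_add (d0.fun_add (d1.const_mul p)) (d2.const_mul _), pderiv_add d0 (d1.const_mul p),
    pderiv_const_mul _ d1, pderiv_const_mul _ d2, pderiv_comp_refl hφ, pderiv_comp_refl hφ]
  simp [hj]

/-- The condition `p + q = 1` says that the two one-sided traces of the extension agree. Dually, the
combined test function vanishes on the boundary, so normal integration by parts applies. The new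
coefficients `-p` and `-2q` are the chain rule factors of `x₃ ↦ -x₃` and `x₃ ↦ -2x₃`. -/
theorem isWeakDeriv_extend_normal (hd : IsWeakDeriv halfSpace (idx 2) u g) {p q : ℝ}
    (hpq : p + q = 1) :
    IsWeakDeriv univ (idx 2) (extend p q u) (extend (-p) (-2 * q) g) := by
  refine isWeakDeriv_extend_aux hu hg fun φ hφ hc => ?_
  have c1 := contDiff_comp_refl hφ 1
  have c2 := contDiff_comp_refl hφ 2⁻¹
  have := integral_mul_pderiv_normal hd hu hg
    (ψ := fun x => φ x + (-p) * φ (refl 1 x) + (-2 * q) / 2 * φ (refl 2⁻¹ x))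
    ((hφ.add (contDiff_const.mul c1)).add (contDiff_const.mul c2))
    ((hc.add (hasCompactSupport_comp_refl hc one_ne_zero).mul_left).add
      (hasCompactSupport_comp_refl hc (by norm_num)).mul_left)
    (fun x hx => by
      have : ∀ a, refl a x = x := fun a => by
        ext i; rw [refl_apply]; split_ifs with h
        · rw [h, hx, mul_zero]
        · rfl
      simp only [this]
      linear_combination (-φ x) * hpq)
  rw [← this]
  congr 1; ext x; congr 1
  have d0 := hφ.differentiable (by simp) x
  have d1 := c1.differentiable (by simp) x
  have d2 := c2.differentiable (by simp) x
  rw [pderiv_add (d0.fun_add (d1.const_mul _)) (d2.const_mul _), pderiv_add d0 (d1.const_mul _),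
    pderiv_const_mul _ d1, pderiv_const_mul _ d2, pderiv_comp_refl hφ, pderiv_comp_refl hφ]
  simp
  ring

end Extension

theorem memLp_indicator {g : E3 → ℝ} (hg : MemLp g 2 hsVol) :
    MemLp (halfSpace.indicator g) 2 volume :=
  (memLp_indicator_iff_restrict measurableSet_halfSpace).2 hg

theorem memLp_extend {g : E3 → ℝ} (hg : MemLp g 2 hsVol) (p q : ℝ) :
    MemLp (extend p q g) 2 volume := by
  have h := memLp_indicator hg
  exact (h.add ((memLp_refl one_pos h).const_mul p)).add ((memLp_refl two_pos h).const_mul q)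

theorem nrm_indicator (g : E3 → ℝ) : nrm volume (halfSpace.indicator g) = nrm hsVol g := by
  unfold nrm; rw [eLpNorm_indicator_eq_eLpNorm_restrict measurableSet_halfSpace]

theorem nrm_extend_le {g : E3 → ℝ} (hg : MemLp g 2 hsVol) (p q : ℝ) :
    nrm volume (extend p q g) ≤ (1 + |p| + |q|) * nrm hsVol g := by
  have h := memLp_indicator hg
  have h1 := (memLp_refl one_pos h)
  have h2 := (memLp_refl two_pos h)
  have t1 := nrm_add_le (h.add (h1.const_mul p)) (h2.const_mul q)
  have t2 := nrm_add_le h (h1.const_mul p)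
  rw [nrm_const_mul] at t1 t2
  have t3 := mul_le_mul_of_nonneg_left (nrm_refl_le le_rfl h) (abs_nonneg p)
  have t4 := mul_le_mul_of_nonneg_left (nrm_refl_le one_le_two h) (abs_nonneg q)
  rw [nrm_indicator] at *
  calc nrm volume (extend p q g) ≤ _ := t1
    _ ≤ (nrm hsVol g + |p| * nrm hsVol g) + |q| * nrm hsVol g := add_le_add (t2.trans (by linarith)) t4
    _ = _ := by ring

theorem extend_of_mem {g : E3 → ℝ} {x : E3} (hx : x ∈ halfSpace) (p q : ℝ) :
    extend p q g x = g x := by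
  have hx' : x 2 < 0 := hx
  have h1 : refl 1 x ∉ halfSpace := by simp [halfSpace, refl_apply]; linarith
  have h2 : refl 2 x ∉ halfSpace := by simp [halfSpace, refl_apply]; linarith
  simp [extend, hx, h1, h2]

theorem nrm_restrict_le {F g : E3 → ℝ} (hF : MemLp F 2 volume)
    (h : ∀ x ∈ halfSpace, F x = g x) : nrm hsVol g ≤ nrm volume F := by
  rw [← nrm_indicator]
  refine nrm_mono hF (Eventually.of_forall fun x => ?_)
  by_cases hx : x ∈ halfSpace <;> simp [hx, h]

theorem extend_linear (p q a b : ℝ) (f g : E3 → ℝ) (x : E3) :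
    extend p q (fun y => a * f y + b * g y) x = a * extend p q f x + b * extend p q g x := by
  have : ∀ y, halfSpace.indicator (fun y => a * f y + b * g y) y =
      a * halfSpace.indicator f y + b * halfSpace.indicator g y := fun y => by
    by_cases hy : y ∈ halfSpace <;> simp [hy]
  simp only [extend, this]; ring

theorem rho_refl_le (a : ℝ) (h1 : 1 ≤ a) (h2 : a ≤ 2) (x : E3) : rho (refl a x) ≤ 2 * rho x := by
  refine abs_le_of_sq_le_sq' ?_ (by have := rho_pos x; positivity) |>.2
  rw [mul_pow, rho_sq, rho_sq, EuclideanSpace.norm_sq_eq, EuclideanSpace.norm_sq_eq]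
  simp only [Fin.sum_univ_three, refl_apply, Real.norm_eq_abs, sq_abs]
  simp
  nlinarith [sq_nonneg (x 0), sq_nonneg (x 1), sq_nonneg (x 2),
    mul_nonneg (mul_nonneg (sub_nonneg.2 h2) (by linarith : (0:ℝ) ≤ 2 + a)) (sq_nonneg (x 2))]

theorem memLp_rho_inv_extend {u : E3 → ℝ} (hu : MemLp (fun x => (rho x)⁻¹ * u x) 2 hsVol)
    (p q : ℝ) : MemLp (fun x => (rho x)⁻¹ * extend p q u x) 2 volume := by
  have h := memLp_indicator hu
  have key : ∀ a, 1 ≤ a → a ≤ 2 →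
      MemLp (fun x => (rho x)⁻¹ * halfSpace.indicator u (refl a x)) 2 volume := by
    intro a h1 h2
    have hm := memLp_refl (zero_lt_one.trans_le h1) h
    have hcont : Continuous fun x => (rho x)⁻¹ * rho (refl a x) :=
      continuous_rho_inv.mul (continuous_rho.comp (refl a).continuous)
    have heq : ∀ x, (rho x)⁻¹ * halfSpace.indicator u (refl a x) = ((rho x)⁻¹ * rho (refl a x)) *
        halfSpace.indicator (fun x => (rho x)⁻¹ * u x) (refl a x) := fun x => by
      by_cases hx : refl a x ∈ halfSpace
      · simp [hx]; field_simp [(rho_pos (refl a x)).ne']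
      · simp [hx]
    simp only [heq]
    refine memLp_of_le (c := 2) hm (hcont.aestronglyMeasurable.mul hm.1)
      (Eventually.of_forall fun x => ?_)
    rw [abs_mul]
    refine mul_le_mul_of_nonneg_right ?_ (abs_nonneg _)
    rw [abs_of_pos (mul_pos (rho_inv_pos x) (rho_pos _)), inv_mul_le_iff₀ (rho_pos x), mul_comm]
    exact rho_refl_le a h1 h2 x
  have h0 : MemLp (fun x => (rho x)⁻¹ * halfSpace.indicator u x) 2 volume := by
    refine h.ae_eq (Eventually.of_forall fun x => ?_)
    by_cases hx : x ∈ halfSpace <;> simp [hx]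
  refine ((h0.add ((key 1 le_rfl one_le_two).const_mul p)).add
    ((key 2 one_le_two le_rfl).const_mul q)).ae_eq (Eventually.of_forall fun x => ?_)
  simp only [Pi.add_apply, extend]; ring

theorem locallyIntegrable_of_rho_inv {u : E3 → ℝ}
    (hu : MemLp (fun x => (rho x)⁻¹ * u x) 2 hsVol) : LocallyIntegrable u hsVol := by
  have := (hu.locallyIntegrable (by norm_num)).continuous_mul continuous_rho
  refine this.congr (Eventually.of_forall fun x => ?_)
  simp only
  rw [← mul_assoc, mul_inv_cancel₀ (rho_pos x).ne', one_mul]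

/-- The extension of an `H^1_0` function. -/
theorem H1.extend {u : E3 → ℝ} {G : Fin 3 → E3 → ℝ} (h : H1 halfSpace u G) {p q : ℝ}
    (hpq : p + q = 1) :
    H1 univ (extend p q u) (fun j => if j = 2 then LameHalfSpace.extend (-p) (-2 * q) (G j)
      else LameHalfSpace.extend p q (G j)) := by
  have lu := locallyIntegrable_of_rho_inv h.mem
  have lg := fun j => (h.gmem j).locallyIntegrable (by norm_num)
  refine ⟨fun j => ?_, ?_, fun j => ?_⟩
  · by_cases hj : j = 2
    · subst hj; simpa using isWeakDeriv_extend_normal lu (lg 2) (h.deriv 2) hpq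
    · simpa [hj] using isWeakDeriv_extend_tangential lu (lg j) hj (h.deriv j) p q
  · rw [Measure.restrict_univ]; exact memLp_rho_inv_extend h.mem p q
  · rw [Measure.restrict_univ]
    by_cases hj : j = 2
    · simpa [hj] using memLp_extend (h.gmem 2) _ _
    · simpa [hj] using memLp_extend (h.gmem j) _ _

/-! ### Averages in `L²` -/

section Average
variable {Θ α : Type*} [MeasurableSpace Θ] [MeasurableSpace α] {P : Measure Θ} {ν : Measure α}

theorem sq_lintegral_le [IsProbabilityMeasure P] {f : Θ → ℝ≥0∞} (hf : AEMeasurable f P) :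
    (∫⁻ t, f t ∂P) ^ (2:ℝ) ≤ ∫⁻ t, f t ^ (2:ℝ) ∂P := by
  have h := ENNReal.lintegral_mul_le_Lp_mul_Lq P (Real.HolderConjugate.two_two) hf
    (aemeasurable_const (b := (1:ℝ≥0∞)))
  simp only [Pi.mul_apply, mul_one, ENNReal.one_rpow, lintegral_const, measure_univ] at h
  calc (∫⁻ t, f t ∂P) ^ (2:ℝ) ≤ ((∫⁻ t, f t ^ (2:ℝ) ∂P) ^ (1 / (2:ℝ))) ^ (2:ℝ) := by
        exact ENNReal.rpow_le_rpow h (by norm_num)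
    _ = _ := by rw [← ENNReal.rpow_mul]; norm_num

theorem eLpNorm_two_le_iff {f : α → ℝ} {B : ℝ≥0∞} :
    eLpNorm f 2 ν ≤ B ↔ ∫⁻ x, ‖f x‖ₑ ^ (2:ℝ) ∂ν ≤ B ^ (2:ℝ) := by
  rw [eLpNorm_eq_lintegral_rpow_enorm_toReal (by norm_num) (by norm_num)]
  simp only [ENNReal.toReal_ofNat]
  rw [one_div, ENNReal.rpow_inv_le_iff (by norm_num)]

/-- Minkowski's inequality for averages with respect to a probability measure. -/
theorem eLpNorm_average_le [IsProbabilityMeasure P] [SFinite ν] {F : Θ → α → ℝ}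
    (hF : StronglyMeasurable (Function.uncurry F)) {B : ℝ≥0∞}
    (hB : ∀ᵐ t ∂P, eLpNorm (F t) 2 ν ≤ B) : eLpNorm (fun x => ∫ t, F t x ∂P) 2 ν ≤ B := by
  rw [eLpNorm_two_le_iff]
  have hm : Measurable (Function.uncurry fun (t : Θ) (x : α) => ‖F t x‖ₑ ^ (2:ℝ)) :=
    (hF.measurable.enorm).pow_const _
  calc ∫⁻ x, ‖∫ t, F t x ∂P‖ₑ ^ (2:ℝ) ∂ν ≤ ∫⁻ x, ∫⁻ t, ‖F t x‖ₑ ^ (2:ℝ) ∂P ∂ν := by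
        refine lintegral_mono fun x => ?_
        refine (ENNReal.rpow_le_rpow (enorm_integral_le_lintegral_enorm _) (by norm_num)).trans ?_
        refine sq_lintegral_le ?_
        exact ((hF.measurable.comp measurable_prodMk_right).enorm).aemeasurable
    _ = ∫⁻ t, ∫⁻ x, ‖F t x‖ₑ ^ (2:ℝ) ∂ν ∂P :=
        lintegral_lintegral_swap (hm.comp measurable_swap).aemeasurable
    _ ≤ ∫⁻ _t, B ^ (2:ℝ) ∂P := by
        refine lintegral_mono_ae ?_
        filter_upwards [hB] with t ht
        exact eLpNorm_two_le_iff.1 ht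
    _ = B ^ (2:ℝ) := by simp

end Average

/-! ### Mollification -/

section Mollify
open scoped Convolution

/-- Strong continuity of translations in `L²`, read off from the continuous action of `DomAddAct` on
`Lp`. -/
theorem tendsto_eLpNorm_translate {g : E3 → ℝ} (hg : MemLp g 2 volume) :
    Tendsto (fun a : E3 => eLpNorm (fun x => g (x - a) - g x) 2 volume) (𝓝 0) (𝓝 0) := by
  have : Fact ((2:ℝ≥0∞) ≠ ⊤) := ⟨by norm_num⟩
  have hc : Continuous fun a : E3 => (DomAddAct.mk (-a) +ᵥ hg.toLp g) - hg.toLp g := by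
    have h1 : Continuous fun a : E3 => (DomAddAct.mk (-a)) +ᵥ hg.toLp g :=
      (DomAddAct.continuous_mk.comp continuous_neg).vadd continuous_const
    exact Continuous.sub h1 (continuous_const (y := hg.toLp g))
  have h0 := (hc.enorm).tendsto 0
  have e0 : (DomAddAct.mk (-(0:E3)) +ᵥ hg.toLp g) - hg.toLp g = 0 := by simp
  rw [e0, enorm_zero] at h0
  refine h0.congr fun a => ?_
  have e1 := DomAddAct.mk_vadd_toLp (-a) hg
  rw [e1, ← MemLp.toLp_sub, Lp.enorm_toLp]
  refine eLpNorm_congr_ae (Eventually.of_forall fun x => ?_)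
  simp [sub_eq_add_neg, add_comm]

/-- The mollification of `g` by a bump function. -/
def mollify (η : ContDiffBump (0 : E3)) (g : E3 → ℝ) : E3 → ℝ :=
  (η.normed volume) ⋆[ContinuousLinearMap.lsmul ℝ ℝ, volume] g

theorem mollify_congr (η : ContDiffBump (0 : E3)) {g g' : E3 → ℝ} (h : g =ᵐ[volume] g') :
    mollify η g = mollify η g' := convolution_congr _ (ae_eq_refl _) h

theorem contDiff_mollify (η : ContDiffBump (0 : E3)) {g : E3 → ℝ}
    (hg : LocallyIntegrable g volume) : ContDiff ℝ ∞ (mollify η g) :=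
  η.hasCompactSupport_normed.contDiff_convolution_left _ η.contDiff_normed hg

theorem hasCompactSupport_mollify (η : ContDiffBump (0 : E3)) {g : E3 → ℝ}
    (hg : HasCompactSupport g) : HasCompactSupport (mollify η g) :=
  η.hasCompactSupport_normed.convolution _ hg

theorem mollify_eq (η : ContDiffBump (0 : E3)) (g : E3 → ℝ) (x : E3) :
    mollify η g x = ∫ t, g t * η.normed volume (x - t) := by
  unfold mollify
  rw [convolution_lsmul_swap]
  simp [mul_comm]

/-- The derivative falls on the kernel, and `t ↦ η(x - t)` is a test function; the weak derivative
then moves it onto `g`, the two minus signs cancelling. -/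
theorem pderiv_mollify (η : ContDiffBump (0 : E3)) {g G : E3 → ℝ} {j : Fin 3}
    (h : IsWeakDeriv univ (idx j) g G) : pderiv j (mollify η g) = mollify η G := by
  ext x
  obtain ⟨hg, hG, hd⟩ := isWeakDeriv_idx.1 h
  rw [locallyIntegrableOn_univ] at hg hG
  have hf := η.hasCompactSupport_normed.hasFDerivAt_convolution_left
    (ContinuousLinearMap.lsmul ℝ ℝ) (η.contDiff_normed (n := 1) (μ := volume)) hg x
  have hφ : IsTest univ (fun t => η.normed volume (x - t)) := by
    refine ⟨η.contDiff_normed.comp (contDiff_const.sub contDiff_id), ?_, subset_univ _⟩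
    exact η.hasCompactSupport_normed.comp_homeomorph (Homeomorph.subLeft x)
  have hd' := hd _ hφ
  simp only [Measure.restrict_univ] at hd'
  rw [mollify_eq, ← neg_eq_iff_eq_neg.2 hd', ← integral_neg]
  unfold LameHalfSpace.pderiv
  have hfd := hf.fderiv
  change fderiv ℝ (mollify η g) x = _ at hfd
  rw [hfd, convolution_eq_swap]
  have hce := η.hasCompactSupport_normed.fderiv ℝ |>.convolutionExists_left
    ((ContinuousLinearMap.lsmul ℝ ℝ : ℝ →L[ℝ] ℝ →L[ℝ] ℝ).precompL E3)
    ((η.contDiff_normed (n := 1) (μ := volume)).continuous_fderiv (by simp)) hg x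
  have hint := hce.integrable_swap
  rw [ContinuousLinearMap.integral_apply hint]
  congr 1; ext t
  have : fderiv ℝ (fun t => η.normed volume (x - t)) t = - fderiv ℝ (η.normed volume) (x - t) := by
    have hdf : DifferentiableAt ℝ (η.normed volume) (x - t) :=
      ((η.contDiff_normed (n := 1) (μ := volume)).differentiable (by simp)) _
    have := (hdf.hasFDerivAt.comp t ((hasFDerivAt_id t).const_sub x)).fderiv
    change fderiv ℝ (η.normed volume ∘ fun t => x - t) t = _
    refine this.trans ?_
    ext v; simp
  rw [this]
  simp [ContinuousLinearMap.precompL_apply, mul_comm]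

theorem exists_mollify_close {g : E3 → ℝ} (hg : MemLp g 2 volume) {ε : ℝ≥0∞} (hε : 0 < ε) :
    ∃ r > 0, ∀ η : ContDiffBump (0 : E3), η.rOut < r →
      eLpNorm (fun x => mollify η g x - g x) 2 volume ≤ ε := by
  -- A strongly measurable representative makes `(y, x) ↦ g (x - y)` jointly measurable, as the
  -- averaged Minkowski inequality requires.
  wlog hs : StronglyMeasurable g generalizing g with H
  · obtain ⟨r, hr, h⟩ := H (hg.ae_eq hg.1.ae_eq_mk) hg.1.stronglyMeasurable_mk
    refine ⟨r, hr, fun η hη => ?_⟩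
    rw [mollify_congr η hg.1.ae_eq_mk]
    refine (eLpNorm_congr_ae ?_).trans_le (h η hη)
    filter_upwards [hg.1.ae_eq_mk] with x hx
    rw [hx]
  obtain ⟨r, hr, h⟩ := Metric.eventually_nhds_iff.1
    ((tendsto_eLpNorm_translate hg).eventually (ge_mem_nhds hε))
  refine ⟨r, hr, fun η hη => ?_⟩
  -- With the kernel as a probability measure, `mollify η g - g` is the mean of `g(· - y) - g` over
  -- the small support of `η`, and each such difference is small in `L²`.
  set P : Measure E3 := volume.withDensity fun y => ENNReal.ofReal (η.normed volume y) with hP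
  have hmeas : Measurable fun y => ENNReal.ofReal (η.normed volume y) :=
    η.continuous_normed.measurable.ennreal_ofReal
  have hprob : IsProbabilityMeasure P := ⟨by
    rw [hP, withDensity_apply _ MeasurableSet.univ, Measure.restrict_univ,
      ← ofReal_integral_eq_lintegral_ofReal η.integrable_normed
        (Eventually.of_forall η.nonneg_normed), η.integral_normed]
    simp⟩
  have hint : ∀ F : E3 → ℝ, ∫ y, F y ∂P = ∫ y, η.normed volume y * F y := by
    intro F
    rw [hP, integral_withDensity_eq_integral_toReal_smul hmeas
      (Eventually.of_forall fun _ => ENNReal.ofReal_lt_top)]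
    congr 1; ext y
    rw [ENNReal.toReal_ofReal (η.nonneg_normed y), smul_eq_mul]
  have hF : StronglyMeasurable (Function.uncurry fun (y x : E3) => g (x - y) - g x) :=
    (hs.comp_measurable (measurable_snd.sub measurable_fst)).sub (hs.comp_measurable measurable_snd)
  have key : ∀ x, mollify η g x - g x = ∫ y, (g (x - y) - g x) ∂P := by
    intro x
    rw [hint]
    have hce := η.hasCompactSupport_normed.convolutionExists_left
      (ContinuousLinearMap.lsmul ℝ ℝ : ℝ →L[ℝ] ℝ →L[ℝ] ℝ)
      (η.continuous_normed (μ := volume)) (hg.locallyIntegrable (by norm_num)) x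
    have h1 : Integrable fun y => η.normed volume y * g (x - y) := hce
    simp only [mul_sub]
    rw [integral_sub h1 (η.integrable_normed.mul_const _), integral_mul_const, η.integral_normed,
      one_mul]
    rfl
  simp only [key]
  refine eLpNorm_average_le hF ?_
  rw [hP, ae_withDensity_iff hmeas]
  refine Eventually.of_forall fun y hy => ?_
  have hy' : y ∈ Function.support (η.normed volume) := by
    intro h0; rw [h0] at hy; simp at hy
  rw [η.support_normed_eq] at hy'
  exact h (lt_trans hy' hη)

end Mollify

/-! ### Density of smooth compactly supported functions -/

theorem nrm_tendsto_zero_of_dominated {α : Type*} [MeasurableSpace α] {μ : Measure α}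
    {f : ℕ → α → ℝ} {g : α → ℝ} (hf : ∀ n, AEStronglyMeasurable (f n) μ) (hg : MemLp g 2 μ)
    (hfg : ∀ n, ∀ᵐ x ∂μ, |f n x| ≤ |g x|)
    (h0 : ∀ᵐ x ∂μ, Tendsto (fun n => f n x) atTop (𝓝 0)) :
    Tendsto (fun n => nrm μ (f n)) atTop (𝓝 0) := by
  have hm : ∀ n, MemLp (f n) 2 μ := fun n => hg.mono (hf n) (hfg n)
  have hsq : Tendsto (fun n => ∫ x, f n x ^ 2 ∂μ) atTop (𝓝 (∫ _x, (0:ℝ) ∂μ)) := by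
    refine tendsto_integral_of_dominated_convergence (fun x => g x ^ 2) (fun n => (hf n).pow 2)
      (integrable_sq hg) (fun n => ?_) ?_
    · filter_upwards [hfg n] with x hx
      rw [Real.norm_eq_abs, abs_pow, ← sq_abs (g x)]
      gcongr
    · filter_upwards [h0] with x hx
      simpa using hx.pow 2
  have := hsq.sqrt
  simp only [integral_zero, Real.sqrt_zero] at this
  refine this.congr fun n => ?_
  rw [← nrm_sq (hm n), Real.sqrt_sq (nrm_nonneg _ _)]

/-- A smooth cutoff, equal to one on the ball of radius `n+1`. -/
def cutoff (n : ℕ) (x : E3) : ℝ := Real.smoothTransition (2 - ‖x‖ ^ 2 * (((n:ℝ) + 1) ^ 2)⁻¹)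

theorem contDiff_cutoff (n : ℕ) : ContDiff ℝ ∞ (cutoff n) := by
  unfold cutoff
  exact Real.smoothTransition.contDiff.comp
    (contDiff_const.sub ((contDiff_norm_sq ℝ).mul contDiff_const))

theorem abs_cutoff_le_one (n : ℕ) (x : E3) : |cutoff n x| ≤ 1 := by
  unfold cutoff
  rw [abs_of_nonneg (Real.smoothTransition.nonneg _)]
  exact Real.smoothTransition.le_one _

theorem hasCompactSupport_cutoff (n : ℕ) : HasCompactSupport (cutoff n) := by
  refine HasCompactSupport.intro (isCompact_closedBall (0:E3) (2 * (n + 1))) fun x hx => ?_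
  refine Real.smoothTransition.zero_of_nonpos ?_
  simp only [Metric.mem_closedBall, dist_zero_right, not_le] at hx
  have h1 : (0:ℝ) < n + 1 := by positivity
  have h2 : (2 * ((n:ℝ) + 1)) ^ 2 ≤ ‖x‖ ^ 2 := by gcongr
  rw [sub_nonpos, ← div_eq_mul_inv, le_div_iff₀ (by positivity)]
  nlinarith

theorem hasFDerivAt_norm_sq' (x : E3) : HasFDerivAt (fun x : E3 => ‖x‖ ^ 2)
    (2 • (innerSL ℝ x)) x := (hasStrictFDerivAt_norm_sq x).hasFDerivAt

theorem pderiv_cutoff (n : ℕ) (j : Fin 3) (x : E3) : pderiv j (cutoff n) x =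
    deriv Real.smoothTransition (2 - ‖x‖ ^ 2 * (((n:ℝ) + 1) ^ 2)⁻¹) *
      (-(2 * x j * (((n:ℝ) + 1) ^ 2)⁻¹)) := by
  have hd : HasFDerivAt (fun x : E3 => 2 - ‖x‖ ^ 2 * (((n:ℝ) + 1) ^ 2)⁻¹) _ x :=
    ((hasFDerivAt_norm_sq' x).mul_const _).const_sub 2
  have hs : HasDerivAt Real.smoothTransition _ (2 - ‖x‖ ^ 2 * (((n:ℝ) + 1) ^ 2)⁻¹) :=
    ((Real.smoothTransition.contDiff (n := 1)).differentiable (by simp) _).hasDerivAt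
  have := (hs.comp_hasFDerivAt x hd).fderiv
  unfold LameHalfSpace.pderiv
  change fderiv ℝ (Real.smoothTransition ∘ fun x : E3 => 2 - ‖x‖ ^ 2 * (((n:ℝ) + 1) ^ 2)⁻¹) x _ = _
  rw [this]
  simp [EuclideanSpace.inner_single_right]
  ring_nf
  simp

theorem abs_coord_le_norm (x : E3) (j : Fin 3) : |x j| ≤ ‖x‖ := by
  simpa using PiLp.norm_apply_le x j

/-- The gradient of the cutoff is at most of order `1/n` and lives where `|x|` is comparable to `n`.
The scale invariant bound lets `u ∇(cutoff)` be controlled by `u/ϱ` alone. The 6 comes from `2ϱ² ≤ 2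
+ 4(n+1)² ≤ 6(n+1)²` on the ball `|x|² ≤ 2(n+1)²`. -/
theorem rho_mul_abs_pderiv_cutoff_le : ∃ D : ℝ, 0 ≤ D ∧ ∀ n j x,
    rho x * |pderiv j (cutoff n) x| ≤ D := by
  obtain ⟨D, hD0, hD⟩ := exists_deriv_smoothTransition_bound
  refine ⟨D * 6, by positivity, fun n j x => ?_⟩
  rw [pderiv_cutoff, abs_mul]
  have hn : (1:ℝ) ≤ ((n:ℝ) + 1) ^ 2 := by
    have : (0:ℝ) ≤ n := by positivity
    nlinarith
  have hn0 : (0:ℝ) < ((n:ℝ) + 1) ^ 2 := by positivity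
  by_cases h : ‖x‖ ^ 2 ≤ 2 * ((n:ℝ) + 1) ^ 2
  · have h1 : rho x * |-(2 * x j * (((n:ℝ) + 1) ^ 2)⁻¹)| ≤ 6 := by
      rw [abs_neg, abs_mul, abs_mul, abs_of_pos (inv_pos.2 hn0), ← mul_assoc, ← div_eq_mul_inv,
        div_le_iff₀ hn0]
      have h2 := rho_sq x
      have h3 : |x j| ≤ rho x := (abs_coord_le_norm x j).trans (norm_le_rho x)
      have h4 := rho_pos x
      simp only [Nat.abs_ofNat]
      nlinarith
    calc _ = |deriv Real.smoothTransition (2 - ‖x‖ ^ 2 * (((n:ℝ) + 1) ^ 2)⁻¹)| *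
          (rho x * |-(2 * x j * (((n:ℝ) + 1) ^ 2)⁻¹)|) := by ring
      _ ≤ D * 6 := mul_le_mul (hD _) h1 (by have := rho_pos x; positivity) hD0
  · rw [deriv_smoothTransition_eq_zero]
    · simp [hD0]
    · left
      push Not at h
      rw [sub_neg, ← div_eq_mul_inv, lt_div_iff₀ hn0]
      exact h

theorem cutoff_eventually (x : E3) :
    ∀ᶠ n : ℕ in atTop, cutoff n x = 1 ∧ ∀ j, pderiv j (cutoff n) x = 0 := by
  have ht : Tendsto (fun n : ℕ => (n:ℝ)) atTop atTop := tendsto_natCast_atTop_atTop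
  filter_upwards [ht.eventually_gt_atTop ‖x‖] with n hn
  have hn0 : (0:ℝ) < ((n:ℝ) + 1) ^ 2 := by positivity
  have h1 : ‖x‖ ^ 2 * (((n:ℝ) + 1) ^ 2)⁻¹ < 1 := by
    rw [← div_eq_mul_inv, div_lt_one hn0]
    have := norm_nonneg x
    nlinarith
  refine ⟨Real.smoothTransition.one_of_one_le (by linarith), fun j => ?_⟩
  rw [pderiv_cutoff, deriv_smoothTransition_eq_zero (Or.inr (by linarith)), zero_mul]

section Density
variable {u : E3 → ℝ} {G : Fin 3 → E3 → ℝ}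

/-- The gradient of the product with a smooth function. -/
def smulGrad (w : E3 → ℝ) (u : E3 → ℝ) (G : Fin 3 → E3 → ℝ) : Fin 3 → E3 → ℝ :=
  fun j x => w x * G j x + pderiv j w x * u x

/-- Products with smooth functions that are bounded and whose gradient is dominated by
`1/ϱ`. -/
theorem H1.smooth_mul {Ω : Set E3} (hΩ : IsOpen Ω) (h : H1 Ω u G) {w : E3 → ℝ}
    (hw : ContDiff ℝ ∞ w) {A B : ℝ} (hA : ∀ x, |w x| ≤ A)
    (hB : ∀ j x, rho x * |pderiv j w x| ≤ B) :
    H1 Ω (fun x => w x * u x) (smulGrad w u G) := by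
  refine ⟨fun j => (h.deriv j).smooth_mul hΩ hw, ?_, fun j => ?_⟩
  · refine memLp_of_le (c := A) h.mem ?_ (Eventually.of_forall fun x => ?_)
    · refine (hw.continuous.aestronglyMeasurable.mul h.mem.1).congr
        (Eventually.of_forall fun x => ?_)
      simp only [Pi.mul_apply]; ring
    · rw [mul_left_comm, abs_mul]
      exact mul_le_mul_of_nonneg_right (hA x) (abs_nonneg _)
  · refine MemLp.add ?_ ?_
    · refine memLp_of_le (c := A) (h.gmem j)
        (hw.continuous.aestronglyMeasurable.mul (h.gmem j).1) (Eventually.of_forall fun x => ?_)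
      rw [abs_mul]
      exact mul_le_mul_of_nonneg_right (hA x) (abs_nonneg _)
    · have heq : ∀ x, pderiv j w x * u x = (rho x * pderiv j w x) * ((rho x)⁻¹ * u x) := fun x => by
        have := (rho_pos x).ne'
        field_simp
      simp only [heq]
      refine memLp_of_le (c := B) h.mem ((continuous_rho.mul
        (contDiff_pderiv hw j).continuous).aestronglyMeasurable.mul h.mem.1)
        (Eventually.of_forall fun x => ?_)
      rw [abs_mul]
      refine mul_le_mul_of_nonneg_right ?_ (abs_nonneg _)
      rw [abs_mul, abs_of_pos (rho_pos x)]
      exact hB j x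

/-- Dominated convergence: the gradient error is at most `2|G j| + D|u/ϱ|` and vanishes pointwise
for large `n`. -/
theorem H1.exists_cutoff_close (h : H1 univ u G) {ε : ℝ} (hε : 0 < ε) :
    ∃ v F, H1 univ v F ∧ MemLp v 2 volume ∧ HasCompactSupport v ∧
      nrm volume (fun x => (rho x)⁻¹ * (v x - u x)) ≤ ε ∧
      ∀ j, nrm volume (fun x => F j x - G j x) ≤ ε := by
  have hmem := h.mem
  have hgmem := h.gmem
  simp only [Measure.restrict_univ] at hmem hgmem
  obtain ⟨D, hD0, hD⟩ := rho_mul_abs_pderiv_cutoff_le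
  have hH : ∀ n, H1 univ (fun x => cutoff n x * u x) (smulGrad (cutoff n) u G) := fun n =>
    h.smooth_mul isOpen_univ (contDiff_cutoff n) (abs_cutoff_le_one n) (hD n)
  have t0 : Tendsto (fun n => nrm volume fun x => (rho x)⁻¹ * (cutoff n x * u x - u x)) atTop
      (𝓝 0) := by
    refine nrm_tendsto_zero_of_dominated (g := fun x => 2 * ((rho x)⁻¹ * u x)) (fun n => ?_)
      (hmem.const_mul 2) (fun n => Eventually.of_forall fun x => ?_)
      (Eventually.of_forall fun x => ?_)
    · have := (hH n).mem.sub h.mem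
      simp only [Measure.restrict_univ] at this
      refine this.1.congr (Eventually.of_forall fun x => ?_)
      simp only [Pi.sub_apply]; ring
    · have h1 : (rho x)⁻¹ * (cutoff n x * u x - u x) = (cutoff n x - 1) * ((rho x)⁻¹ * u x) := by
        ring
      rw [h1, abs_mul, abs_mul 2]
      refine mul_le_mul_of_nonneg_right ?_ (abs_nonneg _)
      have := abs_cutoff_le_one n x
      rw [abs_le] at this ⊢
      rw [abs_two]
      constructor <;> linarith
    · refine tendsto_const_nhds.congr' ?_
      filter_upwards [cutoff_eventually x] with n hn
      rw [hn.1]; ring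
  have t1 : ∀ j, Tendsto (fun n => nrm volume fun x => smulGrad (cutoff n) u G j x - G j x) atTop
      (𝓝 0) := by
    intro j
    refine nrm_tendsto_zero_of_dominated
      (g := fun x => 2 * |G j x| + D * |(rho x)⁻¹ * u x|) (fun n => ?_)
      (((hgmem j).abs.const_mul 2).add (hmem.abs.const_mul D))
      (fun n => Eventually.of_forall fun x => ?_)
      (Eventually.of_forall fun x => ?_)
    · have := ((hH n).gmem j).sub (h.gmem j)
      simp only [Measure.restrict_univ] at this
      exact this.1
    · have h1 : smulGrad (cutoff n) u G j x - G j x = (cutoff n x - 1) * G j x +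
          (rho x * pderiv j (cutoff n) x) * ((rho x)⁻¹ * u x) := by
        have := (rho_pos x).ne'
        unfold smulGrad
        field_simp
        ring
      rw [h1]
      refine (abs_add_le _ _).trans ?_
      rw [abs_mul, abs_mul (rho x * _)]
      refine le_trans ?_ (le_abs_self _)
      have h2 := abs_cutoff_le_one n x
      refine add_le_add (mul_le_mul_of_nonneg_right ?_ (abs_nonneg _))
        (mul_le_mul_of_nonneg_right ?_ (abs_nonneg _))
      · rw [abs_le] at h2 ⊢
        constructor <;> linarith
      · rw [abs_mul, abs_of_pos (rho_pos x)]
        exact hD n j x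
    · refine tendsto_const_nhds.congr' ?_
      filter_upwards [cutoff_eventually x] with n hn
      simp [smulGrad, hn.1, hn.2]
  have hev : ∀ᶠ n in atTop, (nrm volume fun x => (rho x)⁻¹ * (cutoff n x * u x - u x)) ≤ ε ∧
      ∀ j, (nrm volume fun x => smulGrad (cutoff n) u G j x - G j x) ≤ ε :=
    (t0.eventually (ge_mem_nhds hε)).and
      (eventually_all.2 fun j => (t1 j).eventually (ge_mem_nhds hε))
  obtain ⟨n, hn⟩ := hev.exists
  refine ⟨_, _, hH n, ?_, (hasCompactSupport_cutoff n).mul_right, hn⟩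
  -- On the support of the cutoff the weight is bounded, so the truncated function is in `L²`
  -- without a weight; mollification needs this.
  have hcr : HasCompactSupport fun x => cutoff n x * rho x := (hasCompactSupport_cutoff n).mul_right
  have hcc : Continuous fun x => cutoff n x * rho x := (contDiff_cutoff n).continuous.mul continuous_rho
  obtain ⟨B, hB⟩ := hcr.exists_bound_of_continuous hcc
  have heq : ∀ x, cutoff n x * u x = (cutoff n x * rho x) * ((rho x)⁻¹ * u x) := fun x => by
    have := (rho_pos x).ne'
    field_simp
  simp only [heq]
  refine memLp_of_le (c := B) hmem (hcc.aestronglyMeasurable.mul hmem.1)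
    (Eventually.of_forall fun x => ?_)
  rw [abs_mul]
  exact mul_le_mul_of_nonneg_right (hB x) (abs_nonneg _)

theorem H1.exists_smooth_close (h : H1 univ u G) {ε : ℝ} (hε : 0 < ε) :
    ∃ φ : E3 → ℝ, ContDiff ℝ ∞ φ ∧ HasCompactSupport φ ∧
      nrm volume (fun x => (rho x)⁻¹ * (φ x - u x)) ≤ ε ∧
      ∀ j, nrm volume (fun x => pderiv j φ x - G j x) ≤ ε := by
  obtain ⟨v, F, hv, hvm, hvc, h0, h1⟩ := h.exists_cutoff_close (half_pos hε)
  have hvmem := hv.mem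
  have hFmem := hv.gmem
  have hmem := h.mem
  have hgmem := h.gmem
  simp only [Measure.restrict_univ] at hvmem hFmem hmem hgmem
  have hε' : 0 < ENNReal.ofReal (ε / 2) := ENNReal.ofReal_pos.2 (half_pos hε)
  obtain ⟨r, hr, H⟩ := exists_mollify_close hvm hε'
  choose s hs S using fun j => exists_mollify_close (hFmem j) hε'
  -- One radius has to serve for the function and for its three derivatives.
  obtain ⟨t, ht0, ht⟩ : ∃ t > 0, t < r ∧ ∀ j, t < s j := by
    have : ∀ᶠ t in 𝓝[>] (0:ℝ), t < r ∧ ∀ j, t < s j := by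
      refine Filter.Eventually.and ?_ (eventually_all.2 fun j => ?_)
      · exact mem_nhdsWithin_of_mem_nhds (Iio_mem_nhds hr)
      · exact mem_nhdsWithin_of_mem_nhds (Iio_mem_nhds (hs j))
    obtain ⟨t, ht1, ht2⟩ := (this.and self_mem_nhdsWithin).exists
    exact ⟨t, ht2, ht1⟩
  let η : ContDiffBump (0 : E3) := ⟨t / 2, t, half_pos ht0, half_lt_self ht0⟩
  have hsm := contDiff_mollify η (hvm.locallyIntegrable (by norm_num))
  have hsc := hasCompactSupport_mollify η hvc
  refine ⟨mollify η v, hsm, hsc, ?_, fun j => ?_⟩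
  · have m1 : MemLp (fun x => mollify η v x - v x) 2 volume :=
      (hsm.continuous.memLp_of_hasCompactSupport hsc).sub hvm
    have n1 : nrm volume (fun x => mollify η v x - v x) ≤ ε / 2 :=
      ENNReal.toReal_le_of_le_ofReal (half_pos hε).le (H η ht.1)
    have hle : ∀ x, |(rho x)⁻¹ * (mollify η v x - v x)| ≤ 1 * |mollify η v x - v x| := fun x => by
      rw [abs_mul, abs_of_pos (rho_inv_pos x)]
      exact mul_le_mul_of_nonneg_right (rho_inv_le_one x) (abs_nonneg _)
    have m2 : MemLp (fun x => (rho x)⁻¹ * (mollify η v x - v x)) 2 volume :=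
      memLp_of_le m1 (continuous_rho_inv.aestronglyMeasurable.mul m1.1)
        (Eventually.of_forall hle)
    have m3 : MemLp (fun x => (rho x)⁻¹ * (v x - u x)) 2 volume := by
      simp only [mul_sub]; exact hvmem.sub hmem
    have n2 := nrm_le_const_mul zero_le_one m1 (Eventually.of_forall hle)
    have := nrm_add_le m2 m3
    simp only [← mul_add, sub_add_sub_cancel] at this
    linarith
  · rw [pderiv_mollify η (hv.deriv j)]
    have m0 : MemLp (mollify η (F j)) 2 volume := by
      rw [← pderiv_mollify η (hv.deriv j)]
      exact (contDiff_pderiv hsm j).continuous.memLp_of_hasCompactSupport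
        (hasCompactSupport_pderiv hsc j)
    have n1 : nrm volume (fun x => mollify η (F j) x - F j x) ≤ ε / 2 :=
      ENNReal.toReal_le_of_le_ofReal (half_pos hε).le (S j η (ht.2 j))
    have := nrm_add_le (m0.sub (hFmem j)) ((hFmem j).sub (hgmem j))
    simp only [Pi.sub_apply, sub_add_sub_cancel] at this
    change _ ≤ nrm volume (fun x => mollify η (F j) x - F j x) +
      nrm volume (fun x => F j x - G j x) at this
    linarith [h1 j]

/-- `φ n → u` in `H^1_0(Ω)`. -/
structure Approx (μ : Measure E3) (φ : ℕ → E3 → ℝ) (u : E3 → ℝ) (G : Fin 3 → E3 → ℝ) : Prop where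
  smooth : ∀ n, ContDiff ℝ ∞ (φ n)
  compact : ∀ n, HasCompactSupport (φ n)
  lim : Tendsto (fun n => nrm μ (fun x => (rho x)⁻¹ * (φ n x - u x))) atTop (𝓝 0)
  glim : ∀ j, Tendsto (fun n => nrm μ (fun x => pderiv j (φ n) x - G j x)) atTop (𝓝 0)

theorem H1.exists_approx_univ (h : H1 univ u G) : ∃ φ, Approx volume φ u G := by
  choose φ h1 h2 h3 h4 using fun n : ℕ =>
    h.exists_smooth_close (ε := 1 / ((n:ℝ) + 1)) (by positivity)
  exact ⟨φ, h1, h2,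
    squeeze_zero (fun _ => nrm_nonneg _ _) h3 tendsto_one_div_add_atTop_nhds_zero_nat,
    fun j => squeeze_zero (fun _ => nrm_nonneg _ _) (fun n => h4 n j)
      tendsto_one_div_add_atTop_nhds_zero_nat⟩

theorem memLp_pderiv {μ : Measure E3} [IsFiniteMeasureOnCompacts μ] {φ : E3 → ℝ}
    (h : ContDiff ℝ ∞ φ) (hc : HasCompactSupport φ) (j : Fin 3) : MemLp (pderiv j φ) 2 μ :=
  (contDiff_pderiv h j).continuous.memLp_of_hasCompactSupport (hasCompactSupport_pderiv hc j)

theorem memLp_rho_inv_mul {μ : Measure E3} [IsFiniteMeasureOnCompacts μ] {φ : E3 → ℝ}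
    (h : ContDiff ℝ ∞ φ) (hc : HasCompactSupport φ) : MemLp (fun x => (rho x)⁻¹ * φ x) 2 μ :=
  (continuous_rho_inv.mul h.continuous).memLp_of_hasCompactSupport hc.mul_left

/-- Even reflection (`p = 1`, `q = 0`), approximation on the whole space, and restriction. The
approximants are not required to vanish on the boundary, as befits a natural boundary condition. -/
theorem H1.exists_approx (h : H1 halfSpace u G) : ∃ φ, Approx hsVol φ u G := by
  have hE := h.extend (p := 1) (q := 0) (by norm_num)
  have hEm := hE.mem
  have hEg := hE.gmem
  simp only [Measure.restrict_univ] at hEm hEg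
  obtain ⟨φ, hφ⟩ := hE.exists_approx_univ
  refine ⟨φ, hφ.smooth, hφ.compact, ?_, fun j => ?_⟩
  · refine squeeze_zero (fun _ => nrm_nonneg _ _) (fun n => ?_) hφ.lim
    refine nrm_restrict_le (F := fun x => (rho x)⁻¹ * (φ n x - LameHalfSpace.extend 1 0 u x)) ?_
      fun x hx => ?_
    · refine ((memLp_rho_inv_mul (hφ.smooth n) (hφ.compact n)).sub hEm).ae_eq
        (Eventually.of_forall fun x => ?_)
      simp only [Pi.sub_apply, mul_sub]
    · rw [extend_of_mem hx]
  · refine squeeze_zero (fun _ => nrm_nonneg _ _) (fun n => ?_) (hφ.glim j)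
    refine nrm_restrict_le ((memLp_pderiv (hφ.smooth n) (hφ.compact n) j).sub (hEg j))
      fun x hx => ?_
    by_cases hj : j = 2 <;> simp [hj, extend_of_mem hx]

/-- Along a subsequence the approximation converges almost everywhere. -/
theorem Approx.exists_ae {μ : Measure E3} [IsFiniteMeasureOnCompacts μ] {φ : ℕ → E3 → ℝ}
    (h : Approx μ φ u G) (hu : MemLp (fun x => (rho x)⁻¹ * u x) 2 μ) :
    ∃ ψ, Approx μ ψ u G ∧ ∀ᵐ x ∂μ, Tendsto (fun n => ψ n x) atTop (𝓝 (u x)) := by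
  have := exists_subseq_ae (fun n => memLp_rho_inv_mul (μ := μ) (h.smooth n) (h.compact n)) hu
    (by simpa only [mul_sub] using h.lim)
  obtain ⟨ns, hns, hae⟩ := this
  refine ⟨fun n => φ (ns n), ⟨fun n => h.smooth _, fun n => h.compact _,
    h.lim.comp hns.tendsto_atTop, fun j => (h.glim j).comp hns.tendsto_atTop⟩, ?_⟩
  filter_upwards [hae] with x hx
  have := hx.const_mul (rho x)
  simpa [← mul_assoc, mul_inv_cancel₀ (rho_pos x).ne'] using this

end Density

/-! ### Korn's inequality -/

/-- The symmetric part of a matrix of functions. -/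
def symPart (G : Fin 3 → Fin 3 → E3 → ℝ) (i j : Fin 3) (x : E3) : ℝ := (G i j x + G j i x) / 2

theorem memLp_symPart {μ : Measure E3} {G : Fin 3 → Fin 3 → E3 → ℝ}
    (h : ∀ i j, MemLp (G i j) 2 μ) (i j : Fin 3) : MemLp (symPart G i j) 2 μ := by
  refine (((h i j).add (h j i)).const_mul 2⁻¹).ae_eq (Eventually.of_forall fun x => ?_)
  simp only [Pi.add_apply, symPart]; ring

/-- Two integrations by parts. This identity turns the cross terms of the squared strain into
products of diagonal derivatives. -/
theorem integral_pderiv_mul_pderiv {φ ψ : E3 → ℝ} (hφ : ContDiff ℝ ∞ φ) (hψ : ContDiff ℝ ∞ ψ)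
    (hc : HasCompactSupport ψ) (i j : Fin 3) :
    ∫ x, pderiv j φ x * pderiv i ψ x = ∫ x, pderiv i φ x * pderiv j ψ x := by
  rw [integral_pderiv_mul (contDiff_pderiv hφ j) hψ hc,
    integral_pderiv_mul (contDiff_pderiv hφ i) hψ hc, pderiv_comm hφ]

/-- Expanding the square, `‖sym ∇φ‖² = ½‖∇φ‖² + ½∫ ∂_jφ_i ∂_iφ_j`, summed over `i, j`. After the
exchange of derivatives the last integral is `∫ (div φ)² ≥ 0`. -/
theorem korn_smooth {φ : Fin 3 → E3 → ℝ} (hφ : ∀ i, ContDiff ℝ ∞ (φ i))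
    (hc : ∀ i, HasCompactSupport (φ i)) :
    ∑ i, ∑ j, nrm volume (pderiv j (φ i)) ^ 2 ≤
      2 * ∑ i, ∑ j, nrm volume (symPart (fun i j => pderiv j (φ i)) i j) ^ 2 := by
  have m : ∀ i j, MemLp (pderiv j (φ i)) 2 (volume : Measure E3) := fun i j =>
    memLp_pderiv (hφ i) (hc i) j
  have hI : ∀ i j k l, Integrable (fun x => pderiv j (φ i) x * pderiv l (φ k) x) :=
    fun i j k l => integrable_mul (m i j) (m k l)
  have e1 : ∀ i j, nrm volume (symPart (fun i j => pderiv j (φ i)) i j) ^ 2 =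
      (∫ x, pderiv j (φ i) x * pderiv j (φ i) x) / 4 +
      (∫ x, pderiv i (φ j) x * pderiv i (φ j) x) / 4 +
      (∫ x, pderiv i (φ i) x * pderiv j (φ j) x) / 2 := by
    intro i j
    rw [nrm_sq (memLp_symPart m i j), integral_pderiv_mul_pderiv (hφ i) (hφ j) (hc j),
      ← integral_div, ← integral_div, ← integral_div,
      ← integral_add ((hI _ _ _ _).div_const _) ((hI _ _ _ _).div_const _),
      ← integral_add (((hI i j i j).div_const 4).fun_add ((hI j i j i).div_const 4))
        ((hI _ _ _ _).div_const _)]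
    congr 1; ext x
    simp only [symPart]; ring
  have e2 : ∀ i j, nrm volume (pderiv j (φ i)) ^ 2 =
      ∫ x, pderiv j (φ i) x * pderiv j (φ i) x := by
    intro i j
    rw [nrm_sq (m i j)]; simp only [sq]
  have e3 : 0 ≤ ∑ i, ∑ j, ∫ x, pderiv i (φ i) x * pderiv j (φ j) x := by
    have : ∑ i, ∑ j, ∫ x, pderiv i (φ i) x * pderiv j (φ j) x =
        ∫ x, (∑ i, pderiv i (φ i) x) ^ 2 := by
      have hx : ∀ x, (∑ i, pderiv i (φ i) x) ^ 2 =
          ∑ i, ∑ j, pderiv i (φ i) x * pderiv j (φ j) x := fun x => by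
        rw [sq, Finset.sum_mul_sum]
      simp only [hx]
      rw [integral_finsetSum _ fun i _ => integrable_finsetSum _ fun j _ => hI _ _ _ _]
      exact Finset.sum_congr rfl fun i _ => (integral_finsetSum _ fun j _ => hI _ _ _ _).symm
    rw [this]
    exact integral_nonneg fun x => sq_nonneg _
  simp only [e1, e2, Fin.sum_univ_three] at e3 ⊢
  linarith

theorem Approx.tendsto_nrm {μ : Measure E3} [IsFiniteMeasureOnCompacts μ] {u : E3 → ℝ}
    {G : Fin 3 → E3 → ℝ} {φ : ℕ → E3 → ℝ} (h : Approx μ φ u G) (hG : ∀ j, MemLp (G j) 2 μ)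
    (j : Fin 3) : Tendsto (fun n => nrm μ (pderiv j (φ n))) atTop (𝓝 (nrm μ (G j))) :=
  nrm_sub_tendsto (fun n => memLp_pderiv (h.smooth n) (h.compact n) j) (hG j) (h.glim j)

theorem korn_univ {u : Fin 3 → E3 → ℝ} {G : Fin 3 → Fin 3 → E3 → ℝ}
    (h : ∀ i, H1 univ (u i) (G i)) :
    ∑ i, ∑ j, nrm volume (G i j) ^ 2 ≤ 2 * ∑ i, ∑ j, nrm volume (symPart G i j) ^ 2 := by
  have hg : ∀ i j, MemLp (G i j) 2 volume := fun i j => by simpa using (h i).gmem j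
  choose φ hφ using fun i => (h i).exists_approx_univ
  have m : ∀ n i j, MemLp (pderiv j (φ i n)) 2 (volume : Measure E3) := fun n i j =>
    memLp_pderiv ((hφ i).smooth n) ((hφ i).compact n) j
  have t1 := fun i j => (hφ i).tendsto_nrm (hg i) j
  have t2 : ∀ i j, Tendsto (fun n => nrm volume (symPart (fun i j => pderiv j (φ i n)) i j)) atTop
      (𝓝 (nrm volume (symPart G i j))) := by
    intro i j
    refine nrm_sub_tendsto (fun n => memLp_symPart (m n) i j) (memLp_symPart hg i j) ?_
    have hz := (((hφ i).glim j).add ((hφ j).glim i)).const_mul 2⁻¹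
    simp only [add_zero, mul_zero] at hz
    refine squeeze_zero (fun _ => nrm_nonneg _ _) (fun n => ?_) hz
    have e := nrm_const_mul (μ := volume) 2⁻¹ (fun x => (pderiv j (φ i n) x - G i j x) +
      (pderiv i (φ j n) x - G j i x))
    have e' : (fun x => symPart (fun i j => pderiv j (φ i n)) i j x - symPart G i j x) =
      fun x => 2⁻¹ * ((pderiv j (φ i n) x - G i j x) + (pderiv i (φ j n) x - G j i x)) := by
      ext x; simp only [symPart]; ring
    rw [e', e, abs_of_pos (by norm_num)]
    refine mul_le_mul_of_nonneg_left ?_ (by norm_num)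
    exact nrm_add_le ((m n i j).sub (hg i j)) ((m n j i).sub (hg j i))
  refine le_of_tendsto_of_tendsto'
    (tendsto_finsetSum _ fun i _ => tendsto_finsetSum _ fun j _ => (t1 i j).pow 2)
    ((tendsto_finsetSum _ fun i _ => tendsto_finsetSum _ fun j _ => (t2 i j).pow 2).const_mul 2)
    fun n => korn_smooth (fun i => (hφ i).smooth n) (fun i => (hφ i).compact n)

/-- Korn's inequality in the half space. -/
theorem korn {u : Fin 3 → E3 → ℝ} {G : Fin 3 → Fin 3 → E3 → ℝ}
    (h : ∀ i, H1 halfSpace (u i) (G i)) :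
    ∑ i, ∑ j, nrm hsVol (G i j) ^ 2 ≤ 288 * ∑ i, ∑ j, nrm hsVol (symPart G i j) ^ 2 := by
  -- A tangential component extended with `(p, q)` has a normal derivative extended with `(-p,
  -- -2q)`. For the mixed strains, the normal component must use this same pair, and both pairs must
  -- sum to one: `p + q = 1` and `-p - 2q = 1` force `(p, q) = (3, -2)`, hence `(-3, 4)` for the
  -- normal component.
  let p : Fin 3 → ℝ := fun i => if i = 2 then -3 else 3
  let q : Fin 3 → ℝ := fun i => if i = 2 then 4 else -2
  have hpq : ∀ i, p i + q i = 1 := fun i => by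
    simp only [p, q]; split_ifs <;> norm_num
  have hE := fun i => (h i).extend (hpq i)
  have hg := fun i => (h i).gmem
  have k := korn_univ hE
  have hs : ∀ i j, MemLp (symPart G i j) 2 hsVol := memLp_symPart hg
  set F : Fin 3 → Fin 3 → E3 → ℝ := fun i j =>
    if j = 2 then extend (-p i) (-2 * q i) (G i j) else extend (p i) (q i) (G i j) with hF
  have hFm : ∀ i j, MemLp (F i j) 2 volume := fun i j => by
    simpa only [Measure.restrict_univ] using (hE i).gmem j
  have lower : ∀ i j, nrm hsVol (G i j) ≤ nrm volume (F i j) := fun i j =>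
    nrm_restrict_le (hFm i j) fun x hx => by
      simp only [hF]; split_ifs <;> rw [extend_of_mem hx]
  have upper : ∀ i j, nrm volume (symPart F i j) ≤ 12 * nrm hsVol (symPart G i j) := by
    have key : ∀ i j, ∃ a b : ℝ, 1 + |a| + |b| ≤ 12 ∧ symPart F i j = extend a b (symPart G i j) := by
      have hlin : ∀ (a b : ℝ) i j, extend a b (symPart G i j) =
          fun x => (1/2) * extend a b (G i j) x + (1/2) * extend a b (G j i) x := by
        intro a b i j; ext x
        rw [← extend_linear]
        congr 1; ext y; simp only [symPart]; ring
      intro i j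
      -- `G i j` and `G j i` are extended with one common pair, so the symmetric part is extended
      -- too. The worst pair is `(3, -8)`, for the normal derivative of the normal component: `12 =
      -- 1 + 3 + 8`, and in the end `288 = 2 · 12²`.
      refine ⟨if i = 2 ∧ j = 2 then 3 else if i = 2 ∨ j = 2 then -3 else 3, if i = 2 ∧ j = 2 then -8 else
        if i = 2 ∨ j = 2 then 4 else -2, ?_, ?_⟩
      · fin_cases i <;> fin_cases j <;> simp <;> norm_num
      · rw [hlin]
        ext x
        fin_cases i <;> fin_cases j <;> simp [symPart, hF, p, q] <;> norm_num <;> ring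
    intro i j
    obtain ⟨a, b, hab, he⟩ := key i j
    rw [he]
    exact (nrm_extend_le (hs i j) a b).trans
      (mul_le_mul_of_nonneg_right hab (nrm_nonneg _ _))
  calc ∑ i, ∑ j, nrm hsVol (G i j) ^ 2 ≤ ∑ i, ∑ j, nrm volume (F i j) ^ 2 := by
        gcongr with i _ j _
        · exact nrm_nonneg _ _
        · exact lower i j
    _ ≤ 2 * ∑ i, ∑ j, nrm volume (symPart F i j) ^ 2 := k
    _ ≤ 2 * ∑ i, ∑ j, (12 * nrm hsVol (symPart G i j)) ^ 2 := by
        gcongr with i _ j _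
        · exact nrm_nonneg _ _
        · exact upper i j
    _ = 288 * ∑ i, ∑ j, nrm hsVol (symPart G i j) ^ 2 := by
        simp only [mul_pow, ← Finset.mul_sum]; ring

/-! ### Hardy's inequality -/

theorem pderiv_radial (x : E3) (j : Fin 3) :
    pderiv j (fun y : E3 => y j * (1 + ‖y‖ ^ 2)⁻¹) x =
      (1 + ‖x‖ ^ 2)⁻¹ - 2 * x j ^ 2 * ((1 + ‖x‖ ^ 2)⁻¹) ^ 2 := by
  have hp : (1 + ‖x‖ ^ 2 : ℝ) ≠ 0 := by positivity
  have h1 : HasFDerivAt (fun y : E3 => y j) (EuclideanSpace.proj j : E3 →L[ℝ] ℝ) x :=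
    (EuclideanSpace.proj j : E3 →L[ℝ] ℝ).hasFDerivAt
  have h2 : HasFDerivAt (fun y : E3 => (1 + ‖y‖ ^ 2)⁻¹) _ x :=
    (hasDerivAt_inv hp).comp_hasFDerivAt x ((hasFDerivAt_norm_sq' x).const_add 1)
  unfold pderiv
  rw [(h1.fun_mul h2).fderiv]
  simp [EuclideanSpace.inner_single_right]
  field_simp
  ring

/-- The field `X = x/(1+|x|²)` satisfies `div X ≥ ϱ⁻²` in dimension three and `|X_j| ≤ ϱ⁻¹`. From `∫
div X φ² = -2∫ φ X·∇φ` one gets `H² ≤ 2 H ∑ ‖∂_jφ‖` for `H = ‖φ/ϱ‖`, and divides by `H`. -/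
theorem hardy_smooth {φ : E3 → ℝ} (hφ : ContDiff ℝ ∞ φ) (hc : HasCompactSupport φ) :
    nrm volume (fun x => (rho x)⁻¹ * φ x) ≤ 2 * ∑ j, nrm volume (pderiv j φ) := by
  have m0 := memLp_rho_inv_mul (μ := volume) hφ hc
  have m1 := fun j => memLp_pderiv (μ := volume) hφ hc j
  set H := nrm volume (fun x => (rho x)⁻¹ * φ x) with hH
  have hcoordsm : ∀ j : Fin 3, ContDiff ℝ ∞ (fun y : E3 => y j * (1 + ‖y‖ ^ 2)⁻¹) := fun j => by
    refine ContDiff.mul (by fun_prop) (ContDiff.inv (contDiff_const.add (contDiff_norm_sq ℝ))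
      fun x => by positivity)
  have hφ2 : ContDiff ℝ ∞ (fun x => φ x * φ x) := hφ.mul hφ
  have hc2 : HasCompactSupport (fun x => φ x * φ x) := hc.mul_left
  have ibp := fun j => integral_pderiv_mul (hcoordsm j) hφ2 hc2 j
  have hi : ∀ j, Integrable fun x => pderiv j (fun y : E3 => y j * (1 + ‖y‖ ^ 2)⁻¹) x *
      (φ x * φ x) := fun j =>
    ((contDiff_pderiv (hcoordsm j) j).continuous.mul hφ2.continuous).integrable_of_hasCompactSupport
      hc2.mul_left
  have hrho : ∀ x, (1 + ‖x‖ ^ 2)⁻¹ = ((rho x)⁻¹) ^ 2 := fun x => by rw [inv_pow, rho_sq]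
  have lower : H ^ 2 ≤ ∑ j, ∫ x, pderiv j (fun y : E3 => y j * (1 + ‖y‖ ^ 2)⁻¹) x *
      (φ x * φ x) := by
    rw [hH, nrm_sq m0, ← integral_finsetSum _ fun j _ => hi j]
    refine integral_mono (integrable_sq m0) (integrable_finsetSum _ fun j _ => hi j) fun x => ?_
    simp only [pderiv_radial, ← Finset.sum_mul]
    have h1 : (∑ j : Fin 3, ((1 + ‖x‖ ^ 2)⁻¹ - 2 * x j ^ 2 * ((1 + ‖x‖ ^ 2)⁻¹) ^ 2)) =
        3 * (1 + ‖x‖ ^ 2)⁻¹ - 2 * ‖x‖ ^ 2 * ((1 + ‖x‖ ^ 2)⁻¹) ^ 2 := by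
      have : ‖x‖ ^ 2 = x 0 ^ 2 + x 1 ^ 2 + x 2 ^ 2 := by
        rw [EuclideanSpace.norm_sq_eq]; simp [Fin.sum_univ_three]
      simp only [Fin.sum_univ_three]
      rw [show 2 * ‖x‖ ^ 2 * ((1 + ‖x‖ ^ 2)⁻¹) ^ 2 = 2 * (x 0 ^ 2 + x 1 ^ 2 + x 2 ^ 2) *
        ((1 + ‖x‖ ^ 2)⁻¹) ^ 2 by rw [← this]]
      ring
    have h2 : (1 + ‖x‖ ^ 2)⁻¹ ≤ 3 * (1 + ‖x‖ ^ 2)⁻¹ - 2 * ‖x‖ ^ 2 * ((1 + ‖x‖ ^ 2)⁻¹) ^ 2 := by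
      have hp : (0:ℝ) < 1 + ‖x‖ ^ 2 := by positivity
      have h3 : ‖x‖ ^ 2 * ((1 + ‖x‖ ^ 2)⁻¹) ^ 2 ≤ (1 + ‖x‖ ^ 2)⁻¹ := by
        rw [sq (1 + ‖x‖ ^ 2)⁻¹, ← mul_assoc]
        refine mul_le_of_le_one_left (by positivity) ?_
        rw [← div_eq_mul_inv, div_le_one hp]; linarith
      linarith
    rw [h1, mul_pow, ← hrho, sq (φ x)]
    exact mul_le_mul_of_nonneg_right h2 (mul_self_nonneg _)
  have upper : ∀ j, (∫ x, pderiv j (fun y : E3 => y j * (1 + ‖y‖ ^ 2)⁻¹) x * (φ x * φ x)) ≤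
      2 * (H * nrm volume (pderiv j φ)) := by
    intro j
    have e : (∫ x, pderiv j (fun y : E3 => y j * (1 + ‖y‖ ^ 2)⁻¹) x * (φ x * φ x)) =
        -2 * ∫ x, ((rho x)⁻¹ * x j * ((rho x)⁻¹ * φ x)) * pderiv j φ x := by
      rw [← integral_const_mul, eq_comm, ← neg_eq_iff_eq_neg.2 (ibp j), ← integral_neg]
      congr 1; ext x
      have hd := hφ.differentiable (by simp) x
      rw [pderiv_mul hd hd, hrho]; ring
    have hle : ∀ x, |(rho x)⁻¹ * x j * ((rho x)⁻¹ * φ x)| ≤ 1 * |(rho x)⁻¹ * φ x| := fun x => by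
      rw [abs_mul]
      refine mul_le_mul_of_nonneg_right ?_ (abs_nonneg _)
      rw [abs_mul, abs_of_pos (rho_inv_pos x), inv_mul_le_iff₀ (rho_pos x), mul_one]
      exact (abs_coord_le_norm x j).trans (norm_le_rho x)
    have m2 : MemLp (fun x => (rho x)⁻¹ * x j * ((rho x)⁻¹ * φ x)) 2 volume := by
      refine memLp_of_le m0 ?_ (Eventually.of_forall hle)
      exact (continuous_rho_inv.mul (by fun_prop)).aestronglyMeasurable.mul m0.1
    have := abs_integral_mul_le m2 (m1 j)
    have h3 := nrm_le_const_mul zero_le_one m0 (Eventually.of_forall hle)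
    rw [e]
    have h4 := neg_abs_le (∫ x, ((rho x)⁻¹ * x j * ((rho x)⁻¹ * φ x)) * pderiv j φ x)
    have h5 := mul_le_mul_of_nonneg_right h3 (nrm_nonneg volume (pderiv j φ))
    linarith
  have hsum : H ^ 2 ≤ 2 * H * ∑ j, nrm volume (pderiv j φ) := by
    refine lower.trans ((Finset.sum_le_sum fun j _ => upper j).trans (le_of_eq ?_))
    rw [Finset.mul_sum]
    exact Finset.sum_congr rfl fun j _ => by ring
  have hH0 : 0 ≤ H := nrm_nonneg _ _
  rcases hH0.eq_or_lt with h0 | h0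
  · rw [← h0]
    exact mul_nonneg (by norm_num) (Finset.sum_nonneg fun j _ => nrm_nonneg _ _)
  · nlinarith

theorem hardy_univ {u : E3 → ℝ} {G : Fin 3 → E3 → ℝ} (h : H1 univ u G) :
    nrm volume (fun x => (rho x)⁻¹ * u x) ≤ 2 * ∑ j, nrm volume (G j) := by
  have hg : ∀ j, MemLp (G j) 2 volume := fun j => by simpa using h.gmem j
  have hm : MemLp (fun x => (rho x)⁻¹ * u x) 2 volume := by simpa using h.mem
  obtain ⟨φ, hφ⟩ := h.exists_approx_univ
  have t0 := nrm_sub_tendsto (fun n => memLp_rho_inv_mul (μ := volume) (hφ.smooth n) (hφ.compact n))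
    hm (by simpa only [mul_sub] using hφ.lim)
  refine le_of_tendsto_of_tendsto' t0
    ((tendsto_finsetSum _ fun j _ => hφ.tendsto_nrm hg j).const_mul 2)
    fun n => hardy_smooth (hφ.smooth n) (hφ.compact n)

/-- Hardy's inequality in the half space. -/
theorem hardy {u : E3 → ℝ} {G : Fin 3 → E3 → ℝ} (h : H1 halfSpace u G) :
    nrm hsVol (fun x => (rho x)⁻¹ * u x) ≤ 4 * ∑ j, nrm hsVol (G j) := by
  have hE := h.extend (p := 1) (q := 0) (by norm_num)
  have k := hardy_univ hE
  have hm : MemLp (fun x => (rho x)⁻¹ * extend 1 0 u x) 2 volume := by simpa using hE.mem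
  have l := nrm_restrict_le hm (g := fun x => (rho x)⁻¹ * u x) fun x hx => by
    rw [extend_of_mem hx]
  refine l.trans (k.trans ?_)
  have : ∀ j, nrm volume (if j = 2 then extend (-1) (-2 * 0) (G j) else extend 1 0 (G j)) ≤
      2 * nrm hsVol (G j) := by
    intro j
    split_ifs
    · refine (nrm_extend_le (h.gmem j) _ _).trans (le_of_eq ?_); norm_num
    · refine (nrm_extend_le (h.gmem j) _ _).trans (le_of_eq ?_); norm_num
  calc _ ≤ 2 * ∑ j, 2 * nrm hsVol (G j) := by
        gcongr with j _
        exact this j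
    _ = _ := by rw [← Finset.mul_sum]; ring

/-! ### The elastic energy -/

/-- Lipschitz coefficients with `|c| ≤ B` and `|∇c| ≤ B/ϱ`. -/
structure Coef (c : E3 → ℝ) (B : ℝ) : Prop where
  lip : IsLip c
  bdd : ∀ x ∈ halfSpace, |c x| ≤ B
  grad : ∀ᵐ x ∂hsVol, ‖fderiv ℝ c x‖ ≤ B / rho x

theorem Coef.continuousOn {c : E3 → ℝ} {B : ℝ} (h : Coef c B) : ContinuousOn c halfSpace := by
  obtain ⟨L, hL⟩ := h.lip
  exact hL.continuousOn

theorem Coef.aestronglyMeasurable {c : E3 → ℝ} {B : ℝ} (h : Coef c B) :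
    AEStronglyMeasurable c hsVol := h.continuousOn.aestronglyMeasurable measurableSet_halfSpace

theorem Coef.ae_bdd {c : E3 → ℝ} {B : ℝ} (h : Coef c B) : ∀ᵐ x ∂hsVol, |c x| ≤ B := by
  filter_upwards [ae_restrict_mem measurableSet_halfSpace] with x hx using h.bdd x hx

/-- Admissible Lamé coefficients. -/
structure Lame (lam mu : E3 → ℝ) (B α₀ β₀ : ℝ) : Prop where
  lamCoef : Coef lam B
  muCoef : Coef mu B
  posα : 0 < α₀
  posβ : 0 < β₀
  posB : 0 < B
  lower : ∀ x ∈ halfSpace, α₀ ≤ mu x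
  lower' : ∀ x ∈ halfSpace, β₀ ≤ 3 * lam x + 2 * mu x

/-- The pointwise energy density. -/
def density (l m : ℝ) (e s : Fin 3 → Fin 3 → ℝ) : ℝ :=
  l * (∑ k, e k k) * (∑ k, s k k) + 2 * m * ∑ i, ∑ j, e i j * s i j

/-- On symmetric matrices the elasticity tensor has eigenvalue `2m` on trace-free ones and `3l + 2m`
on multiples of the identity. The hints are the squares of these parts: differences of diagonal
entries and off-diagonal entries with `2m - c`, the trace with `3l + 2m - c`. -/
theorem density_lower {l m a b : ℝ} (ha : a ≤ m) (hb : b ≤ 3 * l + 2 * m)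
    (e : Fin 3 → Fin 3 → ℝ) :
    min (2 * a) b * ∑ i, ∑ j, e i j ^ 2 ≤ density l m e e := by
  unfold density
  have h1 := min_le_left (2 * a) b
  have h2 := min_le_right (2 * a) b
  generalize min (2 * a) b = c at *
  simp only [Fin.sum_univ_three]
  nlinarith [mul_nonneg (by linarith : 0 ≤ 2 * m - c) (sq_nonneg (e 0 0 - e 1 1)),
    mul_nonneg (by linarith : 0 ≤ 2 * m - c) (sq_nonneg (e 0 0 - e 2 2)),
    mul_nonneg (by linarith : 0 ≤ 2 * m - c) (sq_nonneg (e 1 1 - e 2 2)),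
    mul_nonneg (by linarith : 0 ≤ 3 * l + 2 * m - c) (sq_nonneg (e 0 0 + e 1 1 + e 2 2)),
    mul_nonneg (by linarith : 0 ≤ 2 * m - c) (sq_nonneg (e 0 1)),
    mul_nonneg (by linarith : 0 ≤ 2 * m - c) (sq_nonneg (e 0 2)),
    mul_nonneg (by linarith : 0 ≤ 2 * m - c) (sq_nonneg (e 1 0)),
    mul_nonneg (by linarith : 0 ≤ 2 * m - c) (sq_nonneg (e 1 2)),
    mul_nonneg (by linarith : 0 ≤ 2 * m - c) (sq_nonneg (e 2 0)),
    mul_nonneg (by linarith : 0 ≤ 2 * m - c) (sq_nonneg (e 2 1))]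

/-- The elastic energy form. -/
def energy (lam mu : E3 → ℝ) (e s : Fin 3 → Fin 3 → E3 → ℝ) : ℝ :=
  ∫ x in halfSpace, density (lam x) (mu x) (fun i j => e i j x) (fun i j => s i j x)

theorem integrable_coef_mul {c f g : E3 → ℝ} {B : ℝ} (hm : AEStronglyMeasurable c hsVol)
    (hB : ∀ᵐ x ∂hsVol, |c x| ≤ B) (hf : MemLp f 2 hsVol) (hg : MemLp g 2 hsVol) :
    Integrable (fun x => c x * f x * g x) hsVol := by
  refine integrable_mul (memLp_of_le hf (hm.mul hf.1) (c := B) ?_) hg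
  filter_upwards [hB] with x hx
  rw [abs_mul]
  exact mul_le_mul_of_nonneg_right hx (abs_nonneg _)

theorem abs_integral_coef_mul_le {c f g : E3 → ℝ} {B : ℝ} (h0 : 0 ≤ B)
    (hm : AEStronglyMeasurable c hsVol)
    (hB : ∀ᵐ x ∂hsVol, |c x| ≤ B) (hf : MemLp f 2 hsVol) (hg : MemLp g 2 hsVol) :
    |∫ x in halfSpace, c x * f x * g x| ≤ B * nrm hsVol f * nrm hsVol g := by
  have hle : ∀ᵐ x ∂hsVol, |c x * f x| ≤ B * |f x| := by
    filter_upwards [hB] with x hx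
    rw [abs_mul]
    exact mul_le_mul_of_nonneg_right hx (abs_nonneg _)
  have hcf : MemLp (fun x => c x * f x) 2 hsVol := memLp_of_le hf (hm.mul hf.1) hle
  refine (abs_integral_mul_le hcf hg).trans ?_
  exact mul_le_mul_of_nonneg_right (nrm_le_const_mul h0 hf hle) (nrm_nonneg _ _)

section Energy
variable {lam mu : E3 → ℝ} {B α₀ β₀ : ℝ} {e s : Fin 3 → Fin 3 → E3 → ℝ}

theorem integrable_density (hl : Coef lam B) (hm : Coef mu B)
    (he : ∀ i j, MemLp (e i j) 2 hsVol) (hs : ∀ i j, MemLp (s i j) 2 hsVol) :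
    Integrable (fun x => density (lam x) (mu x) (fun i j => e i j x) (fun i j => s i j x))
      hsVol := by
  unfold density
  refine Integrable.add ?_ ?_
  · exact integrable_coef_mul hl.aestronglyMeasurable hl.ae_bdd
      (memLp_sum _ fun k _ => he k k) (memLp_sum _ fun k _ => hs k k)
  · have : ∀ x, 2 * mu x * ∑ i, ∑ j, e i j x * s i j x =
        ∑ i, ∑ j, 2 * (mu x * e i j x * s i j x) := fun x => by
      simp only [Finset.mul_sum]
      exact Finset.sum_congr rfl fun i _ => Finset.sum_congr rfl fun j _ => by ring
    simp only [this]
    exact integrable_finsetSum _ fun i _ => integrable_finsetSum _ fun j _ =>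
      (integrable_coef_mul hm.aestronglyMeasurable hm.ae_bdd (he i j) (hs i j)).const_mul 2

theorem energy_lower (h : Lame lam mu B α₀ β₀) (he : ∀ i j, MemLp (e i j) 2 hsVol) :
    min (2 * α₀) β₀ * ∑ i, ∑ j, nrm hsVol (e i j) ^ 2 ≤ energy lam mu e e := by
  have hi : ∀ i j, Integrable (fun x => e i j x ^ 2) hsVol := fun i j => integrable_sq (he i j)
  have : ∑ i, ∑ j, nrm hsVol (e i j) ^ 2 = ∫ x in halfSpace, ∑ i, ∑ j, e i j x ^ 2 := by
    rw [integral_finsetSum _ fun i _ => integrable_finsetSum _ fun j _ => hi i j]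
    refine Finset.sum_congr rfl fun i _ => ?_
    rw [integral_finsetSum _ fun j _ => hi i j]
    exact Finset.sum_congr rfl fun j _ => nrm_sq (he i j)
  rw [this, ← integral_const_mul]
  refine integral_mono_ae ?_ (integrable_density h.lamCoef h.muCoef he he) ?_
  · exact (integrable_finsetSum _ fun i _ => integrable_finsetSum _ fun j _ => hi i j).const_mul _
  · filter_upwards [ae_restrict_mem measurableSet_halfSpace] with x hx
    exact density_lower (h.lower x hx) (h.lower' x hx) _

/-- `u` is a weak solution with weak gradient `G`. -/
structure WeakSol (lam mu : E3 → ℝ) (f u : Fin 3 → E3 → ℝ) (G : Fin 3 → Fin 3 → E3 → ℝ) :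
    Prop where
  mem : ∀ i, H1 halfSpace (u i) (G i)
  eq : ∀ (v : Fin 3 → E3 → ℝ) (F : Fin 3 → Fin 3 → E3 → ℝ), (∀ i, H1 halfSpace (v i) (F i)) →
    energy lam mu (symPart G) (symPart F) = - ∑ i, ∫ x in halfSpace, f i x * v i x

end Energy

/-! ### Existence of weak solutions -/

section Hilbert

/-- The space `L²` of the half space. -/
abbrev L2 : Type := Lp ℝ 2 hsVol

/-- Tuples of square integrable functions, representing `u/ϱ` and `∇u`. -/
abbrev Tuple : Type := PiLp 2 (fun _ : Fin 3 × Option (Fin 3) => L2)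

theorem coeFn_add' (f g : L2) : (f + g : L2) =ᵐ[hsVol] fun x => f x + g x := Lp.coeFn_add f g

theorem coeFn_smul' (c : ℝ) (f : L2) : (c • f : L2) =ᵐ[hsVol] fun x => c * f x :=
  Lp.coeFn_smul c f

theorem memLp_rho_mul_pderiv {φ : E3 → ℝ} (h : IsTest halfSpace φ) (j : Fin 3) :
    MemLp (fun x => rho x * pderiv j φ x) 2 hsVol :=
  (continuous_rho.mul (contDiff_pderiv h.1 j).continuous).memLp_of_hasCompactSupport
    (hasCompactSupport_pderiv h.2.1 j).mul_left

theorem memLp_test {φ : E3 → ℝ} (h : IsTest halfSpace φ) : MemLp φ 2 hsVol :=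
  h.1.continuous.memLp_of_hasCompactSupport h.2.1

/-- The weak derivative relation becomes a family of continuous linear equations in `L²`, the weight
being moved onto the test function. Hence the energy space is closed, thus complete. -/
theorem h1_tuple_iff (F : Tuple) (i : Fin 3) :
    H1 halfSpace (fun x => rho x * F (i, none) x) (fun j x => F (i, some j) x) ↔
      ∀ j φ (hφ : IsTest halfSpace φ), inner ℝ (F (i, none)) ((memLp_rho_mul_pderiv hφ j).toLp _) +
        inner ℝ (F (i, some j)) ((memLp_test hφ).toLp _) = 0 := by
  have hm : ∀ k, MemLp (fun x => F k x) 2 hsVol := fun k => Lp.memLp (F k)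
  have hl0 : LocallyIntegrableOn (fun x => rho x * F (i, none) x) halfSpace :=
    (hm _).locInt.mul_cont isOpen_halfSpace continuous_rho.continuousOn
  have hin : ∀ j φ (hφ : IsTest halfSpace φ),
      inner ℝ (F (i, none)) ((memLp_rho_mul_pderiv hφ j).toLp _) +
        inner ℝ (F (i, some j)) ((memLp_test hφ).toLp _) =
      (∫ x in halfSpace, rho x * F (i, none) x * pderiv j φ x) +
        ∫ x in halfSpace, F (i, some j) x * φ x := by
    intro j φ hφ
    have e1 := integral_mul_eq_inner (hm (i, none)) (memLp_rho_mul_pderiv hφ j)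
    have e2 := integral_mul_eq_inner (hm (i, some j)) (memLp_test hφ)
    rw [Lp.toLp_coeFn] at e1 e2
    rw [← e1, ← e2]
    congr 2; ext x; ring
  constructor
  · intro h j φ hφ
    rw [hin j φ hφ, (isWeakDeriv_idx.1 (h.deriv j)).2.2 φ hφ]; simp
  · intro h
    refine ⟨fun j => isWeakDeriv_idx.2 ⟨hl0, (hm _).locInt, fun φ hφ => ?_⟩, ?_, fun j => hm _⟩
    · have := h j φ hφ
      rw [hin j φ hφ] at this
      linarith
    · refine (hm (i, none)).ae_eq (Eventually.of_forall fun x => ?_)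
      simp only
      rw [← mul_assoc, inv_mul_cancel₀ (rho_pos x).ne', one_mul]

/-- The Hilbert space `H^1_0` of vector fields on the half space. -/
def energySpace : Submodule ℝ Tuple where
  carrier := {F | ∀ i, H1 halfSpace (fun x => rho x * F (i, none) x) (fun j x => F (i, some j) x)}
  add_mem' {F H} hF hH i := by
    refine ((hF i).add (hH i)).congr ?_ fun j => ?_
    · filter_upwards [coeFn_add' (F (i, none)) (H (i, none))] with x hx
      rw [PiLp.add_apply, hx]; ring
    · filter_upwards [coeFn_add' (F (i, some j)) (H (i, some j))] with x hx
      rw [PiLp.add_apply, hx]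
  zero_mem' i := by
    rw [h1_tuple_iff]; simp
  smul_mem' c F hF i := by
    refine ((hF i).const_mul c).congr ?_ fun j => ?_
    · filter_upwards [coeFn_smul' c (F (i, none))] with x hx
      rw [PiLp.smul_apply, hx]; ring
    · filter_upwards [coeFn_smul' c (F (i, some j))] with x hx
      rw [PiLp.smul_apply, hx]

theorem isClosed_energySpace : IsClosed (energySpace : Set Tuple) := by
  have : (energySpace : Set Tuple) = ⋂ i, ⋂ j, ⋂ φ, ⋂ hφ : IsTest halfSpace φ,
      {F : Tuple | inner ℝ (F (i, none)) ((memLp_rho_mul_pderiv hφ j).toLp _) +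
        inner ℝ (F (i, some j)) ((memLp_test hφ).toLp _) = 0} := by
    ext F
    simp only [mem_iInter]
    exact forall_congr' fun i => h1_tuple_iff F i
  rw [this]
  refine isClosed_iInter fun i => isClosed_iInter fun j => isClosed_iInter fun φ =>
    isClosed_iInter fun hφ => isClosed_eq ?_ continuous_const
  fun_prop

instance : CompleteSpace energySpace := isClosed_energySpace.completeSpace_coe

/-- Bilinear forms `∫ c f g` with bounded coefficients. -/
theorem exists_coef_form {c : E3 → ℝ} {B : ℝ} (h : Coef c B) (h0 : 0 ≤ B) :
    ∃ T : L2 →L[ℝ] L2 →L[ℝ] ℝ, ∀ f g : L2, T f g = ∫ x in halfSpace, c x * f x * g x := by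
  have hint := fun f g : L2 =>
    integrable_coef_mul h.aestronglyMeasurable h.ae_bdd (Lp.memLp f) (Lp.memLp g)
  refine ⟨LinearMap.mkContinuous₂ (LinearMap.mk₂ ℝ
    (fun f g : L2 => ∫ x in halfSpace, c x * f x * g x) ?_ ?_ ?_ ?_) B ?_, fun f g => rfl⟩
  · intro f f' g
    rw [← integral_add (hint f g) (hint f' g)]
    refine integral_congr_ae ?_
    filter_upwards [coeFn_add' f f'] with x hx
    rw [hx]; ring
  · intro a f g
    rw [smul_eq_mul, ← integral_const_mul]
    refine integral_congr_ae ?_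
    filter_upwards [coeFn_smul' a f] with x hx
    rw [hx]; ring
  · intro f g g'
    rw [← integral_add (hint f g) (hint f g')]
    refine integral_congr_ae ?_
    filter_upwards [coeFn_add' g g'] with x hx
    rw [hx]; ring
  · intro a f g
    rw [smul_eq_mul, ← integral_const_mul]
    refine integral_congr_ae ?_
    filter_upwards [coeFn_smul' a g] with x hx
    rw [hx]; ring
  · intro f g
    have := abs_integral_coef_mul_le h0 h.aestronglyMeasurable h.ae_bdd (Lp.memLp f) (Lp.memLp g)
    rw [Lp.norm_def, Lp.norm_def]
    exact this

/-- The strain entries as continuous linear maps. -/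
def strainMap (i j : Fin 3) : Tuple →L[ℝ] L2 :=
  (2⁻¹ : ℝ) • (PiLp.proj (𝕜 := ℝ) 2 (fun _ : Fin 3 × Option (Fin 3) => L2) (i, some j) +
    PiLp.proj (𝕜 := ℝ) 2 (fun _ : Fin 3 × Option (Fin 3) => L2) (j, some i))

theorem strainMap_ae (i j : Fin 3) (F : Tuple) :
    strainMap i j F =ᵐ[hsVol] symPart (fun i j x => F (i, some j) x) i j := by
  have e : strainMap i j F = (2⁻¹ : ℝ) • (F (i, some j) + F (j, some i)) := rfl
  rw [e]
  filter_upwards [coeFn_smul' 2⁻¹ (F (i, some j) + F (j, some i)),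
    coeFn_add' (F (i, some j)) (F (j, some i))] with x h1 h2
  rw [h1, h2, symPart]; ring

theorem coeFn_sum' {ι : Type*} (s : Finset ι) (f : ι → L2) :
    (∑ i ∈ s, f i : L2) =ᵐ[hsVol] fun x => ∑ i ∈ s, f i x := by
  classical
  induction s using Finset.induction_on with
  | empty => simp only [Finset.sum_empty]; exact Lp.coeFn_zero ..
  | insert a s ha ih =>
    simp only [Finset.sum_insert ha]
    filter_upwards [coeFn_add' (f a) (∑ i ∈ s, f i), ih] with x h1 h2
    rw [h1, h2]

theorem exists_energy_form {lam mu : E3 → ℝ} {B : ℝ} (hl : Coef lam B) (hm : Coef mu B)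
    (h0 : 0 ≤ B) : ∃ T : Tuple →L[ℝ] Tuple →L[ℝ] ℝ, ∀ F H : Tuple, T F H =
      energy lam mu (symPart fun i j x => F (i, some j) x) (symPart fun i j x => H (i, some j) x) := by
  obtain ⟨T1, h1⟩ := exists_coef_form hl h0
  obtain ⟨T2, h2⟩ := exists_coef_form hm h0
  let tr : Tuple →L[ℝ] L2 := ∑ k, strainMap k k
  refine ⟨T1.bilinearComp tr tr +
    (2:ℝ) • ∑ i, ∑ j, T2.bilinearComp (strainMap i j) (strainMap i j), fun F H => ?_⟩
  have hms : ∀ (F : Tuple) i j, MemLp (symPart (fun i j x => F (i, some j) x) i j) 2 hsVol :=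
    fun F => memLp_symPart fun i j => Lp.memLp _
  have htr : ∀ F : Tuple, tr F =ᵐ[hsVol]
      fun x => ∑ k, symPart (fun i j x => F (i, some j) x) k k x := fun F => by
    have : tr F = ∑ k, strainMap k k F := by simp [tr, sum_apply]
    rw [this]
    filter_upwards [coeFn_sum' Finset.univ fun k => strainMap k k F,
      ae_all_iff.2 fun k => strainMap_ae k k F] with x hx hk
    rw [hx]
    exact Finset.sum_congr rfl fun k _ => hk k
  have e1 : T1 (tr F) (tr H) = ∫ x in halfSpace,
      lam x * (∑ k, symPart (fun i j x => F (i, some j) x) k k x) *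
        (∑ k, symPart (fun i j x => H (i, some j) x) k k x) := by
    rw [h1]
    refine integral_congr_ae ?_
    filter_upwards [htr F, htr H] with x hF hH
    rw [hF, hH]
  have e2 : ∀ i j, T2 (strainMap i j F) (strainMap i j H) = ∫ x in halfSpace,
      mu x * symPart (fun i j x => F (i, some j) x) i j x *
        symPart (fun i j x => H (i, some j) x) i j x := fun i j => by
    rw [h2]
    refine integral_congr_ae ?_
    filter_upwards [strainMap_ae i j F, strainMap_ae i j H] with x hF hH
    rw [hF, hH]
  have i2 := fun i j => integrable_coef_mul hm.aestronglyMeasurable hm.ae_bdd (hms F i j) (hms H i j)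
  have hsum : (T1.bilinearComp tr tr +
    (2:ℝ) • ∑ i, ∑ j, T2.bilinearComp (strainMap i j) (strainMap i j)) F H =
    T1 (tr F) (tr H) + 2 * ∑ i, ∑ j, T2 (strainMap i j F) (strainMap i j H) := by
    simp [sum_apply]
  rw [hsum, e1]
  simp only [e2]
  have e3 : ∑ i, ∑ j, ∫ x in halfSpace, mu x * symPart (fun i j x => F (i, some j) x) i j x *
        symPart (fun i j x => H (i, some j) x) i j x =
      ∫ x in halfSpace, ∑ i, ∑ j, mu x * symPart (fun i j x => F (i, some j) x) i j x *
        symPart (fun i j x => H (i, some j) x) i j x := by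
    rw [integral_finsetSum _ fun i _ => integrable_finsetSum _ fun j _ => i2 i j]
    exact Finset.sum_congr rfl fun i _ => (integral_finsetSum _ fun j _ => i2 i j).symm
  rw [e3, ← integral_const_mul, ← integral_add]
  · unfold energy density
    congr 1; ext x
    simp only [mul_assoc, Finset.mul_sum]
  · exact integrable_coef_mul hl.aestronglyMeasurable hl.ae_bdd
      (memLp_sum _ fun k _ => hms F k k) (memLp_sum _ fun k _ => hms H k k)
  · exact (integrable_finsetSum _ fun i _ => integrable_finsetSum _ fun j _ => i2 i j).const_mul 2

/-- The norm of `H^1_0` is controlled by the strain. -/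
theorem norm_sq_tuple_le {F : Tuple} (hF : F ∈ energySpace) :
    ‖F‖ ^ 2 ≤ 15000 * ∑ i, ∑ j, nrm hsVol (symPart (fun i j x => F (i, some j) x) i j) ^ 2 := by
  have hk := korn hF
  have hh : ∀ i, nrm hsVol (fun x => F (i, none) x) ≤ 4 * ∑ j, nrm hsVol (fun x => F (i, some j) x) := by
    intro i
    refine (le_of_eq (nrm_congr (Eventually.of_forall fun x => ?_))).trans (hardy (hF i))
    simp only
    rw [← mul_assoc, inv_mul_cancel₀ (rho_pos x).ne', one_mul]
  rw [PiLp.norm_sq_eq_of_L2, Fintype.sum_prod_type]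
  have hn : ∀ k, ‖F k‖ = nrm hsVol (fun x => F k x) := fun k => by rw [Lp.norm_def]; rfl
  -- `49 = 1 + 3 · 4²`, from Hardy's constant 4 and Cauchy–Schwarz for three terms; then `49 · 288 ≤
  -- 15000`.
  have h2 : ∀ i, ∑ o : Option (Fin 3), ‖F (i, o)‖ ^ 2 ≤
      49 * ∑ j, nrm hsVol (fun x => F (i, some j) x) ^ 2 := by
    intro i
    rw [Fintype.sum_option]
    simp only [hn]
    have h3 := hh i
    have h4 : nrm hsVol (fun x => F (i, none) x) ^ 2 ≤
        (4 * ∑ j, nrm hsVol (fun x => F (i, some j) x)) ^ 2 := by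
      gcongr; exact nrm_nonneg _ _
    have h5 : (∑ j, nrm hsVol (fun x => F (i, some j) x)) ^ 2 ≤
        3 * ∑ j, nrm hsVol (fun x => F (i, some j) x) ^ 2 := by
      have := sq_sum_le_card_mul_sum_sq (s := Finset.univ)
        (f := fun j => nrm hsVol (fun x => F (i, some j) x))
      simpa using this
    linarith
  calc ∑ i, ∑ o : Option (Fin 3), ‖F (i, o)‖ ^ 2
      ≤ ∑ i, 49 * ∑ j, nrm hsVol (fun x => F (i, some j) x) ^ 2 := Finset.sum_le_sum fun i _ => h2 i
    _ = 49 * ∑ i, ∑ j, nrm hsVol (fun x => F (i, some j) x) ^ 2 := by rw [Finset.mul_sum]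
    _ ≤ 49 * (288 * ∑ i, ∑ j, nrm hsVol (symPart (fun i j x => F (i, some j) x) i j) ^ 2) := by
        gcongr
    _ ≤ _ := by
        rw [← mul_assoc]
        refine mul_le_mul_of_nonneg_right (by norm_num) ?_
        exact Finset.sum_nonneg fun i _ => Finset.sum_nonneg fun j _ => sq_nonneg _

/-- Existence of weak solutions, by the Lax–Milgram theorem. -/
theorem exists_weakSol {lam mu : E3 → ℝ} {B α₀ β₀ : ℝ} (h : Lame lam mu B α₀ β₀)
    {f : Fin 3 → E3 → ℝ} (hf : ∀ i, MemLp (fun x => rho x * f i x) 2 hsVol) :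
    ∃ u G, WeakSol lam mu f u G := by
  obtain ⟨T, hT⟩ := exists_energy_form h.lamCoef h.muCoef h.posB.le
  let S : energySpace →L[ℝ] energySpace →L[ℝ] ℝ :=
    T.bilinearComp energySpace.subtypeL energySpace.subtypeL
  have hS : ∀ F H : energySpace, S F H = T F H := fun F H => rfl
  have hcoer : IsCoercive S := by
    have hc : 0 < min (2 * α₀) β₀ := lt_min (by linarith [h.posα]) h.posβ
    refine ⟨min (2 * α₀) β₀ / 15000, by positivity, fun F => ?_⟩
    rw [hS, hT]
    have h1 := norm_sq_tuple_le F.2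
    have h2 := energy_lower h (memLp_symPart fun i j => Lp.memLp ((F : Tuple) (i, some j)))
    have h3 : ‖F‖ * ‖F‖ = ‖(F : Tuple)‖ ^ 2 := by rw [sq]; rfl
    rw [mul_assoc, h3]
    refine le_trans ?_ h2
    rw [div_mul_eq_mul_div, div_le_iff₀ (by norm_num)]
    refine (mul_le_mul_of_nonneg_left h1 hc.le).trans (le_of_eq ?_)
    ring
  -- The load is written `f·v = (ϱ f)·(v/ϱ)`; the second factor is the `none` slot of a tuple, so
  -- continuity is immediate.
  let ℓ : energySpace →L[ℝ] ℝ := -(∑ i, (innerSL ℝ ((hf i).toLp _)).comp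
    ((PiLp.proj (𝕜 := ℝ) 2 (fun _ : Fin 3 × Option (Fin 3) => L2) (i, none)).comp energySpace.subtypeL))
  let w := (InnerProductSpace.toDual ℝ energySpace).symm ℓ
  let z := hcoer.continuousLinearEquivOfBilin.symm w
  have hz : ∀ H : energySpace, S z H = ℓ H := by
    intro H
    rw [← hcoer.continuousLinearEquivOfBilin_apply]
    simp [z, w]
  refine ⟨fun i x => rho x * (z : Tuple) (i, none) x, fun i j x => (z : Tuple) (i, some j) x, z.2,
    fun v F hv => ?_⟩
  let H : Tuple := WithLp.toLp 2 fun k => match k with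
    | (i, none) => (hv i).mem.toLp _
    | (i, some j) => ((hv i).gmem j).toLp _
  have hH0 : ∀ i, H (i, none) =ᵐ[hsVol] fun x => (rho x)⁻¹ * v i x := fun i =>
    (hv i).mem.coeFn_toLp
  have hH1 : ∀ i j, H (i, some j) =ᵐ[hsVol] F i j := fun i j => ((hv i).gmem j).coeFn_toLp
  have hHmem : H ∈ energySpace := fun i => by
    refine (hv i).congr ?_ fun j => (hH1 i j).symm
    filter_upwards [hH0 i] with x hx
    rw [hx, ← mul_assoc, mul_inv_cancel₀ (rho_pos x).ne', one_mul]
  have key := hz ⟨H, hHmem⟩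
  rw [hS, hT] at key
  have e1 : energy lam mu (symPart fun i j x => (z : Tuple) (i, some j) x)
      (symPart fun i j x => H (i, some j) x) =
      energy lam mu (symPart fun i j x => (z : Tuple) (i, some j) x) (symPart F) := by
    refine integral_congr_ae ?_
    filter_upwards [ae_all_iff.2 fun i => ae_all_iff.2 fun j => hH1 i j] with x hx
    simp only [symPart, hx]
  rw [← e1, key]
  have e2 : ℓ ⟨H, hHmem⟩ = - ∑ i, inner ℝ ((hf i).toLp _) (H (i, none)) := by
    simp [ℓ, sum_apply]
  rw [e2]
  congr 1
  refine Finset.sum_congr rfl fun i _ => ?_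
  have e3 := integral_mul_eq_inner (hf i) (hv i).mem
  change _ = inner ℝ ((hf i).toLp _) (H (i, none)) at e3
  rw [← e3]
  congr 1; ext x
  have := (rho_pos x).ne'
  field_simp

end Hilbert

/-! ### Lipschitz coefficients -/

section Coef
variable {c : E3 → ℝ} {B : ℝ}

/-- A Lipschitz extension to the whole space gives access to Rademacher's theorem. Agreement of
germs in the open half space keeps the derivative the same there. -/
theorem IsLip.exists_global (h : IsLip c) :
    ∃ g L, LipschitzWith L g ∧ ∀ x ∈ halfSpace, c x = g x ∧ c =ᶠ[𝓝 x] g := by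
  obtain ⟨L, hL⟩ := h
  obtain ⟨g, hg, he⟩ := hL.extend_real
  exact ⟨g, L, hg, fun x hx => ⟨he hx, he.eventuallyEq_of_mem (isOpen_halfSpace.mem_nhds hx)⟩⟩

theorem IsLip.ae_differentiableAt (h : IsLip c) : ∀ᵐ x ∂hsVol, DifferentiableAt ℝ c x := by
  obtain ⟨g, L, hg, he⟩ := h.exists_global
  filter_upwards [ae_restrict_mem measurableSet_halfSpace,
    ae_restrict_of_ae (hg.ae_differentiableAt (μ := volume))] with x hx hd
  exact hd.congr_of_eventuallyEq (he x hx).2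

theorem Coef.mono {B' : ℝ} (h : Coef c B) (hB : B ≤ B') : Coef c B' :=
  ⟨h.lip, fun x hx => (h.bdd x hx).trans hB, h.grad.mono fun x hx => hx.trans (by
    have := rho_pos x; gcongr)⟩

theorem Coef.const_mul (h : Coef c B) (a : ℝ) : Coef (fun x => a * c x) (|a| * B) := by
  refine ⟨?_, fun x hx => ?_, ?_⟩
  · obtain ⟨L, hL⟩ := h.lip
    exact ⟨‖a‖₊ * L, (lipschitzWith_smul a).comp_lipschitzOnWith hL⟩
  · rw [abs_mul]; exact mul_le_mul_of_nonneg_left (h.bdd x hx) (abs_nonneg _)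
  · filter_upwards [h.grad, h.lip.ae_differentiableAt] with x hx hd
    rw [fderiv_const_mul hd, norm_smul, Real.norm_eq_abs, mul_div_assoc]
    exact mul_le_mul_of_nonneg_left hx (abs_nonneg _)

theorem Coef.congr {c' : E3 → ℝ} (h : Coef c B) (he : ∀ x, c x = c' x) : Coef c' B :=
  (funext he : c = c') ▸ h

theorem Coef.add {c' : E3 → ℝ} {B' : ℝ} (h : Coef c B) (h' : Coef c' B') :
    Coef (fun x => c x + c' x) (B + B') := by
  refine ⟨?_, fun x hx => ?_, ?_⟩
  · obtain ⟨L, hL⟩ := h.lip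
    obtain ⟨L', hL'⟩ := h'.lip
    exact ⟨L + L', hL.add hL'⟩
  · exact (abs_add_le _ _).trans (add_le_add (h.bdd x hx) (h'.bdd x hx))
  · filter_upwards [h.grad, h.lip.ae_differentiableAt, h'.grad, h'.lip.ae_differentiableAt]
      with x h1 h2 h3 h4
    rw [fderiv_fun_add h2 h4, add_div]
    exact (norm_add_le _ _).trans (add_le_add h1 h3)

/-- Since `∇(1/c) = -c⁻²∇c`, the decay `1/ϱ` is inherited. The constant adds the supremum bound
`a⁻¹` and the gradient bound `B/a²`. -/
theorem Coef.inv (h : Coef c B) {a : ℝ} (ha : 0 < a) (hc : ∀ x ∈ halfSpace, a ≤ c x) :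
    Coef (fun x => (c x)⁻¹) (a⁻¹ + B / a ^ 2) := by
  have hB : 0 ≤ B := by
    have hx : EuclideanSpace.single (2 : Fin 3) (-1 : ℝ) ∈ halfSpace := by simp [halfSpace]
    exact (abs_nonneg _).trans (h.bdd _ hx)
  refine ⟨?_, fun x hx => ?_, ?_⟩
  · obtain ⟨L, hL⟩ := h.lip
    refine ⟨L * Real.toNNReal (a ^ 2)⁻¹, LipschitzOnWith.of_dist_le_mul fun x hx y hy => ?_⟩
    have h1 := hc x hx
    have h2 := hc y hy
    have h3 := hL.dist_le_mul x hx y hy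
    have hx0 : 0 < c x := ha.trans_le h1
    have hy0 : 0 < c y := ha.trans_le h2
    rw [dist_inv_inv₀ hx0.ne' hy0.ne', Real.norm_eq_abs, Real.norm_eq_abs, abs_of_pos hx0,
      abs_of_pos hy0, NNReal.coe_mul, Real.coe_toNNReal _ (by positivity)]
    rw [div_le_iff₀ (by positivity)]
    calc dist (c x) (c y) ≤ L * dist x y := h3
      _ = (L * (a ^ 2)⁻¹ * dist x y) * (a * a) := by field_simp
      _ ≤ _ := by gcongr
  · have h1 := hc x hx
    have hx0 : 0 < c x := ha.trans_le h1
    rw [abs_inv, abs_of_pos hx0]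
    have : (c x)⁻¹ ≤ a⁻¹ := by gcongr
    have : 0 ≤ B / a ^ 2 := by positivity
    linarith
  · filter_upwards [h.grad, h.lip.ae_differentiableAt, ae_restrict_mem measurableSet_halfSpace]
      with x h1 h2 hx
    have h3 := hc x hx
    have hx0 : 0 < c x := ha.trans_le h3
    have hr := rho_pos x
    have h4 : fderiv ℝ (fun x => (c x)⁻¹) x = (-(c x ^ 2)⁻¹) • fderiv ℝ c x :=
      ((hasDerivAt_inv hx0.ne').comp_hasFDerivAt x h2.hasFDerivAt).fderiv
    rw [h4, norm_smul, norm_neg, norm_inv, norm_pow, Real.norm_eq_abs, abs_of_pos hx0]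
    calc (c x ^ 2)⁻¹ * ‖fderiv ℝ c x‖ ≤ (a ^ 2)⁻¹ * (B / rho x) := by gcongr
      _ = B / a ^ 2 / rho x := by field_simp
      _ ≤ _ := by gcongr; have : 0 < a⁻¹ := by positivity
                  linarith

theorem measurable_pderiv (c : E3 → ℝ) (j : Fin 3) : Measurable (pderiv j c) :=
  measurable_fderiv_apply_const ℝ c _

theorem Coef.abs_pderiv_le (h : Coef c B) (j : Fin 3) :
    ∀ᵐ x ∂hsVol, |pderiv j c x| ≤ B * (rho x)⁻¹ := by
  filter_upwards [h.grad] with x hx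
  refine ((fderiv ℝ c x).le_opNorm _).trans ?_
  simpa [div_eq_mul_inv] using hx

/-- Integration by parts for Lipschitz coefficients. -/
theorem IsLip.integral_mul_pderiv (h : IsLip c) {φ : E3 → ℝ} (hφ : IsTest halfSpace φ)
    (j : Fin 3) :
    ∫ x in halfSpace, c x * pderiv j φ x = - ∫ x in halfSpace, pderiv j c x * φ x := by
  obtain ⟨g, L, hg, he⟩ := h.exists_global
  obtain ⟨D, hD⟩ := hφ.1.lipschitzWith_of_hasCompactSupport hφ.2.1 (by simp)
  have key := hg.integral_lineDeriv_mul_eq (μ := volume) hD hφ.2.1 (EuclideanSpace.single j 1)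
  have h0 : ∀ x, x ∉ halfSpace → φ x = 0 := fun x hx =>
    image_eq_zero_of_notMem_tsupport fun hx' => hx (hφ.2.2 hx')
  have h1 : ∀ x, x ∉ halfSpace → pderiv j φ x = 0 := fun x hx =>
    image_eq_zero_of_notMem_tsupport fun hx' => hx ((hφ.pderiv j).2.2 hx')
  have e1 : ∫ x in halfSpace, c x * pderiv j φ x = ∫ x, g x * pderiv j φ x := by
    rw [← setIntegral_eq_integral_of_forall_compl_eq_zero (s := halfSpace)
      (f := fun x => g x * pderiv j φ x) fun x hx => by rw [h1 x hx, mul_zero]]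
    exact setIntegral_congr_fun measurableSet_halfSpace fun x hx => by
      simp only [(he x hx).1]
  have e2 : ∫ x in halfSpace, pderiv j c x * φ x =
      ∫ x, lineDeriv ℝ g x (EuclideanSpace.single j 1) * φ x := by
    rw [← setIntegral_eq_integral_of_forall_compl_eq_zero (s := halfSpace)
      (f := fun x => lineDeriv ℝ g x (EuclideanSpace.single j 1) * φ x)
      fun x hx => by rw [h0 x hx, mul_zero]]
    refine setIntegral_congr_ae measurableSet_halfSpace ?_
    filter_upwards [hg.ae_differentiableAt (μ := volume)] with x hd hx
    rw [hd.lineDeriv_eq_fderiv, pderiv, (he x hx).2.fderiv_eq]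
  rw [e1, e2, key, ← integral_neg]
  refine integral_congr_ae (Eventually.of_forall fun x => ?_)
  simp only
  rw [((hφ.1.differentiable (by simp)) x).lineDeriv_eq_fderiv, map_neg, pderiv]
  ring

/-- The fundamental theorem of calculus on the segment from `x` to `x + a`, which stays in the half
space and along which `ϱ` varies by at most a factor two. -/
theorem Coef.abs_sub_le (h : Coef c B) (hB : 0 ≤ B) {a : E3} (ha : a 2 = 0) (ha1 : ‖a‖ ≤ 1) :
    ∀ᵐ x ∂hsVol, |c (x + a) - c x| ≤ 2 * B * ‖a‖ * (rho x)⁻¹ := by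
  obtain ⟨g, L, hg, he⟩ := h.lip.exists_global
  have hP : ∀ᵐ x : E3, x ∈ halfSpace → DifferentiableAt ℝ g x ∧ ‖fderiv ℝ g x‖ ≤ B / rho x := by
    filter_upwards [hg.ae_differentiableAt (μ := volume),
      (ae_restrict_iff' measurableSet_halfSpace).1 h.grad] with x h1 h2 hx
    exact ⟨h1, by rw [← (he x hx).2.fderiv_eq]; exact h2 hx⟩
  obtain ⟨N, hN, hNm, hN0⟩ := exists_measurable_superset_of_null hP
  -- The gradient bound holds only almost everywhere, and a single segment is a null set. By Fubini,
  -- almost every segment meets the bad set in a null set of parameters.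
  have hall : ∀ᵐ x : E3, ∀ᵐ t : ℝ, x + t • a ∉ N := by
    rw [Measure.ae_ae_comm]
    · refine Eventually.of_forall fun t => ?_
      have := (measurePreserving_add_right (volume : Measure E3) (t • a)).quasiMeasurePreserving
      exact this.ae (p := fun y => y ∉ N) (measure_eq_zero_iff_ae_notMem.1 hN0)
    · have : Measurable fun p : E3 × ℝ => p.1 + p.2 • a := by fun_prop
      exact (this hNm).compl
  have hin : ∀ x ∈ halfSpace, ∀ t : ℝ, x + t • a ∈ halfSpace := fun x hx t => by
    have : x 2 < 0 := hx
    simpa [halfSpace, ha] using this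
  filter_upwards [ae_restrict_mem measurableSet_halfSpace, ae_restrict_of_ae hall] with x hx ht
  have hxa : x + a ∈ halfSpace := by simpa using hin x hx 1
  rw [(he _ hxa).1, (he x hx).1]
  have hL : LipschitzWith (L * ‖a‖₊) fun t : ℝ => g (x + t • a) := by
    refine hg.comp (LipschitzWith.of_dist_le_mul fun s t => ?_)
    rw [dist_add_left, dist_eq_norm, ← sub_smul, norm_smul, mul_comm]; rfl
  have hint := (hL.lipschitzOnWith (s := uIcc 0 1)).absolutelyContinuousOnInterval.integral_deriv_eq_sub
  simp only [one_smul, zero_smul, add_zero] at hint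
  rw [← hint]
  have hb : ∀ᵐ t : ℝ, t ∈ uIoc (0:ℝ) 1 → ‖deriv (fun t : ℝ => g (x + t • a)) t‖ ≤
      2 * B * ‖a‖ * (rho x)⁻¹ := by
    filter_upwards [ht] with t ht h01
    rw [uIoc_of_le zero_le_one] at h01
    have hmem : x + t • a ∈ {x | x ∈ halfSpace →
        DifferentiableAt ℝ g x ∧ ‖fderiv ℝ g x‖ ≤ B / rho x} := by
      by_contra hcon
      exact ht (hN hcon)
    obtain ⟨hd, hn⟩ := hmem (hin x hx t)
    have h1 : HasDerivAt (fun t : ℝ => x + t • a) a t := by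
      simpa using ((hasDerivAt_id t).smul_const a).const_add x
    have h2 := hd.hasFDerivAt.comp_hasDerivAt t h1
    change ‖deriv (g ∘ fun t : ℝ => x + t • a) t‖ ≤ _
    rw [h2.deriv]
    refine ((fderiv ℝ g (x + t • a)).le_opNorm a).trans ?_
    have hr : rho x ≤ 2 * rho (x + t • a) := by
      apply rho_le_two_mul
      rw [sub_add_cancel_left, norm_neg, norm_smul, Real.norm_eq_abs, abs_of_pos h01.1]
      nlinarith [norm_nonneg a, h01.2]
    have hr0 := rho_pos x
    have hr1 := rho_pos (x + t • a)
    have h3 : B / rho (x + t • a) ≤ 2 * B * (rho x)⁻¹ := by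
      rw [div_le_iff₀ hr1, mul_assoc, mul_comm 2 B, mul_assoc]
      refine le_mul_of_one_le_right hB ?_
      rw [← mul_assoc, mul_right_comm, ← div_eq_mul_inv, one_le_div hr0]
      exact hr
    calc _ ≤ (2 * B * (rho x)⁻¹) * ‖a‖ := by gcongr; exact hn.trans h3
      _ = _ := by ring
  have := intervalIntegral.norm_integral_le_of_norm_le_const_ae hb
  simpa using this

/-- Multiplication by Lipschitz coefficients in `H^1_0`. -/
theorem H1.coef_mul {u : E3 → ℝ} {G : Fin 3 → E3 → ℝ} (h : H1 halfSpace u G) (hc : Coef c B) :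
    H1 halfSpace (fun x => c x * u x) (smulGrad c u G) := by
  have hm1 : MemLp (fun x => (rho x)⁻¹ * (c x * u x)) 2 hsVol := by
    have e : (fun x => (rho x)⁻¹ * (c x * u x)) = fun x => c x * ((rho x)⁻¹ * u x) := by
      ext x; ring
    rw [e]
    refine memLp_of_le h.mem (hc.aestronglyMeasurable.mul h.mem.1) (c := B) ?_
    filter_upwards [hc.ae_bdd] with x hx
    rw [abs_mul]; gcongr
  have hm2 : ∀ j, MemLp (fun x => c x * G j x) 2 hsVol := fun j => by
    refine memLp_of_le (h.gmem j) (hc.aestronglyMeasurable.mul (h.gmem j).1) (c := B) ?_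
    filter_upwards [hc.ae_bdd] with x hx
    rw [abs_mul]; gcongr
  have hu : AEStronglyMeasurable u hsVol := by
    have := continuous_rho.aestronglyMeasurable.mul h.mem.1
    refine this.congr (Eventually.of_forall fun x => ?_)
    simp only [Pi.mul_apply]
    rw [← mul_assoc, mul_inv_cancel₀ (rho_pos x).ne', one_mul]
  have hm3 : ∀ j, MemLp (fun x => pderiv j c x * u x) 2 hsVol := fun j => by
    refine memLp_of_le h.mem ((measurable_pderiv c j).aestronglyMeasurable.mul hu) (c := B) ?_
    filter_upwards [hc.abs_pderiv_le j] with x hx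
    rw [abs_mul, abs_mul, abs_of_pos (rho_inv_pos x), ← mul_assoc]; gcongr
  refine ⟨fun j => isWeakDeriv_idx.2 ⟨?_, ((hm2 j).add (hm3 j)).locInt, fun φ hφ => ?_⟩, hm1,
    fun j => (hm2 j).add (hm3 j)⟩
  · exact memLp_locallyIntegrableOn isOpen_halfSpace continuous_rho_inv.continuousOn
      (fun x _ => (rho_inv_pos x).ne') hm1
  -- With `u` replaced by a smooth `ψ n`, the product `ψ n · φ` is a test function for the Lipschitz
  -- coefficient itself. Factors `ϱ` and `ϱ⁻¹` are inserted because `ψ n → u` is known only in the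
  -- weighted norm.
  obtain ⟨ψ, hψ⟩ := h.exists_approx
  have hmψ := fun n => memLp_rho_inv_mul (μ := hsVol) (hψ.smooth n) (hψ.compact n)
  have hcomp : ∀ {k : E3 → ℝ}, Continuous k → HasCompactSupport k →
      MemLp (fun x => c x * k x) 2 hsVol := fun hk hkc => by
    have hk2 := hk.memLp_of_hasCompactSupport (μ := hsVol) (p := 2) hkc
    refine memLp_of_le hk2 (hc.aestronglyMeasurable.mul hk2.1) (c := B) ?_
    filter_upwards [hc.ae_bdd] with x hx
    rw [abs_mul]; gcongr
  have hρφ : MemLp (fun x => rho x * φ x) 2 hsVol :=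
    (continuous_rho.mul hφ.1.continuous).memLp_of_hasCompactSupport hφ.2.1.mul_left
  have k1 : MemLp (fun x => c x * (rho x * pderiv j φ x)) 2 hsVol :=
    hcomp (continuous_rho.mul (hφ.pderiv j).1.continuous) (hφ.pderiv j).2.1.mul_left
  have k2 : MemLp (fun x => c x * φ x) 2 hsVol := hcomp hφ.1.continuous hφ.2.1
  have k3 : MemLp (fun x => pderiv j c x * (rho x * φ x)) 2 hsVol := by
    refine memLp_of_le (hφ.1.continuous.memLp_of_hasCompactSupport (μ := hsVol) hφ.2.1)
      ((measurable_pderiv c j).aestronglyMeasurable.mul hρφ.1) (c := B) ?_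
    filter_upwards [hc.abs_pderiv_le j] with x hx
    rw [abs_mul, abs_mul, abs_of_pos (rho_pos x)]
    calc _ ≤ (B * (rho x)⁻¹) * (rho x * |φ x|) := by have := rho_pos x; gcongr
      _ = _ := by have := (rho_pos x).ne'; field_simp
  have hlim : Tendsto (fun n => nrm hsVol (fun x => (rho x)⁻¹ * ψ n x - (rho x)⁻¹ * u x)) atTop
      (𝓝 0) := by simpa only [mul_sub] using hψ.lim
  have t1 := tendsto_integral_mul hmψ h.mem k1 hlim
  have t2 := tendsto_integral_mul (fun n => memLp_pderiv (hψ.smooth n) (hψ.compact n) j)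
    (h.gmem j) k2 (hψ.glim j)
  have t3 := tendsto_integral_mul hmψ h.mem k3 hlim
  have hn : ∀ n, ∫ x in halfSpace, c x * (rho x * pderiv j φ x) * ((rho x)⁻¹ * ψ n x) =
      -(∫ x in halfSpace, c x * φ x * pderiv j (ψ n) x) -
      ∫ x in halfSpace, pderiv j c x * (rho x * φ x) * ((rho x)⁻¹ * ψ n x) := by
    intro n
    have i1 := hc.lip.integral_mul_pderiv (hφ.mul_smooth (hψ.smooth n)) j
    have d1 := (hψ.smooth n).differentiable (by simp)
    have d2 := hφ.1.differentiable (by simp)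
    have i2 : ∫ x in halfSpace, c x * pderiv j (fun y => ψ n y * φ y) x =
        (∫ x in halfSpace, c x * (rho x * pderiv j φ x) * ((rho x)⁻¹ * ψ n x)) +
        ∫ x in halfSpace, c x * φ x * pderiv j (ψ n) x := by
      rw [← integral_add (integrable_mul k1 (hmψ n)) (integrable_mul k2
        (memLp_pderiv (hψ.smooth n) (hψ.compact n) j))]
      refine integral_congr_ae (Eventually.of_forall fun x => ?_)
      have := (rho_pos x).ne'
      simp only
      rw [pderiv_mul (d1 x) (d2 x)]
      field_simp
    have i3 : ∫ x in halfSpace, pderiv j c x * (rho x * φ x) * ((rho x)⁻¹ * ψ n x) =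
        ∫ x in halfSpace, pderiv j c x * (ψ n x * φ x) := by
      congr 1; ext x
      have := (rho_pos x).ne'
      field_simp
    rw [i3]; rw [i2] at i1; linarith
  have key := tendsto_nhds_unique (t1.congr hn) (t2.neg.sub t3)
  have f1 : ∫ x in halfSpace, c x * u x * pderiv j φ x =
      ∫ x in halfSpace, c x * (rho x * pderiv j φ x) * ((rho x)⁻¹ * u x) := by
    congr 1; ext x
    have := (rho_pos x).ne'
    field_simp
  have f2 : ∫ x in halfSpace, smulGrad c u G j x * φ x =
      (∫ x in halfSpace, c x * φ x * G j x) +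
      ∫ x in halfSpace, pderiv j c x * (rho x * φ x) * ((rho x)⁻¹ * u x) := by
    rw [← integral_add (integrable_mul k2 (h.gmem j)) (integrable_mul k3 h.mem)]
    congr 1; ext x
    have := (rho_pos x).ne'
    unfold smulGrad
    field_simp
  rw [f1, f2, key]; ring

end Coef

/-! ### Bounds and uniqueness for weak solutions -/

section WeakBound
variable {lam mu : E3 → ℝ} {B α₀ β₀ : ℝ}

theorem sum_sum_nrm_sq_le (G : Fin 3 → Fin 3 → E3 → ℝ) :
    (∑ i, ∑ j, nrm hsVol (G i j)) ^ 2 ≤ 9 * ∑ i, ∑ j, nrm hsVol (G i j) ^ 2 := by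
  have := sq_sum_le_card_mul_sum_sq (s := (Finset.univ : Finset (Fin 3 × Fin 3)))
    (f := fun p => nrm hsVol (G p.1 p.2))
  simpa [Fintype.sum_prod_type] using this

/-- `2592 = 9 · 288`: Korn's constant times the nine terms in Cauchy–Schwarz. -/
theorem coercive (h : Lame lam mu B α₀ β₀) {u : Fin 3 → E3 → ℝ} {G : Fin 3 → Fin 3 → E3 → ℝ}
    (hu : ∀ i, H1 halfSpace (u i) (G i)) :
    min (2 * α₀) β₀ * (∑ i, ∑ j, nrm hsVol (G i j)) ^ 2 ≤
      2592 * energy lam mu (symPart G) (symPart G) := by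
  have hc : 0 < min (2 * α₀) β₀ := lt_min (by linarith [h.posα]) h.posβ
  have h1 := korn hu
  have h2 := sum_sum_nrm_sq_le G
  have h3 := energy_lower h (memLp_symPart fun i j => (hu i).gmem j)
  calc min (2 * α₀) β₀ * (∑ i, ∑ j, nrm hsVol (G i j)) ^ 2
      ≤ min (2 * α₀) β₀ * (9 * (288 * ∑ i, ∑ j, nrm hsVol (symPart G i j) ^ 2)) :=
        mul_le_mul_of_nonneg_left (by linarith) hc.le
    _ = 2592 * (min (2 * α₀) β₀ * ∑ i, ∑ j, nrm hsVol (symPart G i j) ^ 2) := by ring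
    _ ≤ _ := by gcongr

theorem abs_integral_load_le {f v : Fin 3 → E3 → ℝ} {F : Fin 3 → Fin 3 → E3 → ℝ}
    (hf : ∀ i, MemLp (fun x => rho x * f i x) 2 hsVol) (hv : ∀ i, H1 halfSpace (v i) (F i)) :
    |∑ i, ∫ x in halfSpace, f i x * v i x| ≤
      4 * (∑ i, nrm hsVol fun x => rho x * f i x) * ∑ i, ∑ j, nrm hsVol (F i j) := by
  have h1 : ∀ i, |∫ x in halfSpace, f i x * v i x| ≤
      (nrm hsVol fun x => rho x * f i x) * (4 * ∑ i, ∑ j, nrm hsVol (F i j)) := fun i => by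
    have e : ∫ x in halfSpace, f i x * v i x =
        ∫ x in halfSpace, (rho x * f i x) * ((rho x)⁻¹ * v i x) := by
      congr 1; ext x
      have := (rho_pos x).ne'
      field_simp
    rw [e]
    refine (abs_integral_mul_le (hf i) (hv i).mem).trans ?_
    refine mul_le_mul_of_nonneg_left ((hardy (hv i)).trans ?_) (nrm_nonneg _ _)
    refine mul_le_mul_of_nonneg_left ?_ (by norm_num)
    exact Finset.single_le_sum (f := fun i => ∑ j, nrm hsVol (F i j))
      (fun i _ => Finset.sum_nonneg fun j _ => nrm_nonneg _ _) (Finset.mem_univ i)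
  refine (Finset.abs_sum_le_sum_abs _ _).trans ((Finset.sum_le_sum fun i _ => h1 i).trans ?_)
  rw [← Finset.sum_mul]
  exact le_of_eq (by ring)

/-- The solution is its own test field: coercivity and the load estimate give `c S² ≤ 2592 · 4 · T
S`, and one divides by `S`. -/
theorem WeakSol.bound (h : Lame lam mu B α₀ β₀) {f u : Fin 3 → E3 → ℝ}
    {G : Fin 3 → Fin 3 → E3 → ℝ} (hu : WeakSol lam mu f u G)
    (hf : ∀ i, MemLp (fun x => rho x * f i x) 2 hsVol) :
    ∑ i, ∑ j, nrm hsVol (G i j) ≤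
      10368 / min (2 * α₀) β₀ * ∑ i, nrm hsVol fun x => rho x * f i x := by
  have hc : 0 < min (2 * α₀) β₀ := lt_min (by linarith [h.posα]) h.posβ
  have h1 := coercive h hu.mem
  have h2 := abs_integral_load_le hf hu.mem
  rw [hu.eq u G hu.mem] at h1
  have h3 := neg_abs_le (∑ i, ∫ x in halfSpace, f i x * u i x)
  have hF : 0 ≤ ∑ i, nrm hsVol fun x => rho x * f i x :=
    Finset.sum_nonneg fun i _ => nrm_nonneg _ _
  have hS : 0 ≤ ∑ i, ∑ j, nrm hsVol (G i j) :=
    Finset.sum_nonneg fun i _ => Finset.sum_nonneg fun j _ => nrm_nonneg _ _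
  rw [div_mul_eq_mul_div, le_div_iff₀ hc]
  generalize ∑ i, ∑ j, nrm hsVol (G i j) = S at *
  generalize (∑ i, nrm hsVol fun x => rho x * f i x) = T at *
  rcases hS.eq_or_lt with h0 | h0
  · rw [← h0]; simp; exact hF
  · refine le_of_mul_le_mul_right ?_ h0
    nlinarith

theorem density_sub_left (l m : ℝ) (e e' s : Fin 3 → Fin 3 → ℝ) :
    density l m (fun i j => e i j - e' i j) s = density l m e s - density l m e' s := by
  simp only [density, Fin.sum_univ_three]; ring

/-- The difference solves the problem with zero load, so its gradient vanishes; Hardy's inequality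
then excludes nonzero constants. -/
theorem WeakSol.unique (h : Lame lam mu B α₀ β₀) {f u u' : Fin 3 → E3 → ℝ}
    {G G' : Fin 3 → Fin 3 → E3 → ℝ} (hu : WeakSol lam mu f u G) (hu' : WeakSol lam mu f u' G')
    (i : Fin 3) : u i =ᵐ[hsVol] u' i := by
  have hd : WeakSol lam mu 0 (fun i x => u i x - u' i x) (fun i j x => G i j x - G' i j x) := by
    refine ⟨fun i => (hu.mem i).sub (hu'.mem i), fun v F hv => ?_⟩
    have e1 := hu.eq v F hv
    rw [← hu'.eq v F hv] at e1
    have hs := memLp_symPart fun i j => (hv i).gmem j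
    have e2 : energy lam mu (symPart fun i j x => G i j x - G' i j x) (symPart F) =
        energy lam mu (symPart G) (symPart F) - energy lam mu (symPart G') (symPart F) := by
      unfold energy
      rw [← integral_sub
        (integrable_density h.lamCoef h.muCoef (memLp_symPart fun i j => (hu.mem i).gmem j) hs)
        (integrable_density h.lamCoef h.muCoef (memLp_symPart fun i j => (hu'.mem i).gmem j) hs)]
      congr 1; ext x
      rw [← density_sub_left]
      congr 1; ext i j
      simp only [symPart]; ring
    rw [e2, e1]; simp
  have hb := hd.bound h (by simp)
  have hb0 : ∑ i, ∑ j, nrm hsVol (fun x => G i j x - G' i j x) ≤ 0 :=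
    hb.trans (le_of_eq (by simp [nrm]))
  have hz : ∑ j, nrm hsVol (fun x => G i j x - G' i j x) ≤ 0 :=
    (Finset.single_le_sum (f := fun i => ∑ j, nrm hsVol (fun x => G i j x - G' i j x))
      (fun i _ => Finset.sum_nonneg fun j _ => nrm_nonneg _ _) (Finset.mem_univ i)).trans hb0
  have hn : nrm hsVol (fun x => (rho x)⁻¹ * (u i x - u' i x)) = 0 :=
    le_antisymm ((hardy (hd.mem i)).trans (by linarith)) (nrm_nonneg _ _)
  have hm := (hd.mem i).mem
  rw [nrm, ENNReal.toReal_eq_zero_iff, or_iff_left hm.2.ne,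
    eLpNorm_eq_zero_iff hm.1 (by norm_num)] at hn
  filter_upwards [hn] with x hx
  have := (rho_inv_pos x).ne'
  simp only [Pi.zero_apply, mul_eq_zero, this, false_or] at hx
  linarith

end WeakBound

/-! ### Tangential translations and difference quotients -/

section Translate
variable {a : E3} {g : E3 → ℝ}

theorem add_mem_halfSpace_iff (ha : a 2 = 0) (x : E3) : x + a ∈ halfSpace ↔ x ∈ halfSpace := by
  simp [halfSpace, ha]

theorem measurePreserving_shift (ha : a 2 = 0) :
    MeasurePreserving (fun x : E3 => x + a) hsVol hsVol := by
  have h0 := measurePreserving_add_right (volume : Measure E3) a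
  have := h0.restrict_preimage_emb (Homeomorph.addRight a).measurableEmbedding halfSpace
  have hpre : (fun x : E3 => x + a) ⁻¹' halfSpace = halfSpace := by
    ext x; exact add_mem_halfSpace_iff ha x
  rwa [hpre] at this

theorem memLp_shift (ha : a 2 = 0) (hg : MemLp g 2 hsVol) :
    MemLp (fun x => g (x + a)) 2 hsVol := hg.comp_measurePreserving (measurePreserving_shift ha)

theorem eLpNorm_shift (ha : a 2 = 0) (hg : AEStronglyMeasurable g hsVol) :
    eLpNorm (fun x => g (x + a)) 2 hsVol = eLpNorm g 2 hsVol :=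
  eLpNorm_comp_measurePreserving hg (measurePreserving_shift ha)

theorem integral_shift (ha : a 2 = 0) (g : E3 → ℝ) :
    ∫ x in halfSpace, g (x + a) = ∫ x in halfSpace, g x :=
  (measurePreserving_shift ha).integral_comp (Homeomorph.addRight a).measurableEmbedding g

theorem ae_shift (ha : a 2 = 0) {p : E3 → Prop} (h : ∀ᵐ x ∂hsVol, p x) :
    ∀ᵐ x ∂hsVol, p (x + a) :=
  (measurePreserving_shift ha).quasiMeasurePreserving.ae h

/-- Weights that vary slowly. -/
structure SlowWeight (p : E3 → ℝ) : Prop where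
  cont : Continuous p
  nonneg : ∀ x, 0 ≤ p x
  le_one : ∀ x, p x ≤ 1
  slow : ∀ x y, ‖x - y‖ ≤ 1 → p x ≤ 2 * p y

theorem slowWeight_one : SlowWeight fun _ => 1 :=
  ⟨continuous_const, fun _ => zero_le_one, fun _ => le_rfl, fun _ _ _ => by norm_num⟩

theorem slowWeight_rho_inv : SlowWeight fun x => (rho x)⁻¹ := by
  refine ⟨continuous_rho_inv, fun x => (rho_inv_pos x).le, rho_inv_le_one, fun x y h => ?_⟩
  have h1 := rho_le_two_mul y x (by rwa [norm_sub_rev])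
  have h2 := rho_pos x
  have h3 := rho_pos y
  rw [inv_le_iff_one_le_mul₀ h2, mul_assoc, mul_comm, mul_assoc, ← div_eq_inv_mul,
    one_le_div h3, mul_comm]
  exact h1

theorem SlowWeight.memLp_mul {p : E3 → ℝ} (hp : SlowWeight p) (hg : MemLp g 2 hsVol) :
    MemLp (fun x => p x * g x) 2 hsVol := by
  refine memLp_of_le hg (hp.cont.aestronglyMeasurable.mul hg.1) (c := 1) (Eventually.of_forall
    fun x => ?_)
  rw [abs_mul, abs_of_nonneg (hp.nonneg x)]
  exact mul_le_mul_of_nonneg_right (hp.le_one x) (abs_nonneg _)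

theorem SlowWeight.eLpNorm_shift_le {p : E3 → ℝ} (hp : SlowWeight p) (ha : a 2 = 0)
    (ha1 : ‖a‖ ≤ 1) (hg : AEStronglyMeasurable g hsVol) :
    eLpNorm (fun x => p x * g (x + a)) 2 hsVol ≤ 2 * eLpNorm (fun x => p x * g x) 2 hsVol := by
  have h2 := eLpNorm_shift ha (g := fun x => p x * g x) (hp.cont.aestronglyMeasurable.mul hg)
  rw [← h2]
  have := eLpNorm_le_nnreal_smul_eLpNorm_of_ae_le_mul (μ := hsVol) (c := 2)
    (f := fun x => p x * g (x + a)) (g := fun x => p (x + a) * g (x + a))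
    (Eventually.of_forall fun x => ?_) 2
  · simpa [ENNReal.smul_def] using this
  · have h3 := hp.slow x (x + a) (by simpa using ha1)
    rw [← NNReal.coe_le_coe]
    simp only [coe_nnnorm, NNReal.coe_mul, NNReal.coe_ofNat, norm_mul, Real.norm_eq_abs]
    rw [abs_of_nonneg (hp.nonneg x), abs_of_nonneg (hp.nonneg _), ← mul_assoc]
    gcongr

theorem memLp_rho_inv_shift (ha : a 2 = 0) (ha1 : ‖a‖ ≤ 1)
    (hg : MemLp (fun x => (rho x)⁻¹ * g x) 2 hsVol) :
    MemLp (fun x => (rho x)⁻¹ * g (x + a)) 2 hsVol := by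
  have hgm : AEStronglyMeasurable g hsVol := (locallyIntegrable_of_rho_inv hg).aestronglyMeasurable
  refine ⟨continuous_rho_inv.aestronglyMeasurable.mul
    (hgm.comp_measurePreserving (measurePreserving_shift ha)),
    (slowWeight_rho_inv.eLpNorm_shift_le ha ha1 hgm).trans_lt ?_⟩
  exact ENNReal.mul_lt_top (by norm_num) hg.2

theorem H1.shift {u : E3 → ℝ} {G : Fin 3 → E3 → ℝ} (h : H1 halfSpace u G) (ha : a 2 = 0)
    (ha1 : ‖a‖ ≤ 1) : H1 halfSpace (fun x => u (x + a)) (fun j x => G j (x + a)) :=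
  ⟨fun j => (h.deriv j).translate a (add_mem_halfSpace_iff ha),
    memLp_rho_inv_shift ha ha1 h.mem, fun j => memLp_shift ha (h.gmem j)⟩

theorem Coef.shift {c : E3 → ℝ} {B : ℝ} (h : Coef c B) (hB : 0 ≤ B) (ha : a 2 = 0)
    (ha1 : ‖a‖ ≤ 1) : Coef (fun x => c (x + a)) (2 * B) := by
  refine ⟨?_, fun x hx => ?_, ?_⟩
  · obtain ⟨L, hL⟩ := h.lip
    refine ⟨L, LipschitzOnWith.of_dist_le_mul fun x hx y hy => ?_⟩
    simpa using hL.dist_le_mul _ ((add_mem_halfSpace_iff ha x).2 hx) _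
      ((add_mem_halfSpace_iff ha y).2 hy)
  · exact (h.bdd _ ((add_mem_halfSpace_iff ha x).2 hx)).trans (by linarith)
  · filter_upwards [ae_shift ha h.grad] with x hx
    rw [fderiv_comp_add_right]
    refine hx.trans ?_
    have h1 := rho_le_two_mul x (x + a) (by simpa using ha1)
    rw [div_le_div_iff₀ (rho_pos _) (rho_pos _)]
    nlinarith

theorem Lame.shift {lam mu : E3 → ℝ} {B α₀ β₀ : ℝ} (h : Lame lam mu B α₀ β₀) (ha : a 2 = 0)
    (ha1 : ‖a‖ ≤ 1) :
    Lame (fun x => lam (x + a)) (fun x => mu (x + a)) (2 * B) α₀ β₀ :=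
  ⟨h.lamCoef.shift h.posB.le ha ha1, h.muCoef.shift h.posB.le ha ha1, h.posα, h.posβ,
    by linarith [h.posB], fun _ hx => h.lower _ ((add_mem_halfSpace_iff ha _).2 hx),
    fun _ hx => h.lower' _ ((add_mem_halfSpace_iff ha _).2 hx)⟩

end Translate

/-- The difference quotient in the direction `e_k`. -/
def dq (k : Fin 3) (h : ℝ) (g : E3 → ℝ) (x : E3) : ℝ :=
  h⁻¹ * (g (x + EuclideanSpace.single k h) - g x)

section DQ
variable {k : Fin 3} {h : ℝ} {g : E3 → ℝ}

theorem single_two (hk : k ≠ 2) (h : ℝ) : (EuclideanSpace.single k h : E3) 2 = 0 := by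
  simp [hk.symm]

theorem norm_single_le {h : ℝ} (h1 : |h| ≤ 1) : ‖(EuclideanSpace.single k h : E3)‖ ≤ 1 := by
  simpa using h1

theorem memLp_dq (hk : k ≠ 2) (hg : MemLp g 2 hsVol) : MemLp (dq k h g) 2 hsVol :=
  ((memLp_shift (single_two hk h) hg).sub hg).const_mul _

theorem H1.dq {u : E3 → ℝ} {G : Fin 3 → E3 → ℝ} (hu : H1 halfSpace u G) (hk : k ≠ 2)
    (h1 : |h| ≤ 1) : H1 halfSpace (dq k h u) (fun j => LameHalfSpace.dq k h (G j)) :=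
  ((hu.shift (single_two hk h) (norm_single_le h1)).sub hu).const_mul _

theorem single_neg (k : Fin 3) (h : ℝ) :
    (EuclideanSpace.single k (-h) : E3) = -EuclideanSpace.single k h := by
  ext i; by_cases hi : i = k <;> simp [hi]

/-- Discrete integration by parts. -/
theorem integral_mul_dq (hk : k ≠ 2) {q s : E3 → ℝ}
    (h0 : Integrable (fun x => q x * s x) hsVol)
    (h1 : Integrable (fun x => q (x + EuclideanSpace.single k h) * s x) hsVol) :
    ∫ x in halfSpace, q x * dq k (-h) s x = - ∫ x in halfSpace, dq k h q x * s x := by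
  set a : E3 := EuclideanSpace.single k h with ha
  have ha2 : a 2 = 0 := single_two hk h
  have ha2' : (-a) 2 = 0 := by simp [ha2]
  have e0 : ∀ x, q x * dq k (-h) s x = h⁻¹ * (q x * s x) - h⁻¹ * (q x * s (x + -a)) := fun x => by
    rw [dq, single_neg, inv_neg]; ring
  have e1 : ∀ x, dq k h q x * s x = h⁻¹ * (q (x + a) * s x) - h⁻¹ * (q x * s x) := fun x => by
    rw [dq]; ring
  have hsh : (fun x => q x * s (x + -a)) = fun x => (fun y => q (y + a) * s y) (x + -a) := by
    ext x; simp
  have h2 : Integrable (fun x => q x * s (x + -a)) hsVol := by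
    rw [hsh]
    exact (measurePreserving_shift ha2').integrable_comp_of_integrable h1
  have e2 : ∫ x in halfSpace, q x * s (x + -a) = ∫ x in halfSpace, q (x + a) * s x := by
    rw [hsh]; exact integral_shift ha2' fun y => q (y + a) * s y
  simp only [e0, e1]
  rw [integral_sub (h0.const_mul _) (h2.const_mul _), integral_sub (h1.const_mul _)
    (h0.const_mul _)]
  simp only [integral_const_mul, e2]
  ring

theorem single_mul_eq (k : Fin 3) (h t : ℝ) : (EuclideanSpace.single k (t * h) : E3) =
    t • (h • EuclideanSpace.single k (1:ℝ)) := by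
  ext i; by_cases hi : i = k <;> simp [hi]

theorem hasDerivAt_along {φ : E3 → ℝ} (hφ : ContDiff ℝ ∞ φ) (k : Fin 3) (x : E3) (h t : ℝ) :
    HasDerivAt (fun t : ℝ => φ (x + EuclideanSpace.single k (t * h)))
      (h * pderiv k φ (x + EuclideanSpace.single k (t * h))) t := by
  have h1 : HasDerivAt (fun t : ℝ => x + (EuclideanSpace.single k (t * h) : E3))
      (h • EuclideanSpace.single k (1:ℝ)) t := by
    simp only [single_mul_eq]
    simpa using ((hasDerivAt_id t).smul_const
      (h • (EuclideanSpace.single k (1:ℝ) : E3))).const_add x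
  have h2 := ((hφ.differentiable (by simp))
    (x + EuclideanSpace.single k (t * h))).hasFDerivAt.comp_hasDerivAt t h1
  rw [map_smul] at h2
  exact h2

theorem dq_eq_integral {φ : E3 → ℝ} (hφ : ContDiff ℝ ∞ φ) (hh : h ≠ 0) (k : Fin 3) (x : E3) :
    dq k h φ x = ∫ t in Ioc (0:ℝ) 1, pderiv k φ (x + EuclideanSpace.single k (t * h)) := by
  have hs := single_mul_eq k h
  have hd := hasDerivAt_along hφ k x h
  have hc : Continuous fun t : ℝ => h * pderiv k φ (x + EuclideanSpace.single k (t * h)) := by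
    refine continuous_const.mul ((contDiff_pderiv hφ k).continuous.comp ?_)
    simp only [hs]; fun_prop
  have := intervalIntegral.integral_eq_sub_of_hasDerivAt (a := 0) (b := 1) (fun t _ => hd t)
    (hc.intervalIntegrable 0 1)
  rw [intervalIntegral.integral_const_mul, intervalIntegral.integral_of_le zero_le_one] at this
  rw [dq]
  simp only [one_mul, zero_mul] at this
  have hz : (EuclideanSpace.single k (0:ℝ) : E3) = 0 := by ext i; simp
  rw [hz, add_zero] at this
  rw [← this, ← mul_assoc, inv_mul_cancel₀ hh, one_mul]

/-- The quotient is the mean over `t` in `(0, 1]` of translates of `∂_kφ`. Minkowski's inequality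
bounds the mean, and each translation costs the factor two of a slow weight. -/
theorem SlowWeight.nrm_dq_smooth_le {p φ : E3 → ℝ} (hp : SlowWeight p) (hφ : ContDiff ℝ ∞ φ)
    (hc : HasCompactSupport φ) (hk : k ≠ 2) (hh : h ≠ 0) (h1 : |h| ≤ 1) :
    nrm hsVol (fun x => p x * dq k h φ x) ≤ 2 * nrm hsVol (fun x => p x * pderiv k φ x) := by
  have hcp := (contDiff_pderiv hφ k).continuous
  have hmem : MemLp (fun x => p x * pderiv k φ x) 2 hsVol := hp.memLp_mul (memLp_pderiv hφ hc k)
  have hpr : IsProbabilityMeasure (volume.restrict (Ioc (0:ℝ) 1)) := ⟨by simp⟩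
  have hsing : Continuous fun q : ℝ × E3 => q.2 + (EuclideanSpace.single k (q.1 * h) : E3) := by
    simp only [single_mul_eq]; fun_prop
  have hav := eLpNorm_average_le (P := volume.restrict (Ioc (0:ℝ) 1)) (ν := hsVol)
    (F := fun t x => p x * pderiv k φ (x + EuclideanSpace.single k (t * h)))
    (B := 2 * eLpNorm (fun x => p x * pderiv k φ x) 2 hsVol)
    ((hp.cont.comp continuous_snd).mul (hcp.comp hsing)).stronglyMeasurable ?_
  · simp only [integral_const_mul, ← dq_eq_integral hφ hh] at hav
    have := ENNReal.toReal_mono (ENNReal.mul_lt_top (by norm_num) hmem.2).ne hav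
    simpa [nrm, ENNReal.toReal_mul] using this
  · filter_upwards [ae_restrict_mem measurableSet_Ioc] with t ht
    refine hp.eLpNorm_shift_le (single_two hk _) (norm_single_le ?_) hcp.aestronglyMeasurable
    rw [abs_mul, abs_of_pos ht.1]
    nlinarith [ht.2, ht.1, abs_nonneg h]

/-- Since only `u/ϱ` is in `L²`, smooth approximants need not converge to `u` without the weight.
Almost everywhere convergence of a subsequence and Fatou's lemma suffice, and also yield
integrability of the quotient. -/
theorem SlowWeight.nrm_dq_le {p u : E3 → ℝ} {G : Fin 3 → E3 → ℝ} (hp : SlowWeight p)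
    (hu : H1 halfSpace u G) (hk : k ≠ 2) (hh : h ≠ 0) (h1 : |h| ≤ 1) :
    MemLp (fun x => p x * LameHalfSpace.dq k h u x) 2 hsVol ∧
    nrm hsVol (fun x => p x * LameHalfSpace.dq k h u x) ≤ 2 * nrm hsVol (fun x => p x * G k x) := by
  obtain ⟨φ, hφ⟩ := hu.exists_approx
  obtain ⟨ψ, hψ, hae⟩ := hφ.exists_ae hu.mem
  have hψm := fun n => memLp_pderiv (μ := hsVol) (hψ.smooth n) (hψ.compact n) k
  have hlim : Tendsto (fun n => nrm hsVol (fun x => p x * pderiv k (ψ n) x)) atTop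
      (𝓝 (nrm hsVol (fun x => p x * G k x))) := by
    refine nrm_sub_tendsto (fun n => hp.memLp_mul (hψm n)) (hp.memLp_mul (hu.gmem k)) ?_
    refine squeeze_zero (fun _ => nrm_nonneg _ _) (fun n => ?_) (hψ.glim k)
    refine nrm_mono ((hψm n).sub (hu.gmem k)) (Eventually.of_forall fun x => ?_)
    rw [← mul_sub, abs_mul, abs_of_nonneg (hp.nonneg x)]
    exact mul_le_of_le_one_left (abs_nonneg _) (hp.le_one x)
  have hlim2 : ∀ᵐ x ∂hsVol, Tendsto (fun n => p x * dq k h (ψ n) x) atTop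
      (𝓝 (p x * dq k h u x)) := by
    filter_upwards [hae, ae_shift (single_two hk h) hae] with x hx hx'
    exact ((hx'.sub hx).const_mul _).const_mul _
  have hmem : ∀ n, MemLp (fun x => p x * dq k h (ψ n) x) 2 hsVol := fun n =>
    hp.memLp_mul (memLp_dq hk ((hψ.smooth n).continuous.memLp_of_hasCompactSupport (hψ.compact n)))
  have key : ∀ δ > 0, MemLp (fun x => p x * dq k h u x) 2 hsVol ∧
      nrm hsVol (fun x => p x * dq k h u x) ≤ 2 * nrm hsVol (fun x => p x * G k x) + δ := by
    intro δ hδ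
    obtain ⟨N, hN⟩ := eventually_atTop.1
      ((tendsto_order.1 hlim).2 (nrm hsVol (fun x => p x * G k x) + δ / 2) (by linarith))
    refine memLp_of_tendsto_ae (f := fun n x => p x * dq k h (ψ (n + N)) x)
      (fun n => hmem _) (fun n => ?_) (hlim2.mono fun x hx => (tendsto_add_atTop_iff_nat N).2 hx)
    have e1 := hp.nrm_dq_smooth_le (hψ.smooth (n + N)) (hψ.compact (n + N)) hk hh h1
    have e2 := hN (n + N) (by omega)
    linarith
  exact ⟨(key 1 one_pos).1, le_of_forall_pos_le_add fun δ hδ => (key δ hδ).2⟩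

end DQ

/-- Dominated convergence: outside the 1-thickening of the support both terms vanish, and inside
each is at most the Lipschitz constant. -/
theorem tendsto_dq_smooth {φ : E3 → ℝ} (hφ : ContDiff ℝ ∞ φ) (hc : HasCompactSupport φ)
    {k : Fin 3} (hk : k ≠ 2) {t : ℕ → ℝ} (t0 : ∀ n, t n ≠ 0) (t1 : ∀ n, |t n| ≤ 1)
    (tl : Tendsto t atTop (𝓝 0)) :
    Tendsto (fun n => nrm hsVol (fun x => dq k (t n) φ x - pderiv k φ x)) atTop (𝓝 0) := by
  obtain ⟨L, hL⟩ := hφ.lipschitzWith_of_hasCompactSupport hc (by simp)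
  have hφ2 : MemLp φ 2 hsVol := hφ.continuous.memLp_of_hasCompactSupport hc
  let K : Set E3 := Metric.cthickening 1 (tsupport φ)
  have hK : IsCompact K := hc.isCompact.cthickening
  have hout : ∀ x, x ∉ K → ∀ a : E3, ‖a‖ ≤ 1 → φ (x + a) = 0 := fun x hx a ha => by
    by_contra h0
    exact hx (Metric.mem_cthickening_of_dist_le x (x + a) 1 _ (subset_tsupport φ h0)
      (by simpa [dist_eq_norm] using ha))
  have hsub : tsupport φ ⊆ K := Metric.self_subset_cthickening _
  refine nrm_tendsto_zero_of_dominated (g := K.indicator fun _ => 2 * (L:ℝ))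
    (fun n => ((memLp_dq hk hφ2).sub (memLp_pderiv hφ hc k)).1)
    (memLp_indicator_const 2 hK.measurableSet _ (Or.inr ?_)) (fun n => Eventually.of_forall
      fun x => ?_) (Eventually.of_forall fun x => ?_)
  · exact ((Measure.restrict_apply_le _ _).trans_lt hK.measure_lt_top).ne
  · by_cases hx : x ∈ K
    · rw [indicator_of_mem hx, abs_of_nonneg (by positivity : 0 ≤ 2 * (L:ℝ))]
      have e1 : |dq k (t n) φ x| ≤ L := by
        have := hL.dist_le_mul (x + EuclideanSpace.single k (t n)) x
        rw [Real.dist_eq, dist_eq_norm, add_sub_cancel_left, PiLp.norm_single,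
          Real.norm_eq_abs] at this
        rw [dq, abs_mul, abs_inv, inv_mul_le_iff₀ (abs_pos.2 (t0 n)), mul_comm]
        exact this
      have e2 : |pderiv k φ x| ≤ L := by
        refine ((fderiv ℝ φ x).le_opNorm _).trans ?_
        simpa using norm_fderiv_le_of_lipschitz ℝ hL (x₀ := x)
      exact (abs_sub _ _).trans (by linarith)
    · have e1 : pderiv k φ x = 0 :=
        image_eq_zero_of_notMem_tsupport fun h => hx (hsub (tsupport_pderiv k h))
      have e2 := hout x hx 0 (by simp)
      rw [add_zero] at e2
      rw [dq, hout x hx _ (norm_single_le (t1 n)), e1, e2]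
      simp
  · have hd := hasDerivAt_along hφ k x 1 0
    have h1 := hd.tendsto_slope_zero
    simp only [zero_add, mul_one, one_mul, smul_eq_mul] at h1
    have hz : (EuclideanSpace.single k (0:ℝ) : E3) = 0 := by ext i; simp
    rw [hz, add_zero] at h1
    have h2 : Tendsto t atTop (𝓝[≠] 0) :=
      tendsto_nhdsWithin_iff.2 ⟨tl, Eventually.of_forall fun n => t0 n⟩
    have h3 := (h1.comp h2).sub_const (pderiv k φ x)
    rw [sub_self] at h3
    exact h3

/-! ### Weak limits of difference quotients -/

/-- Banach–Alaoglu with an ultrafilter in place of a subsequence. The conclusion concerns only those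
pairings that converge along the whole sequence, which is all that is needed to identify the limit.
-/
theorem exists_weak_limit {H : Type*} [NormedAddCommGroup H] [InnerProductSpace ℝ H]
    [CompleteSpace H] {g : ℕ → H} {R : ℝ} (hg : ∀ n, ‖g n‖ ≤ R) :
    ∃ y : H, ‖y‖ ≤ R ∧ ∀ (s : H) (l : ℝ), Tendsto (fun n => inner ℝ (g n) s) atTop (𝓝 l) →
      inner ℝ y s = l := by
  let D := InnerProductSpace.toDual ℝ H
  let x : ℕ → WeakDual ℝ H := fun n => StrongDual.toWeakDual (D (g n))
  let U : Ultrafilter (WeakDual ℝ H) := (hyperfilter ℕ).map x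
  obtain ⟨y, hy, hU⟩ := (WeakDual.isCompact_closedBall (𝕜 := ℝ) (E := H) 0 R).ultrafilter_le_nhds U
    (by
      rw [le_principal_iff]
      change x ⁻¹' _ ∈ (hyperfilter ℕ : Filter ℕ)
      exact univ_mem' fun n => by simpa [x, D] using hg n)
  refine ⟨D.symm (WeakDual.toStrongDual y), ?_, fun s l hl => ?_⟩
  · rw [LinearIsometryEquiv.norm_map]; simpa using hy
  · have h1 : Tendsto (fun n => x n s) (hyperfilter ℕ) (𝓝 (y s)) :=
      ((WeakDual.eval_continuous s).tendsto y).comp hU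
    have h2 : Tendsto (fun n => x n s) (hyperfilter ℕ) (𝓝 l) := by
      refine Tendsto.mono_left ?_ Nat.hyperfilter_le_atTop
      simpa [x, D] using hl
    rw [← tendsto_nhds_unique h1 h2]
    have := InnerProductSpace.toDual_symm_apply (𝕜 := ℝ) (x := s) (y := WeakDual.toStrongDual y)
    exact this

/-- Take a weak limit `y` of `ϱ D_h u`. Discrete integration by parts moves the quotient onto the
test function, where it converges strongly, so `y/ϱ` is the weak derivative; the norm bound passes
to weak limits. -/
theorem exists_weakDeriv_of_dq_bound {k : Fin 3} (hk : k ≠ 2) {u : E3 → ℝ} {R : ℝ}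
    (hu : MemLp u 2 hsVol)
    (hR : ∀ h : ℝ, 0 < h → h ≤ 1 → MemLp (fun x => rho x * dq k h u x) 2 hsVol ∧
      nrm hsVol (fun x => rho x * dq k h u x) ≤ R) :
    ∃ g, IsWeakDeriv halfSpace (idx k) u g ∧ MemLp (fun x => rho x * g x) 2 hsVol ∧
      nrm hsVol (fun x => rho x * g x) ≤ R := by
  let t : ℕ → ℝ := fun n => 1 / ((n:ℝ) + 1)
  have t0 : ∀ n, 0 < t n := fun n => by positivity
  have t1 : ∀ n, t n ≤ 1 := fun n => by
    rw [div_le_one (by positivity)]; linarith [(Nat.cast_nonneg n : (0:ℝ) ≤ n)]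
  have tl : Tendsto t atTop (𝓝 0) := tendsto_one_div_add_atTop_nhds_zero_nat
  have hm := fun n => (hR (t n) (t0 n) (t1 n)).1
  obtain ⟨y, hy, hlim⟩ := exists_weak_limit (g := fun n => (hm n).toLp _) (R := R) fun n => by
    rw [norm_toLp_eq_nrm]; exact (hR (t n) (t0 n) (t1 n)).2
  have hym : MemLp (fun x => y x) 2 hsVol := Lp.memLp y
  have e : (fun x => rho x * ((rho x)⁻¹ * y x)) = fun x => y x := by
    ext x; rw [← mul_assoc, mul_inv_cancel₀ (rho_pos x).ne', one_mul]
  refine ⟨fun x => (rho x)⁻¹ * y x, isWeakDeriv_idx.2 ⟨hu.locInt,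
    hym.locInt.mul_cont isOpen_halfSpace continuous_rho_inv.continuousOn, fun φ hφ => ?_⟩,
    by rwa [e], ?_⟩
  · have hφm : MemLp (fun x => (rho x)⁻¹ * φ x) 2 hsVol := memLp_rho_inv_mul hφ.1 hφ.2.1
    have hφ2 : MemLp φ 2 hsVol := hφ.1.continuous.memLp_of_hasCompactSupport hφ.2.1
    have hl := hlim (hφm.toLp _) (- ∫ x in halfSpace, u x * pderiv k φ x) ?_
    · have e1 := integral_mul_eq_inner hym hφm
      rw [Lp.toLp_coeFn] at e1
      have e2 : ∫ x in halfSpace, (rho x)⁻¹ * y x * φ x =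
          ∫ x in halfSpace, y x * ((rho x)⁻¹ * φ x) := by congr 1; ext x; ring
      rw [e2, e1, hl]; simp
    · have e3 : ∀ n, inner ℝ ((hm n).toLp _) (hφm.toLp _) =
          - ∫ x in halfSpace, u x * dq k (-(t n)) φ x := fun n => by
        rw [← integral_mul_eq_inner (hm n) hφm, integral_mul_dq hk (integrable_mul hu hφ2)
          (integrable_mul (memLp_shift (single_two hk _) hu) hφ2), neg_neg]
        congr 1; ext x
        have := (rho_pos x).ne'
        field_simp
      simp only [e3]
      refine Tendsto.neg ?_
      exact tendsto_integral_mul (fun n => memLp_dq hk hφ2) (memLp_pderiv hφ.1 hφ.2.1 k) hu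
        (tendsto_dq_smooth hφ.1 hφ.2.1 hk (fun n => (neg_neg_of_pos (t0 n)).ne) (fun n => by
          rw [abs_neg, abs_of_pos (t0 n)]; exact t1 n) (by simpa using tl.neg))
  · rw [e, ← norm_toLp_eq_nrm hym, Lp.toLp_coeFn]; exact hy

/-! ### Bounded weights approximating `ϱ` -/

/-- Smooth bounded weights `w ≤ ϱ` with `|∂_j w| ≤ 1`. -/
structure Weight (w : E3 → ℝ) : Prop where
  smooth : ContDiff ℝ ∞ w
  nonneg : ∀ x, 0 ≤ w x
  le_rho : ∀ x, w x ≤ rho x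
  grad : ∀ j x, |pderiv j w x| ≤ 1
  bdd : ∃ A, ∀ x, |w x| ≤ A
  gbdd : ∃ A, ∀ j x, rho x * |pderiv j w x| ≤ A

/-- The weights `n ϱ / (n + ϱ)`, up to a shift of `n`. -/
def weight (n : ℕ) (x : E3) : ℝ := ((n:ℝ) + 1) * rho x / ((n:ℝ) + 1 + rho x)

theorem pderiv_rho (j : Fin 3) (x : E3) : pderiv j rho x = x j / rho x := by
  have h1 : HasFDerivAt (fun x : E3 => 1 + ‖x‖ ^ 2) (2 • innerSL ℝ x) x :=
    (hasFDerivAt_norm_sq' x).const_add 1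
  have h2 := (h1.sqrt (by positivity)).fderiv
  change fderiv ℝ rho x _ = _
  change fderiv ℝ rho x = _ at h2
  rw [h2]
  change (1 / (2 * rho x)) * (2 • innerSL ℝ x (EuclideanSpace.single j (1:ℝ))) = _
  have := (rho_pos x).ne'
  simp only [innerSL_apply_apply, EuclideanSpace.inner_single_right]
  simp
  field_simp

theorem pderiv_weight (n : ℕ) (j : Fin 3) (x : E3) :
    pderiv j (weight n) x = (((n:ℝ) + 1) / ((n:ℝ) + 1 + rho x)) ^ 2 * (x j / rho x) := by
  have hr := (contDiff_rho.differentiable (by simp) x).hasFDerivAt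
  have h0 : (n:ℝ) + 1 + rho x ≠ 0 := by have := rho_pos x; positivity
  have hd : HasDerivAt (fun r : ℝ => ((n:ℝ) + 1) * r / ((n:ℝ) + 1 + r))
      ((((n:ℝ) + 1) / ((n:ℝ) + 1 + rho x)) ^ 2) (rho x) := by
    have h1 := ((hasDerivAt_id (rho x)).const_mul ((n:ℝ) + 1)).div
      ((hasDerivAt_id (rho x)).const_add ((n:ℝ) + 1)) h0
    refine h1.congr_deriv ?_
    simp only [id]
    field_simp
    ring
  have h2 := (hd.comp_hasFDerivAt x hr).fderiv
  change fderiv ℝ (weight n) x = _ at h2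
  rw [pderiv, h2, ← pderiv_rho]; rfl

/-- Boundedness (`bdd`, `gbdd`) only makes the weighted test fields admissible and may degenerate as
`n` grows. The estimates use `w ≤ ϱ` and `|∂_j w| ≤ 1`, which are uniform in `n`. -/
theorem weight_isWeight (n : ℕ) : Weight (weight n) := by
  have hN : (0:ℝ) < (n:ℝ) + 1 := by positivity
  have hg : ∀ j x, |pderiv j (weight n) x| ≤ (((n:ℝ) + 1) / ((n:ℝ) + 1 + rho x)) ^ 2 := by
    intro j x
    have hr := rho_pos x
    rw [pderiv_weight, abs_mul, abs_of_nonneg (sq_nonneg _), abs_div, abs_of_pos hr]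
    refine mul_le_of_le_one_right (sq_nonneg _) ?_
    rw [div_le_one hr]
    exact (abs_coord_le_norm x j).trans (norm_le_rho x)
  refine ⟨?_, fun x => ?_, fun x => ?_, fun j x => (hg j x).trans ?_, ⟨(n:ℝ) + 1, fun x => ?_⟩,
    ⟨((n:ℝ) + 1) ^ 2, fun j x => ?_⟩⟩
  · exact (contDiff_const.mul contDiff_rho).div (contDiff_const.add contDiff_rho)
      fun x => by have := rho_pos x; positivity
  · have := rho_pos x; unfold weight; positivity
  · have := rho_pos x
    rw [weight, div_le_iff₀ (by positivity)]
    nlinarith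
  · have := rho_pos x
    refine pow_le_one₀ (by positivity) ?_
    rw [div_le_one (by positivity)]; linarith
  · have := rho_pos x
    have h0 : 0 ≤ weight n x := by unfold weight; positivity
    rw [abs_of_nonneg h0, weight, div_le_iff₀ (by positivity)]
    nlinarith
  · have h1 := one_le_rho x
    refine (mul_le_mul_of_nonneg_left (hg j x) (rho_pos x).le).trans ?_
    rw [div_pow, ← mul_div_assoc, div_le_iff₀ (by positivity), mul_comm]
    refine mul_le_mul_of_nonneg_left ?_ (by positivity)
    nlinarith

theorem tendsto_weight (x : E3) : Tendsto (fun n => weight n x) atTop (𝓝 (rho x)) := by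
  have hr := rho_pos x
  have h1 : ∀ n : ℕ, weight n x = rho x * (1 - rho x / ((n:ℝ) + 1 + rho x)) := fun n => by
    have : (n:ℝ) + 1 + rho x ≠ 0 := by positivity
    unfold weight; field_simp; ring
  simp only [h1]
  have h2 : Tendsto (fun n : ℕ => rho x / ((n:ℝ) + 1 + rho x)) atTop (𝓝 0) := by
    refine Tendsto.div_atTop tendsto_const_nhds ?_
    exact tendsto_atTop_add_const_right _ _
      (tendsto_atTop_add_const_right _ _ tendsto_natCast_atTop_atTop)
  simpa using (h2.const_sub 1).const_mul (rho x)

/-! ### Tangential regularity -/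

theorem abs_energy_le {lam mu : E3 → ℝ} {B : ℝ} (h0 : 0 ≤ B)
    (hlm : AEStronglyMeasurable lam hsVol) (hmm : AEStronglyMeasurable mu hsVol)
    (hl : ∀ᵐ x ∂hsVol, |lam x| ≤ B) (hm : ∀ᵐ x ∂hsVol, |mu x| ≤ B)
    {e s : Fin 3 → Fin 3 → E3 → ℝ}
    (he : ∀ i j, MemLp (e i j) 2 hsVol) (hs : ∀ i j, MemLp (s i j) 2 hsVol) :
    |energy lam mu e s| ≤
      3 * B * (∑ i, ∑ j, nrm hsVol (e i j)) * ∑ i, ∑ j, nrm hsVol (s i j) := by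
  have htr : ∀ {e : Fin 3 → Fin 3 → E3 → ℝ}, (∀ i j, MemLp (e i j) 2 hsVol) →
      nrm hsVol (fun x => ∑ k, e k k x) ≤ ∑ i, ∑ j, nrm hsVol (e i j) := fun he =>
    (nrm_sum_le _ fun k => he k k).trans (Finset.sum_le_sum fun i _ =>
      Finset.single_le_sum (f := fun j => nrm hsVol _) (fun j _ => nrm_nonneg _ _)
        (Finset.mem_univ i))
  have hE : 0 ≤ ∑ i, ∑ j, nrm hsVol (e i j) :=
    Finset.sum_nonneg fun i _ => Finset.sum_nonneg fun j _ => nrm_nonneg _ _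
  have hle : ∀ i j, nrm hsVol (s i j) ≤ ∑ i, ∑ j, nrm hsVol (s i j) := fun i j =>
    (Finset.single_le_sum (f := fun j => nrm hsVol (s i j)) (fun j _ => nrm_nonneg _ _)
      (Finset.mem_univ j)).trans
    (Finset.single_le_sum (f := fun i => ∑ j, nrm hsVol (s i j))
      (fun i _ => Finset.sum_nonneg fun j _ => nrm_nonneg _ _) (Finset.mem_univ i))
  have e1 : energy lam mu e s = (∫ x in halfSpace, lam x * (∑ k, e k k x) * (∑ k, s k k x)) +
      2 * ∑ i, ∑ j, ∫ x in halfSpace, mu x * e i j x * s i j x := by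
    have i2 := fun i j => integrable_coef_mul hmm hm (he i j) (hs i j)
    have e3 : ∑ i, ∑ j, ∫ x in halfSpace, mu x * e i j x * s i j x =
        ∫ x in halfSpace, ∑ i, ∑ j, mu x * e i j x * s i j x := by
      rw [integral_finsetSum _ fun i _ => integrable_finsetSum _ fun j _ => i2 i j]
      exact Finset.sum_congr rfl fun i _ => (integral_finsetSum _ fun j _ => i2 i j).symm
    rw [e3, ← integral_const_mul, ← integral_add]
    · unfold energy density
      congr 1; ext x
      simp only [mul_assoc, Finset.mul_sum]
    · exact integrable_coef_mul hlm hl (memLp_sum _ fun k _ => he k k)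
        (memLp_sum _ fun k _ => hs k k)
    · exact (integrable_finsetSum _ fun i _ => integrable_finsetSum _ fun j _ => i2 i j).const_mul 2
  have b1 : |∫ x in halfSpace, lam x * (∑ k, e k k x) * (∑ k, s k k x)| ≤
      B * (∑ i, ∑ j, nrm hsVol (e i j)) * ∑ i, ∑ j, nrm hsVol (s i j) := by
    refine (abs_integral_coef_mul_le h0 hlm hl (memLp_sum _ fun k _ => he k k)
      (memLp_sum _ fun k _ => hs k k)).trans ?_
    exact mul_le_mul (mul_le_mul_of_nonneg_left (htr he) h0) (htr hs) (nrm_nonneg _ _)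
      (by positivity)
  have b2 : |∑ i, ∑ j, ∫ x in halfSpace, mu x * e i j x * s i j x| ≤
      B * (∑ i, ∑ j, nrm hsVol (e i j)) * ∑ i, ∑ j, nrm hsVol (s i j) := by
    refine (Finset.abs_sum_le_sum_abs _ _).trans ((Finset.sum_le_sum fun i _ =>
      Finset.abs_sum_le_sum_abs _ _).trans ((Finset.sum_le_sum fun i _ => Finset.sum_le_sum
      fun j _ => (abs_integral_coef_mul_le h0 hmm hm (he i j) (hs i j)).trans
        (mul_le_mul_of_nonneg_left (hle i j) (mul_nonneg h0 (nrm_nonneg _ _)))).trans ?_))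
    simp only [← Finset.sum_mul, ← Finset.mul_sum]
    exact le_rfl
  rw [e1]
  refine (abs_add_le _ _).trans ?_
  rw [abs_mul, abs_two]
  linarith

theorem Coef.dq {c : E3 → ℝ} {B : ℝ} (hc : Coef c B) (hB : 0 ≤ B) {k : Fin 3} (hk : k ≠ 2) {h : ℝ}
    (h1 : |h| ≤ 1) : ∃ B', Coef (dq k h c) B' := by
  refine ⟨_, (((hc.shift hB (single_two hk h) (norm_single_le h1)).add
    (hc.const_mul (-1))).const_mul h⁻¹ :
    Coef (fun x => h⁻¹ * (c (x + EuclideanSpace.single k h) + -1 * c x)) _).congr fun x => ?_⟩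
  rw [LameHalfSpace.dq]; ring

/-- This is where the decay of the coefficient gradients enters: a quotient falling on a coefficient
absorbs a full factor `ϱ`. -/
theorem Coef.abs_dq_le {c : E3 → ℝ} {B : ℝ} (hc : Coef c B) (hB : 0 ≤ B) {k : Fin 3} (hk : k ≠ 2)
    {h : ℝ} (h0 : h ≠ 0) (h1 : |h| ≤ 1) :
    ∀ᵐ x ∂hsVol, |rho x * LameHalfSpace.dq k h c x| ≤ 2 * B := by
  filter_upwards [hc.abs_sub_le hB (single_two hk h) (norm_single_le h1)] with x hx
  have hr := rho_pos x
  have hh := abs_pos.2 h0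
  rw [PiLp.norm_single, Real.norm_eq_abs] at hx
  rw [LameHalfSpace.dq, abs_mul, abs_mul, abs_inv, abs_of_pos hr]
  calc rho x * (|h|⁻¹ * |c (x + EuclideanSpace.single k h) - c x|)
      ≤ rho x * (|h|⁻¹ * (2 * B * |h| * (rho x)⁻¹)) := by gcongr
    _ = 2 * B := by field_simp

/-- Discrete integration by parts in the energy. -/
theorem energy_dq {lam mu : E3 → ℝ} {B : ℝ} (hl : Coef lam B) (hm : Coef mu B) (hB : 0 ≤ B)
    {k : Fin 3} (hk : k ≠ 2) {h : ℝ} (h1 : |h| ≤ 1)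
    {e s : Fin 3 → Fin 3 → E3 → ℝ}
    (he : ∀ i j, MemLp (e i j) 2 hsVol) (hs : ∀ i j, MemLp (s i j) 2 hsVol) :
    energy lam mu e (fun i j => dq k (-h) (s i j)) =
      - (energy (fun x => lam (x + EuclideanSpace.single k h))
          (fun x => mu (x + EuclideanSpace.single k h)) (fun i j => dq k h (e i j)) s +
        energy (dq k h lam) (dq k h mu) e s) := by
  set a : E3 := EuclideanSpace.single k h with ha
  have ha2 : a 2 = 0 := single_two hk h
  have ha2' : (-a) 2 = 0 := by simp [ha2]
  have ha1 : ‖a‖ ≤ 1 := norm_single_le h1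
  have hla := hl.shift hB ha2 ha1
  have hma := hm.shift hB ha2 ha1
  obtain ⟨B1, hl1⟩ := hl.dq hB hk h1
  obtain ⟨B2, hm2⟩ := hm.dq hB hk h1
  have i0 := integrable_density hl hm he hs
  have i1 := integrable_density hla hma (fun i j => memLp_shift ha2 (he i j)) hs
  have i2 := integrable_density hla hma (fun i j => memLp_dq (h := h) hk (he i j)) hs
  have i3 := integrable_density (hl1.mono (le_max_left B1 B2)) (hm2.mono (le_max_right B1 B2)) he hs
  have hsh : (fun x => density (lam x) (mu x) (fun i j => e i j x) (fun i j => s i j (x + -a))) =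
      fun x => (fun y => density (lam (y + a)) (mu (y + a)) (fun i j => e i j (y + a))
        (fun i j => s i j y)) (x + -a) := by
    ext x; simp
  have i4 : Integrable (fun x => density (lam x) (mu x) (fun i j => e i j x)
      (fun i j => s i j (x + -a))) hsVol := by
    rw [hsh]
    exact (measurePreserving_shift ha2').integrable_comp_of_integrable i1
  have e2 : ∫ x in halfSpace, density (lam x) (mu x) (fun i j => e i j x)
      (fun i j => s i j (x + -a)) = ∫ x in halfSpace, density (lam (x + a)) (mu (x + a))
        (fun i j => e i j (x + a)) (fun i j => s i j x) := by
    rw [hsh]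
    exact integral_shift ha2' fun y => density (lam (y + a)) (mu (y + a))
      (fun i j => e i j (y + a)) (fun i j => s i j y)
  have p1 : ∀ x, density (lam x) (mu x) (fun i j => e i j x) (fun i j => dq k (-h) (s i j) x) =
      h⁻¹ * density (lam x) (mu x) (fun i j => e i j x) (fun i j => s i j x) -
      h⁻¹ * density (lam x) (mu x) (fun i j => e i j x) (fun i j => s i j (x + -a)) := fun x => by
    simp only [dq, single_neg, ← ha, density, Fin.sum_univ_three, inv_neg]; ring
  have p2 : ∀ x, density (lam (x + a)) (mu (x + a)) (fun i j => dq k h (e i j) x)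
      (fun i j => s i j x) + density (dq k h lam x) (dq k h mu x) (fun i j => e i j x)
      (fun i j => s i j x) =
      h⁻¹ * density (lam (x + a)) (mu (x + a)) (fun i j => e i j (x + a)) (fun i j => s i j x) -
      h⁻¹ * density (lam x) (mu x) (fun i j => e i j x) (fun i j => s i j x) := fun x => by
    simp only [dq, ← ha, density, Fin.sum_univ_three]; ring
  unfold energy
  rw [← integral_add i2 i3]
  simp only [p1, p2]
  rw [integral_sub (i0.const_mul _) (i4.const_mul _), integral_sub (i1.const_mul _)
    (i0.const_mul _)]
  simp only [integral_const_mul, e2]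
  ring

theorem nrm_le_sum_sum (G : Fin 3 → Fin 3 → E3 → ℝ) (i j : Fin 3) :
    nrm hsVol (G i j) ≤ ∑ i, ∑ j, nrm hsVol (G i j) :=
  (Finset.single_le_sum (f := fun j => nrm hsVol (G i j)) (fun _ _ => nrm_nonneg _ _)
      (Finset.mem_univ j)).trans
    (Finset.single_le_sum (f := fun i => ∑ j, nrm hsVol (G i j))
      (fun _ _ => Finset.sum_nonneg fun _ _ => nrm_nonneg _ _) (Finset.mem_univ i))

theorem nrm_symPart_le {G : Fin 3 → Fin 3 → E3 → ℝ} (h : ∀ i j, MemLp (G i j) 2 hsVol)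
    (i j : Fin 3) : nrm hsVol (symPart G i j) ≤ (nrm hsVol (G i j) + nrm hsVol (G j i)) / 2 := by
  have e : symPart G i j = fun x => 2⁻¹ * (G i j x + G j i x) := by
    ext x; rw [symPart]; ring
  rw [e, nrm_const_mul, abs_of_pos (by norm_num)]
  have := nrm_add_le (h i j) (h j i)
  linarith

theorem sum_nrm_symPart_le {G : Fin 3 → Fin 3 → E3 → ℝ} (h : ∀ i j, MemLp (G i j) 2 hsVol) :
    ∑ i, ∑ j, nrm hsVol (symPart G i j) ≤ ∑ i, ∑ j, nrm hsVol (G i j) := by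
  refine (Finset.sum_le_sum fun i _ => Finset.sum_le_sum fun j _ => nrm_symPart_le h i j).trans ?_
  simp only [Fin.sum_univ_three]
  exact le_of_eq (by ring)

/-- The quadratic inequality for the weighted difference quotients. -/
theorem weighted_dq_estimate {lam mu : E3 → ℝ} {B α₀ β₀ : ℝ} (hL : Lame lam mu B α₀ β₀)
    {f u : Fin 3 → E3 → ℝ} {G : Fin 3 → Fin 3 → E3 → ℝ} (hu : WeakSol lam mu f u G)
    (hf : ∀ i, MemLp (fun x => rho x * f i x) 2 hsVol)
    {k : Fin 3} (hk : k ≠ 2) {h : ℝ} (h1 : |h| ≤ 1) (h0 : h ≠ 0) {w : E3 → ℝ} (hw : Weight w) :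
    ∃ z, 0 ≤ z ∧ min (2 * α₀) β₀ * z ^ 2 ≤ 2592 *
        (216 * B * (∑ i, ∑ j, nrm hsVol (G i j)) ^ 2 +
          2 * (∑ i, nrm hsVol fun x => rho x * f i x) * (z + 2 * ∑ i, ∑ j, nrm hsVol (G i j)) +
          6 * B * (∑ i, ∑ j, nrm hsVol (G i j)) * (z + 6 * ∑ i, ∑ j, nrm hsVol (G i j))) ∧
      ∀ i j, MemLp (fun x => w x * dq k h (G i j) x) 2 hsVol ∧
        nrm hsVol (fun x => w x * dq k h (G i j) x) ≤ z + 2 * ∑ i, ∑ j, nrm hsVol (G i j) := by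
  set a : E3 := EuclideanSpace.single k h with ha
  obtain ⟨A1, hA1⟩ := hw.bdd
  obtain ⟨A2, hA2⟩ := hw.gbdd
  have h1' : |-h| ≤ 1 := by rwa [abs_neg]
  have hB := hL.posB.le
  set A := ∑ i, ∑ j, nrm hsVol (G i j) with hA
  let U := fun i => dq k h (u i)
  have hU : ∀ i, H1 halfSpace (U i) (fun j => dq k h (G i j)) := fun i => (hu.mem i).dq hk h1
  let GZ := fun i => smulGrad w (U i) (fun j => dq k h (G i j))
  have hZ : ∀ i, H1 halfSpace (fun x => w x * U i x) (GZ i) := fun i =>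
    (hU i).smooth_mul isOpen_halfSpace hw.smooth hA1 hA2
  let GV := fun i => smulGrad w (fun x => w x * U i x) (GZ i)
  have hV : ∀ i, H1 halfSpace (fun x => w x * (w x * U i x)) (GV i) := fun i =>
    (hZ i).smooth_mul isOpen_halfSpace hw.smooth hA1 hA2
  -- The test field is `D_{-h}(w² D_h u)`; the two bounded weights keep it in `H^1_0`.
  have hT := fun i => (hV i).dq (h := -h) hk h1'
  have hUm : ∀ i, MemLp (U i) 2 hsVol ∧ nrm hsVol (U i) ≤ 2 * nrm hsVol (G i k) := fun i => by
    simpa using slowWeight_one.nrm_dq_le (hu.mem i) hk h0 h1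
  -- The part of the gradient of `w U` that falls on the weight: `GZ = w ∇U + Q` and `GV = w (GZ +
  -- Q)`. It is of lower order, since `|∂_j w| ≤ 1` and `D_h u` is bounded in `L²` by `∇u`.
  let Q : Fin 3 → Fin 3 → E3 → ℝ := fun i j x => pderiv j w x * U i x
  have hQle : ∀ i j, ∀ᵐ x ∂hsVol, |Q i j x| ≤ 1 * |U i x| := fun i j =>
    Eventually.of_forall fun x => by
      rw [abs_mul]; exact mul_le_mul_of_nonneg_right (hw.grad j x) (abs_nonneg _)
  have hQ : ∀ i j, MemLp (Q i j) 2 hsVol := fun i j =>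
    memLp_of_le (hUm i).1 ((contDiff_pderiv hw.smooth j).continuous.aestronglyMeasurable.mul
      (hUm i).1.1) (hQle i j)
  have hQn : ∀ i j, nrm hsVol (Q i j) ≤ 2 * nrm hsVol (G i k) := fun i j => by
    refine (nrm_le_const_mul zero_le_one (hUm i).1 (hQle i j)).trans ?_
    rw [one_mul]; exact (hUm i).2
  have hQsum : ∑ i, ∑ j, nrm hsVol (Q i j) ≤ 6 * A := by
    calc ∑ i, ∑ j, nrm hsVol (Q i j) ≤ ∑ i, ∑ _j : Fin 3, 2 * nrm hsVol (G i k) :=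
          Finset.sum_le_sum fun i _ => Finset.sum_le_sum fun j _ => hQn i j
      _ = 6 * ∑ i, nrm hsVol (G i k) := by
          simp only [Finset.sum_const, Finset.card_univ, Fintype.card_fin, Finset.mul_sum]
          refine Finset.sum_congr rfl fun i _ => ?_
          rw [nsmul_eq_mul]; push_cast; ring
      _ ≤ 6 * A := by
          refine mul_le_mul_of_nonneg_left (Finset.sum_le_sum fun i _ => ?_) (by norm_num)
          exact Finset.single_le_sum (f := fun j => nrm hsVol (G i j)) (fun _ _ => nrm_nonneg _ _)
            (Finset.mem_univ k)
  have hGZ := fun i j => (hZ i).gmem j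
  have hGV := fun i j => (hV i).gmem j
  have hGm := fun i j => (hu.mem i).gmem j
  have hGA : ∀ i, nrm hsVol (G i k) ≤ A := fun i => nrm_le_sum_sum G i k
  set z := ∑ i, ∑ j, nrm hsVol (GZ i j) with hz
  have hz0 : 0 ≤ z := Finset.sum_nonneg fun i _ => Finset.sum_nonneg fun j _ => nrm_nonneg _ _
  have hA0 : 0 ≤ A := Finset.sum_nonneg fun i _ => Finset.sum_nonneg fun j _ => nrm_nonneg _ _
  have hLa := hL.shift (single_two hk h) (norm_single_le h1)
  rw [← ha] at hLa
  have hco := coercive hLa hZ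
  have hweak := hu.eq _ _ hT
  have e1 : (symPart fun i j => dq k (-h) (GV i j)) = fun i j => dq k (-h) (symPart GV i j) := by
    ext i j x; simp only [symPart, dq]; ring
  have e2 : (fun i j => dq k h (symPart G i j)) = symPart fun i j => dq k h (G i j) := by
    ext i j x; simp only [symPart, dq]; ring
  rw [e1, energy_dq hL.lamCoef hL.muCoef hB hk h1 (memLp_symPart hGm) (memLp_symPart hGV), e2,
    ← ha] at hweak
  -- One factor `w` moves from `GV` to `∇U`, and `(GZ - Q) : (GZ + Q) = GZ : GZ - Q : Q` because the
  -- form is symmetric. No cross term is left to absorb.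
  have e3 : energy (fun x => lam (x + a)) (fun x => mu (x + a))
      (symPart fun i j => dq k h (G i j)) (symPart GV) =
      energy (fun x => lam (x + a)) (fun x => mu (x + a)) (symPart GZ) (symPart GZ) -
      energy (fun x => lam (x + a)) (fun x => mu (x + a)) (symPart Q) (symPart Q) := by
    unfold energy
    rw [← integral_sub (integrable_density hLa.lamCoef hLa.muCoef (memLp_symPart hGZ)
      (memLp_symPart hGZ)) (integrable_density hLa.lamCoef hLa.muCoef (memLp_symPart hQ)
      (memLp_symPart hQ))]
    congr 1; ext x
    simp only [density, symPart, GV, GZ, Q, smulGrad, Fin.sum_univ_three]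
    ring
  rw [e3] at hweak
  have b1 : |energy (fun x => lam (x + a)) (fun x => mu (x + a)) (symPart Q) (symPart Q)| ≤
      216 * B * A ^ 2 := by
    have hq : ∑ i, ∑ j, nrm hsVol (symPart Q i j) ≤ 6 * A := (sum_nrm_symPart_le hQ).trans hQsum
    have hq0 : 0 ≤ ∑ i, ∑ j, nrm hsVol (symPart Q i j) :=
      Finset.sum_nonneg fun i _ => Finset.sum_nonneg fun j _ => nrm_nonneg _ _
    refine (abs_energy_le hLa.posB.le hLa.lamCoef.aestronglyMeasurable
      hLa.muCoef.aestronglyMeasurable hLa.lamCoef.ae_bdd hLa.muCoef.ae_bdd (memLp_symPart hQ)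
      (memLp_symPart hQ)).trans ?_
    calc _ ≤ 3 * (2 * B) * (6 * A) * (6 * A) := by gcongr
      _ = _ := by ring
  -- The load is paired as `(ϱ f)(ϱ⁻¹ D_{-h}(w²U))`. The slow weight `ϱ⁻¹` reduces the quotient to
  -- `ϱ⁻¹ GV`, where `w/ϱ ≤ 1` leaves only `|GZ| + |U|`.
  have b2 : |∑ i, ∫ x in halfSpace, f i x * dq k (-h) (fun x => w x * (w x * U i x)) x| ≤
      2 * (∑ i, nrm hsVol fun x => rho x * f i x) * (z + 2 * A) := by
    have hi : ∀ i, |∫ x in halfSpace, f i x * dq k (-h) (fun x => w x * (w x * U i x)) x| ≤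
        (nrm hsVol fun x => rho x * f i x) * (2 * (z + 2 * A)) := fun i => by
      have hd := slowWeight_rho_inv.nrm_dq_le (hV i) hk (neg_ne_zero.2 h0) h1'
      have e : ∫ x in halfSpace, f i x * dq k (-h) (fun x => w x * (w x * U i x)) x =
          ∫ x in halfSpace, (rho x * f i x) *
            ((rho x)⁻¹ * dq k (-h) (fun x => w x * (w x * U i x)) x) := by
        congr 1; ext x
        have := (rho_pos x).ne'
        field_simp
      rw [e]
      refine (abs_integral_mul_le (hf i) hd.1).trans ?_
      refine mul_le_mul_of_nonneg_left (hd.2.trans ?_) (nrm_nonneg _ _)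
      refine mul_le_mul_of_nonneg_left ?_ (by norm_num)
      have hle : nrm hsVol (fun x => (rho x)⁻¹ * GV i k x) ≤
          nrm hsVol (fun x => |GZ i k x| + |U i x|) := by
        refine nrm_mono ((hGZ i k).abs.add (hUm i).1.abs) (Eventually.of_forall fun x => ?_)
        have hr := rho_pos x
        have hwr : (rho x)⁻¹ * w x ≤ 1 := by
          rw [inv_mul_le_iff₀ hr, mul_one]; exact hw.le_rho x
        have hwr0 : 0 ≤ (rho x)⁻¹ * w x := mul_nonneg (rho_inv_pos x).le (hw.nonneg x)
        have ee : (rho x)⁻¹ * GV i k x =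
            ((rho x)⁻¹ * w x) * (GZ i k x + pderiv k w x * U i x) := by
          simp only [GV, smulGrad]; ring
        rw [ee, abs_mul, abs_of_nonneg hwr0]
        rw [abs_of_nonneg (by positivity : 0 ≤ |GZ i k x| + |U i x|)]
        refine (mul_le_of_le_one_left (abs_nonneg _) hwr).trans ((abs_add_le _ _).trans ?_)
        rw [abs_mul]
        have := mul_le_of_le_one_left (abs_nonneg (U i x)) (hw.grad k x)
        linarith
      refine hle.trans ((nrm_add_le (hGZ i k).abs (hUm i).1.abs).trans ?_)
      rw [show nrm hsVol |GZ i k| = nrm hsVol (GZ i k) from nrm_abs _,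
        show nrm hsVol |U i| = nrm hsVol (U i) from nrm_abs _]
      have := nrm_le_sum_sum GZ i k
      have := (hUm i).2
      have := hGA i
      linarith
    refine (Finset.abs_sum_le_sum_abs _ _).trans ((Finset.sum_le_sum fun i _ => hi i).trans ?_)
    rw [← Finset.sum_mul]
    exact le_of_eq (by ring)
  -- The commutator with the coefficients. Splitting `1 = ϱ · ϱ⁻¹`, the factor `ϱ` goes to `D_h λ`,
  -- `D_h μ`, and `ϱ⁻¹` cancels the outer `w` in `GV`; the result is linear in `z`.
  have b3 : |energy (dq k h lam) (dq k h mu) (symPart G) (symPart GV)| ≤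
      6 * B * A * (z + 6 * A) := by
    have e : energy (dq k h lam) (dq k h mu) (symPart G) (symPart GV) =
        energy (fun x => rho x * dq k h lam x) (fun x => rho x * dq k h mu x) (symPart G)
          (fun i j x => (rho x)⁻¹ * symPart GV i j x) := by
      unfold energy density
      congr 1; ext x
      simp only [Fin.sum_univ_three]
      have := (rho_pos x).ne'
      field_simp
    have hS : ∀ i j, ∀ᵐ x ∂hsVol, |(rho x)⁻¹ * symPart GV i j x| ≤
        1 * |symPart GZ i j x + symPart Q i j x| := fun i j => Eventually.of_forall fun x => by
      have hr := rho_pos x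
      have hwr : (rho x)⁻¹ * w x ≤ 1 := by
        rw [inv_mul_le_iff₀ hr, mul_one]; exact hw.le_rho x
      have hwr0 : 0 ≤ (rho x)⁻¹ * w x := mul_nonneg (rho_inv_pos x).le (hw.nonneg x)
      have ee : (rho x)⁻¹ * symPart GV i j x =
          ((rho x)⁻¹ * w x) * (symPart GZ i j x + symPart Q i j x) := by
        simp only [symPart, GV, Q, smulGrad]; ring
      rw [ee, abs_mul, abs_of_nonneg hwr0]
      exact mul_le_mul_of_nonneg_right hwr (abs_nonneg _)
    have hSm0 := fun i j => (memLp_symPart hGZ i j).add (memLp_symPart hQ i j)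
    have hSm : ∀ i j, MemLp (fun x => (rho x)⁻¹ * symPart GV i j x) 2 hsVol := fun i j =>
      memLp_of_le (hSm0 i j) (continuous_rho_inv.aestronglyMeasurable.mul
        (memLp_symPart hGV i j).1) (hS i j)
    have hsum : ∑ i, ∑ j, nrm hsVol (fun x => (rho x)⁻¹ * symPart GV i j x) ≤ z + 6 * A := by
      calc _ ≤ ∑ i, ∑ j, (nrm hsVol (symPart GZ i j) + nrm hsVol (symPart Q i j)) := by
            refine Finset.sum_le_sum fun i _ => Finset.sum_le_sum fun j _ => ?_
            refine (nrm_le_const_mul zero_le_one (hSm0 i j) (hS i j)).trans ?_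
            rw [one_mul]
            exact nrm_add_le (memLp_symPart hGZ i j) (memLp_symPart hQ i j)
        _ = (∑ i, ∑ j, nrm hsVol (symPart GZ i j)) + ∑ i, ∑ j, nrm hsVol (symPart Q i j) := by
            simp only [Finset.sum_add_distrib]
        _ ≤ _ := add_le_add (sum_nrm_symPart_le hGZ) ((sum_nrm_symPart_le hQ).trans hQsum)
    obtain ⟨B1, hl1⟩ := hL.lamCoef.dq hB hk h1
    obtain ⟨B2, hm2⟩ := hL.muCoef.dq hB hk h1
    rw [e]
    refine (abs_energy_le (by positivity : 0 ≤ 2 * B)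
      (continuous_rho.aestronglyMeasurable.mul hl1.aestronglyMeasurable)
      (continuous_rho.aestronglyMeasurable.mul hm2.aestronglyMeasurable)
      (hL.lamCoef.abs_dq_le hB hk h0 h1) (hL.muCoef.abs_dq_le hB hk h0 h1)
      (memLp_symPart hGm) hSm).trans ?_
    have hs0 : 0 ≤ ∑ i, ∑ j, nrm hsVol (fun x => (rho x)⁻¹ * symPart GV i j x) :=
      Finset.sum_nonneg fun i _ => Finset.sum_nonneg fun j _ => nrm_nonneg _ _
    have hg := sum_nrm_symPart_le hGm
    rw [← hA] at hg
    calc _ ≤ 3 * (2 * B) * A * (z + 6 * A) := by gcongr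
      _ = _ := by ring
  refine ⟨z, hz0, hco.trans (mul_le_mul_of_nonneg_left ?_ (by norm_num)), fun i j => ?_⟩
  · have := le_abs_self (energy (fun x => lam (x + a)) (fun x => mu (x + a)) (symPart Q)
      (symPart Q))
    have := le_abs_self
      (∑ i, ∫ x in halfSpace, f i x * dq k (-h) (fun x => w x * (w x * U i x)) x)
    have := neg_abs_le (energy (dq k h lam) (dq k h mu) (symPart G) (symPart GV))
    linarith
  · have e : (fun x => w x * dq k h (G i j) x) = fun x => GZ i j x - Q i j x := by
      ext x; simp only [GZ, Q, smulGrad]; ring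
    rw [e]
    refine ⟨(hGZ i j).sub (hQ i j), (nrm_sub_le (hGZ i j) (hQ i j)).trans ?_⟩
    have := nrm_le_sum_sum GZ i j
    have := hQn i j
    have := hGA i
    linarith

/-- Uniform weighted bounds for the difference quotients. -/
def DqBound (k : Fin 3) (g : E3 → ℝ) (R : ℝ) : Prop :=
  ∀ h : ℝ, 0 < h → h ≤ 1 → MemLp (fun x => rho x * dq k h g x) 2 hsVol ∧
    nrm hsVol (fun x => rho x * dq k h g x) ≤ R

section DqBound
variable {k : Fin 3} {g g' : E3 → ℝ} {R R' : ℝ}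

theorem DqBound.mono (hg : DqBound k g R) (h : R ≤ R') : DqBound k g R' :=
  fun t h0 h1 => ⟨(hg t h0 h1).1, (hg t h0 h1).2.trans h⟩

theorem DqBound.add (hg : DqBound k g R) (hg' : DqBound k g' R') :
    DqBound k (fun x => g x + g' x) (R + R') := by
  intro t h0 h1
  have e : (fun x => rho x * dq k t (fun x => g x + g' x) x) =
      fun x => rho x * dq k t g x + rho x * dq k t g' x := by
    ext x; simp only [dq]; ring
  rw [e]
  exact ⟨(hg t h0 h1).1.add (hg' t h0 h1).1, (nrm_add_le (hg t h0 h1).1 (hg' t h0 h1).1).trans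
    (add_le_add (hg t h0 h1).2 (hg' t h0 h1).2)⟩

theorem DqBound.const_mul (hg : DqBound k g R) (c : ℝ) :
    DqBound k (fun x => c * g x) (|c| * R) := by
  intro t h0 h1
  have e : (fun x => rho x * dq k t (fun x => c * g x) x) =
      fun x => c * (rho x * dq k t g x) := by
    ext x; simp only [dq]; ring
  rw [e, nrm_const_mul]
  exact ⟨(hg t h0 h1).1.const_mul c, mul_le_mul_of_nonneg_left (hg t h0 h1).2 (abs_nonneg _)⟩

/-- Discrete Leibniz rule: one term has the bounded shifted coefficient times `ϱ D_h g`, the other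
the bounded function `ϱ D_h c` times `g`. -/
theorem DqBound.coef_mul (hg : DqBound k g R) (hm : MemLp g 2 hsVol) {c : E3 → ℝ} {B : ℝ}
    (hB : 0 ≤ B) (hc : Coef c B) (hk : k ≠ 2) :
    DqBound k (fun x => c x * g x) (2 * B * (R + nrm hsVol g)) := by
  intro t h0 h1
  have ht : |t| ≤ 1 := by rwa [abs_of_pos h0]
  have hca := hc.shift hB (single_two hk t) (norm_single_le ht)
  obtain ⟨B1, hc1⟩ := hc.dq hB hk ht
  have e : (fun x => rho x * dq k t (fun x => c x * g x) x) =
      fun x => c (x + EuclideanSpace.single k t) * (rho x * dq k t g x) +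
        (rho x * dq k t c x) * g x := by
    ext x; simp only [dq]; ring
  have l1 : ∀ᵐ x ∂hsVol, |c (x + EuclideanSpace.single k t) * (rho x * dq k t g x)| ≤
      2 * B * |rho x * dq k t g x| := by
    filter_upwards [hca.ae_bdd] with x hx
    rw [abs_mul]; gcongr
  have l2 : ∀ᵐ x ∂hsVol, |(rho x * dq k t c x) * g x| ≤ 2 * B * |g x| := by
    filter_upwards [hc.abs_dq_le hB hk h0.ne' ht] with x hx
    rw [abs_mul]; gcongr
  have m1 : MemLp (fun x => c (x + EuclideanSpace.single k t) * (rho x * dq k t g x)) 2 hsVol :=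
    memLp_of_le (hg t h0 h1).1 (hca.aestronglyMeasurable.mul (hg t h0 h1).1.1) l1
  have m2 : MemLp (fun x => (rho x * dq k t c x) * g x) 2 hsVol := memLp_of_le hm ((continuous_rho.aestronglyMeasurable.mul
    hc1.aestronglyMeasurable).mul hm.1) l2
  rw [e]
  refine ⟨m1.add m2, (nrm_add_le m1 m2).trans ?_⟩
  have n1 := nrm_le_const_mul (by positivity) (hg t h0 h1).1 l1
  have n2 := nrm_le_const_mul (by positivity) hm l2
  have n3 := mul_le_mul_of_nonneg_left (hg t h0 h1).2 (by positivity : 0 ≤ 2 * B)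
  linarith

end DqBound

/-- Tangential difference quotients of the gradient of a weak solution. -/
theorem exists_dqBound (B α₀ β₀ : ℝ) : ∃ C, 0 ≤ C ∧ ∀ lam mu : E3 → ℝ, Lame lam mu B α₀ β₀ →
    ∀ (f u : Fin 3 → E3 → ℝ) (G : Fin 3 → Fin 3 → E3 → ℝ), WeakSol lam mu f u G →
    (∀ i, MemLp (fun x => rho x * f i x) 2 hsVol) → ∀ k : Fin 3, k ≠ 2 → ∀ i j,
      DqBound k (G i j) (C * ∑ i, nrm hsVol fun x => rho x * f i x) := by
  -- `D` is the constant of `WeakSol.bound`; `p` and `q` collect the terms of `weighted_dq_estimate`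
  -- that are linear in `z` and free of `z`. Absolute values in the final constant make it
  -- nonnegative before the signs of the parameters are known.
  let c := min (2 * α₀) β₀
  let D := 10368 / c
  let p := 2592 * (2 + 6 * B * D)
  let q := 2592 * (216 * B * D ^ 2 + 4 * D + 36 * B * D ^ 2)
  refine ⟨|(p + q) / c| + 1 + 2 * |D|, by positivity, ?_⟩
  intro lam mu hL f u G hu hf k hk i j h h0 h1
  have hc : 0 < c := lt_min (by linarith [hL.posα]) hL.posβ
  have hB := hL.posB
  have hD : 0 < D := by positivity
  have hh : |h| ≤ 1 := by rwa [abs_of_pos h0]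
  have hA := hu.bound hL hf
  have hF : 0 ≤ ∑ i, nrm hsVol fun x => rho x * f i x :=
    Finset.sum_nonneg fun i _ => nrm_nonneg _ _
  have hA0 : 0 ≤ ∑ i, ∑ j, nrm hsVol (G i j) :=
    Finset.sum_nonneg fun i _ => Finset.sum_nonneg fun j _ => nrm_nonneg _ _
  have key : ∀ n : ℕ, MemLp (fun x => weight n x * dq k h (G i j) x) 2 hsVol ∧
      nrm hsVol (fun x => weight n x * dq k h (G i j) x) ≤
        (|(p + q) / c| + 1 + 2 * |D|) * ∑ i, nrm hsVol fun x => rho x * f i x := by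
    intro n
    obtain ⟨z, hz0, hz, hr⟩ := weighted_dq_estimate hL hu hf hk hh h0.ne' (weight_isWeight n)
    refine ⟨(hr i j).1, (hr i j).2.trans ?_⟩
    change _ ≤ D * _ at hA
    change c * _ ≤ _ at hz
    generalize ∑ i, ∑ j, nrm hsVol (G i j) = A at *
    generalize (∑ i, nrm hsVol fun x => rho x * f i x) = F at *
    have hq : 0 ≤ q := by positivity
    have hp : 0 ≤ p := by positivity
    have h2 : c * z ^ 2 ≤ p * z * F + q * F ^ 2 := by
      refine hz.trans ?_
      calc _ ≤ 2592 * (216 * B * (D * F) ^ 2 + 2 * F * (z + 2 * (D * F)) +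
            6 * B * (D * F) * (z + 6 * (D * F))) := by gcongr
        _ = _ := by simp only [p, q]; ring
    -- From `c z² ≤ p z F + q F²`: either `z ≤ F`, or `q F² ≤ q F z` and one divides by `z`.
    have h3 : z ≤ ((p + q) / c + 1) * F := by
      rcases le_total z F with hzF | hzF
      · have : 0 ≤ (p + q) / c * F := by positivity
        linarith
      · rcases hz0.eq_or_lt with hz1 | hz1
        · rw [← hz1]; positivity
        · have h4 : c * z ^ 2 ≤ (p + q) * F * z := by
            have : q * F ^ 2 ≤ q * F * z := by
              rw [sq, ← mul_assoc]; gcongr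
            linarith
          have h5 : c * z ≤ (p + q) * F := by
            refine le_of_mul_le_mul_right ?_ hz1
            linarith [h4, (by ring : c * z ^ 2 = c * z * z)]
          have h6 : z ≤ (p + q) / c * F := by
            rw [div_mul_eq_mul_div, le_div_iff₀ hc]; linarith
          linarith
    rw [abs_of_pos hD, abs_of_nonneg (by positivity)]
    linarith
  -- The bound is uniform in `n`, so Fatou's lemma replaces `weight n` by its limit `ϱ`.
  exact memLp_of_tendsto_ae (fun n => (key n).1) (fun n => (key n).2)
    (Eventually.of_forall fun x => (tendsto_weight x).mul_const _)

/-! ### Functions with weighted first derivatives -/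

/-- The weak derivative `∂_l g` exists and `‖ϱ ∂_l g‖ ≤ R`. -/
def WD (l : Fin 3) (g : E3 → ℝ) (R : ℝ) : Prop :=
  ∃ g', IsWeakDeriv halfSpace (idx l) g g' ∧ MemLp (fun x => rho x * g' x) 2 hsVol ∧
    nrm hsVol (fun x => rho x * g' x) ≤ R

/-- Quantitative membership in `H^1_1`. -/
structure W1 (g : E3 → ℝ) (R : ℝ) : Prop where
  mem : MemLp g 2 hsVol
  le : nrm hsVol g ≤ R
  wd : ∀ l, WD l g R

section W1
variable {g g' : E3 → ℝ} {R R' : ℝ}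

theorem WD.mono {l : Fin 3} (h : WD l g R) (hR : R ≤ R') : WD l g R' := by
  obtain ⟨d, h1, h2, h3⟩ := h
  exact ⟨d, h1, h2, h3.trans hR⟩

theorem W1.mono (h : W1 g R) (hR : R ≤ R') : W1 g R' :=
  ⟨h.mem, h.le.trans hR, fun l => (h.wd l).mono hR⟩

theorem W1.congr (h : W1 g R) (he : g =ᵐ[hsVol] g') : W1 g' R := by
  refine ⟨h.mem.ae_eq he, (nrm_congr he).symm.trans_le h.le, fun l => ?_⟩
  obtain ⟨d, h1, h2, h3⟩ := h.wd l
  exact ⟨d, h1.congr he (ae_eq_refl d), h2, h3⟩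

theorem W1.add (h : W1 g R) (h' : W1 g' R') : W1 (fun x => g x + g' x) (R + R') := by
  refine ⟨h.mem.add h'.mem, (nrm_add_le h.mem h'.mem).trans (add_le_add h.le h'.le), fun l => ?_⟩
  obtain ⟨d, h1, h2, h3⟩ := h.wd l
  obtain ⟨d', h1', h2', h3'⟩ := h'.wd l
  refine ⟨_, h1.add h1', ?_, ?_⟩
  · simp only [mul_add]; exact h2.add h2'
  · simp only [mul_add]; exact (nrm_add_le h2 h2').trans (add_le_add h3 h3')

theorem W1.const_mul (h : W1 g R) (c : ℝ) : W1 (fun x => c * g x) (|c| * R) := by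
  refine ⟨h.mem.const_mul c, ?_, fun l => ?_⟩
  · rw [nrm_const_mul]; exact mul_le_mul_of_nonneg_left h.le (abs_nonneg _)
  obtain ⟨d, h1, h2, h3⟩ := h.wd l
  have e : (fun x => rho x * (c * d x)) = fun x => c * (rho x * d x) := by ext x; ring
  refine ⟨_, h1.const_mul c, ?_, ?_⟩
  · rw [e]; exact h2.const_mul c
  · rw [e, nrm_const_mul]; exact mul_le_mul_of_nonneg_left h3 (abs_nonneg _)

theorem W1.sub (h : W1 g R) (h' : W1 g' R') : W1 (fun x => g x - g' x) (R + R') := by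
  have := h.add (h'.const_mul (-1))
  rw [abs_neg, abs_one, one_mul] at this
  simpa [sub_eq_add_neg] using this

theorem memLp_of_rho_mul (h : MemLp (fun x => rho x * g x) 2 hsVol) : MemLp g 2 hsVol := by
  have := slowWeight_rho_inv.memLp_mul h
  refine this.ae_eq (Eventually.of_forall fun x => ?_)
  rw [← mul_assoc, inv_mul_cancel₀ (rho_pos x).ne', one_mul]

theorem W1.exists_H1 (h : W1 g R) : ∃ D : Fin 3 → E3 → ℝ, H1 halfSpace g D ∧
    ∀ l, MemLp (fun x => rho x * D l x) 2 hsVol ∧ nrm hsVol (fun x => rho x * D l x) ≤ R := by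
  choose D h1 h2 h3 using h.wd
  exact ⟨D, ⟨h1, slowWeight_rho_inv.memLp_mul h.mem, fun l => memLp_of_rho_mul (h2 l)⟩,
    fun l => ⟨h2 l, h3 l⟩⟩

/-- Coefficients act on `H^1_1` because `ϱ ∂_l c` is bounded; this is what permits solving for the
normal derivatives algebraically. -/
theorem W1.coef_mul (h : W1 g R) {c : E3 → ℝ} {B : ℝ} (hB : 0 ≤ B) (hc : Coef c B) :
    W1 (fun x => c x * g x) (2 * B * R) := by
  have hR : 0 ≤ R := (nrm_nonneg _ _).trans h.le
  have l0 : ∀ {p : E3 → ℝ}, ∀ᵐ x ∂hsVol, |c x * p x| ≤ B * |p x| := by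
    intro p
    filter_upwards [hc.ae_bdd] with x hx
    rw [abs_mul]; gcongr
  refine ⟨memLp_of_le h.mem (hc.aestronglyMeasurable.mul h.mem.1) l0,
    (nrm_le_const_mul hB h.mem l0).trans ?_, fun l => ?_⟩
  · have := mul_le_mul_of_nonneg_left h.le hB
    nlinarith [mul_nonneg hB hR]
  obtain ⟨D, hD, hD'⟩ := h.exists_H1
  have e : (fun x => rho x * smulGrad c g D l x) =
      fun x => c x * (rho x * D l x) + (rho x * pderiv l c x) * g x := by
    ext x; simp only [smulGrad]; ring
  have l2 : ∀ᵐ x ∂hsVol, |(rho x * pderiv l c x) * g x| ≤ B * |g x| := by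
    filter_upwards [hc.abs_pderiv_le l] with x hx
    have hr := rho_pos x
    rw [abs_mul, abs_mul, abs_of_pos hr]
    refine mul_le_mul_of_nonneg_right ?_ (abs_nonneg _)
    calc rho x * |pderiv l c x| ≤ rho x * (B * (rho x)⁻¹) := by gcongr
      _ = B := by field_simp
  have m1 : MemLp (fun x => c x * (rho x * D l x)) 2 hsVol :=
    memLp_of_le (hD' l).1 (hc.aestronglyMeasurable.mul (hD' l).1.1) l0
  have m2 : MemLp (fun x => (rho x * pderiv l c x) * g x) 2 hsVol :=
    memLp_of_le h.mem ((continuous_rho.aestronglyMeasurable.mul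
      (measurable_pderiv c l).aestronglyMeasurable).mul h.mem.1) l2
  refine ⟨_, (hD.coef_mul hc).deriv l, ?_, ?_⟩
  · rw [e]; exact m1.add m2
  · rw [e]
    refine (nrm_add_le m1 m2).trans ?_
    have n1 := nrm_le_const_mul hB (hD' l).1 (l0 (p := fun x => rho x * D l x))
    have n2 := nrm_le_const_mul hB h.mem l2
    have n3 := mul_le_mul_of_nonneg_left h.le hB
    have n4 := mul_le_mul_of_nonneg_left (hD' l).2 hB
    linarith

end W1

/-! ### The stress -/

/-- The entries of the stress, in terms of the gradient. -/
def sig (lam mu : E3 → ℝ) (G : Fin 3 → Fin 3 → E3 → ℝ) (i j : Fin 3) (x : E3) : ℝ :=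
  (if i = j then lam x * (symPart G 0 0 x + symPart G 1 1 x + symPart G 2 2 x) else 0) +
    2 * (mu x * symPart G i j x)

section Stress
variable {lam mu : E3 → ℝ} {B α₀ β₀ : ℝ} {f u : Fin 3 → E3 → ℝ} {G : Fin 3 → Fin 3 → E3 → ℝ}

/-- The stress is symmetric, so it does not see the antisymmetric part of `F`; the weak form can be
tested with gradients instead of strains. -/
theorem density_symPart (G F : Fin 3 → Fin 3 → E3 → ℝ) (x : E3) :
    density (lam x) (mu x) (fun i j => symPart G i j x) (fun i j => symPart F i j x) =
      ∑ i, ∑ j, sig lam mu G i j x * F i j x := by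
  simp [density, sig, symPart, Fin.sum_univ_three]; ring

theorem memLp_trace {e : Fin 3 → E3 → ℝ} (he : ∀ i, MemLp (e i) 2 hsVol) {R : ℝ}
    (hR : ∀ i, nrm hsVol (e i) ≤ R) : MemLp (fun x => e 0 x + e 1 x + e 2 x) 2 hsVol ∧
      nrm hsVol (fun x => e 0 x + e 1 x + e 2 x) ≤ 3 * R := by
  have h01 : MemLp (fun x => e 0 x + e 1 x) 2 hsVol := (he 0).add (he 1)
  refine ⟨h01.add (he 2), ?_⟩
  have a1 := nrm_add_le h01 (he 2)
  have a2 := nrm_add_le (he 0) (he 1)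
  linarith [hR 0, hR 1, hR 2]

theorem nrm_symPart_le_of {R : ℝ} (hm : ∀ i j, MemLp (G i j) 2 hsVol)
    (h : ∀ i j, nrm hsVol (G i j) ≤ R) (i j : Fin 3) : nrm hsVol (symPart G i j) ≤ R :=
  (nrm_symPart_le hm i j).trans (by linarith [h i j, h j i])

theorem memLp_coef_mul {c g : E3 → ℝ} (hc : Coef c B) (hg : MemLp g 2 hsVol) :
    MemLp (fun x => c x * g x) 2 hsVol := by
  refine memLp_of_le hg (hc.aestronglyMeasurable.mul hg.1) (c := B) ?_
  filter_upwards [hc.ae_bdd] with x hx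
  rw [abs_mul]; gcongr

theorem nrm_coef_mul_le {c g : E3 → ℝ} (hB : 0 ≤ B) (hc : Coef c B) (hg : MemLp g 2 hsVol) :
    nrm hsVol (fun x => c x * g x) ≤ B * nrm hsVol g := by
  refine nrm_le_const_mul hB hg ?_
  filter_upwards [hc.ae_bdd] with x hx
  rw [abs_mul]; gcongr

theorem memLp_sig (hl : Coef lam B) (hm : Coef mu B) (hG : ∀ i j, MemLp (G i j) 2 hsVol)
    (i j : Fin 3) : MemLp (sig lam mu G i j) 2 hsVol := by
  have hs := memLp_symPart hG
  have h2 := (memLp_coef_mul hm (hs i j)).const_mul 2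
  unfold sig
  by_cases hij : i = j
  · simp only [hij, if_true] at h2 ⊢
    exact (memLp_coef_mul hl (((hs 0 0).add (hs 1 1)).add (hs 2 2))).add h2
  · simpa only [hij, if_false, zero_add] using h2

theorem nrm_sig_le (hB : 0 ≤ B) (hl : Coef lam B) (hm : Coef mu B)
    (hG : ∀ i j, MemLp (G i j) 2 hsVol) {R : ℝ} (hR : ∀ i j, nrm hsVol (G i j) ≤ R)
    (i j : Fin 3) : nrm hsVol (sig lam mu G i j) ≤ 5 * B * R := by
  have hs := memLp_symPart hG
  have hn := nrm_symPart_le_of hG hR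
  have hR0 : 0 ≤ R := (nrm_nonneg _ _).trans (hR 0 0)
  have h2 := (memLp_coef_mul hm (hs i j)).const_mul 2
  have n2 : nrm hsVol (fun x => 2 * (mu x * symPart G i j x)) ≤ 2 * (B * R) := by
    rw [nrm_const_mul, abs_two]
    have := (nrm_coef_mul_le hB hm (hs i j)).trans (mul_le_mul_of_nonneg_left (hn i j) hB)
    linarith
  unfold sig
  by_cases hij : i = j
  · simp only [hij, if_true] at h2 n2 ⊢
    obtain ⟨m1, n1⟩ := memLp_trace (fun k => hs k k) (fun k => hn k k)
    have n3 := (nrm_coef_mul_le hB hl m1).trans (mul_le_mul_of_nonneg_left n1 hB)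
    refine (nrm_add_le (memLp_coef_mul hl m1) h2).trans ?_
    linarith
  · simp only [hij, if_false, zero_add]
    nlinarith [mul_nonneg hB hR0]

theorem DqBound.symPart {k : Fin 3} {R : ℝ} (h : ∀ i j, DqBound k (G i j) R) (i j : Fin 3) :
    DqBound k (symPart G i j) R := by
  have h1 := ((h i j).add (h j i)).const_mul 2⁻¹
  have e : (fun x => (2:ℝ)⁻¹ * (G i j x + G j i x)) = LameHalfSpace.symPart G i j := by
    ext x; rw [LameHalfSpace.symPart]; ring
  rw [e] at h1
  refine h1.mono ?_
  rw [abs_of_pos (by norm_num)]; linarith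

theorem DqBound.sig {k : Fin 3} (hk : k ≠ 2) {R : ℝ} (hB : 0 ≤ B) (hl : Coef lam B)
    (hm : Coef mu B) (hG : ∀ i j, MemLp (G i j) 2 hsVol) (hR : ∀ i j, nrm hsVol (G i j) ≤ R)
    (h : ∀ i j, DqBound k (G i j) R) (i j : Fin 3) :
    DqBound k (sig lam mu G i j) (20 * B * R) := by
  have hs := memLp_symPart hG
  have hn := nrm_symPart_le_of hG hR
  have hd := DqBound.symPart h
  have hR0 : 0 ≤ R := (nrm_nonneg _ _).trans (hR 0 0)
  have h2 : DqBound k (fun x => 2 * (mu x * LameHalfSpace.symPart G i j x)) (8 * B * R) := by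
    refine (((hd i j).coef_mul (hs i j) hB hm hk).const_mul 2).mono ?_
    rw [abs_two]
    nlinarith [mul_le_mul_of_nonneg_left (hn i j) hB]
  unfold LameHalfSpace.sig
  by_cases hij : i = j
  · simp only [hij, if_true] at h2 ⊢
    obtain ⟨m1, n1⟩ := memLp_trace (fun k => hs k k) (fun k => hn k k)
    refine (((((hd 0 0).add (hd 1 1)).add (hd 2 2)).coef_mul m1 hB hl hk).add h2).mono ?_
    nlinarith [mul_le_mul_of_nonneg_left n1 hB]
  · simp only [hij, if_false, zero_add]
    exact h2.mono (by nlinarith [mul_nonneg hB hR0])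

theorem W1.sig {R : ℝ} (hB : 0 ≤ B) (hl : Coef lam B) (hm : Coef mu B)
    (h : ∀ i j, W1 (G i j) R) (i j : Fin 3) : ∃ R', W1 (sig lam mu G i j) R' := by
  have hs : ∀ i j, ∃ R', W1 (symPart G i j) R' := fun i j => by
    have h1 := ((h i j).add (h j i)).const_mul 2⁻¹
    have e : (fun x => (2:ℝ)⁻¹ * (G i j x + G j i x)) = symPart G i j := by
      ext x; rw [symPart]; ring
    rw [e] at h1
    exact ⟨_, h1⟩
  choose S hS using hs
  have h2 := ((hS i j).coef_mul hB hm).const_mul 2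
  unfold LameHalfSpace.sig
  by_cases hij : i = j
  · simp only [hij, if_true] at h2 ⊢
    exact ⟨_, ((((hS 0 0).add (hS 1 1)).add (hS 2 2)).coef_mul hB hl).add h2⟩
  · simp only [hij, if_false, zero_add]
    exact ⟨_, h2⟩

/-- The weak formulation tested with a smooth function in one component. -/
theorem WeakSol.test (h : WeakSol lam mu f u G) (hl : Coef lam B) (hm : Coef mu B)
    {φ : E3 → ℝ} (hφ : ContDiff ℝ ∞ φ) (hc : HasCompactSupport φ) (i : Fin 3) :
    ∑ j, ∫ x in halfSpace, sig lam mu G i j x * pderiv j φ x =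
      - ∫ x in halfSpace, f i x * φ x := by
  have hs := memLp_sig hl hm fun i j => (h.mem i).gmem j
  have hv : ∀ i', H1 halfSpace (fun x => (if i' = i then 1 else 0) * φ x)
      (fun j x => (if i' = i then 1 else 0) * pderiv j φ x) := fun i' =>
    (H1.smooth hφ hc).const_mul _
  have h1 := h.eq _ _ hv
  unfold energy at h1
  simp only [density_symPart] at h1
  have e1 : ∀ x, ∑ i', ∑ j, sig lam mu G i' j x * ((if i' = i then 1 else 0) * pderiv j φ x) =
      ∑ j, sig lam mu G i j x * pderiv j φ x := fun x => by
    rw [Finset.sum_eq_single i (fun b _ hb => by simp [hb]) (by simp)]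
    simp
  have e2 : ∑ i', ∫ x in halfSpace, f i' x * ((if i' = i then 1 else 0) * φ x) =
      ∫ x in halfSpace, f i x * φ x := by
    rw [Finset.sum_eq_single i (fun b _ hb => by simp [hb]) (by simp)]
    simp
  rw [e2] at h1
  rw [← h1, ← integral_finsetSum _ fun j _ => integrable_mul (hs i j) (memLp_pderiv hφ hc j)]
  simp only [e1]

/-- The normal derivative of the traction, from the equation. -/
theorem WeakSol.normal_deriv (h : WeakSol lam mu f u G) (hl : Coef lam B) (hm : Coef mu B)
    (hf : ∀ i, MemLp (f i) 2 hsVol) (i : Fin 3) {d0 d1 : E3 → ℝ}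
    (h0 : IsWeakDeriv halfSpace (idx 0) (sig lam mu G i 0) d0)
    (h1 : IsWeakDeriv halfSpace (idx 1) (sig lam mu G i 1) d1)
    (m0 : MemLp d0 2 hsVol) (m1 : MemLp d1 2 hsVol) :
    IsWeakDeriv halfSpace (idx 2) (sig lam mu G i 2) (fun x => f i x - (d0 x + d1 x)) := by
  have hs := memLp_sig hl hm fun i j => (h.mem i).gmem j
  refine isWeakDeriv_idx.2 ⟨(hs i 2).locInt, ((hf i).sub (m0.add m1)).locInt, fun φ hφ => ?_⟩
  have hφ2 := memLp_test hφ
  have e := h.test hl hm hφ.1 hφ.2.1 i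
  rw [Fin.sum_univ_three, (isWeakDeriv_idx.1 h0).2.2 φ hφ, (isWeakDeriv_idx.1 h1).2.2 φ hφ] at e
  have e2 : ∫ x in halfSpace, (f i x - (d0 x + d1 x)) * φ x = (∫ x in halfSpace, f i x * φ x) -
      ((∫ x in halfSpace, d0 x * φ x) + ∫ x in halfSpace, d1 x * φ x) := by
    have i01 : Integrable (fun x => d0 x * φ x + d1 x * φ x) hsVol :=
      (integrable_mul m0 hφ2).add (integrable_mul m1 hφ2)
    rw [← integral_add (integrable_mul m0 hφ2) (integrable_mul m1 hφ2),
      ← integral_sub (integrable_mul (hf i) hφ2) i01]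
    congr 1; ext x; ring
  rw [e2]; linarith

end Stress

/-! ### Regularity -/

theorem Lame.inv_mu {lam mu : E3 → ℝ} {B α₀ β₀ : ℝ} (h : Lame lam mu B α₀ β₀) :
    Coef (fun x => (mu x)⁻¹) (α₀⁻¹ + 3 * B / α₀ ^ 2) := by
  have hB := h.posB
  refine (h.muCoef.inv h.posα h.lower).mono ?_
  gcongr; linarith

/-- `3(λ + 2μ) = (3λ + 2μ) + 4μ ≥ β₀ + 4α₀`. The shared constant with `3 * B` serves for `1/μ` as
well. -/
theorem Lame.inv_lam_mu {lam mu : E3 → ℝ} {B α₀ β₀ : ℝ} (h : Lame lam mu B α₀ β₀) :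
    Coef (fun x => (lam x + 2 * mu x)⁻¹) (α₀⁻¹ + 3 * B / α₀ ^ 2) ∧
      ∀ x ∈ halfSpace, α₀ ≤ lam x + 2 * mu x := by
  have hlow : ∀ x ∈ halfSpace, α₀ ≤ lam x + 2 * mu x := fun x hx => by
    linarith [h.lower x hx, h.lower' x hx, h.posα, h.posβ]
  refine ⟨Coef.inv ((h.lamCoef.add (h.muCoef.const_mul 2)).mono ?_) h.posα hlow, hlow⟩
  rw [abs_two]; linarith

/-- Second derivatives of weak solutions. -/
theorem exists_regularity (B α₀ β₀ : ℝ) : ∃ C, 0 ≤ C ∧ ∀ lam mu : E3 → ℝ, Lame lam mu B α₀ β₀ →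
    ∀ (f u : Fin 3 → E3 → ℝ) (G : Fin 3 → Fin 3 → E3 → ℝ), WeakSol lam mu f u G →
    (∀ i, MemLp (fun x => rho x * f i x) 2 hsVol) → ∀ i j,
      W1 (G i j) (C * ∑ i, nrm hsVol fun x => rho x * f i x) := by
  obtain ⟨C0, hC0, H⟩ := exists_dqBound B α₀ β₀
  let C1 := C0 + |10368 / min (2 * α₀) β₀|
  have hC1 : 0 ≤ C1 := by positivity
  let B1 := α₀⁻¹ + 3 * B / α₀ ^ 2
  refine ⟨|C1 + 2 * B1 * (1 + 40 * B * C1 + 4 * B * C1)|, abs_nonneg _, ?_⟩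
  intro lam mu hL f u G hu hf
  have hB := hL.posB
  have hα := hL.posα
  have hB1 : 0 ≤ B1 := by positivity
  have hl := hL.lamCoef
  have hm := hL.muCoef
  have hF0 : ∀ i, nrm hsVol (fun x => rho x * f i x) ≤ ∑ i, nrm hsVol fun x => rho x * f i x :=
    fun i => Finset.single_le_sum (f := fun i => nrm hsVol fun x => rho x * f i x)
      (fun _ _ => nrm_nonneg _ _) (Finset.mem_univ i)
  have hdq := H lam mu hL f u G hu hf
  have hA := hu.bound hL hf
  have hG : ∀ i j, MemLp (G i j) 2 hsVol := fun i j => (hu.mem i).gmem j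
  have hF : 0 ≤ ∑ i, nrm hsVol fun x => rho x * f i x :=
    Finset.sum_nonneg fun i _ => nrm_nonneg _ _
  generalize (∑ i, nrm hsVol fun x => rho x * f i x) = F at *
  obtain ⟨R, hR⟩ : ∃ R, R = C1 * F := ⟨_, rfl⟩
  have hR0 : 0 ≤ R := by rw [hR]; positivity
  have hGR : ∀ i j, nrm hsVol (G i j) ≤ R := fun i j => by
    refine (nrm_le_sum_sum G i j).trans (hA.trans ?_)
    rw [hR]
    refine mul_le_mul_of_nonneg_right ?_ hF
    have := le_abs_self (10368 / min (2 * α₀) β₀)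
    simp only [C1]; linarith
  have hdqR : ∀ k : Fin 3, k ≠ 2 → ∀ i j, DqBound k (G i j) R := fun k hk i j => by
    refine (hdq k hk i j).mono ?_
    rw [hR]
    refine mul_le_mul_of_nonneg_right ?_ hF
    have := abs_nonneg (10368 / min (2 * α₀) β₀)
    simp only [C1]; linarith
  have htan : ∀ k : Fin 3, k ≠ 2 → ∀ i j, WD k (G i j) R := fun k hk i j =>
    exists_weakDeriv_of_dq_bound hk (hG i j) (hdqR k hk i j)
  -- For a tangential column the missing normal derivative `∂₂ (G i k)` equals the tangential
  -- derivative `∂_k (G i 2)`, which the difference quotients already control.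
  have hW : ∀ k : Fin 3, k ≠ 2 → ∀ i, W1 (G i k) R := by
    intro k hk i
    refine ⟨hG i k, hGR i k, fun l => ?_⟩
    by_cases hl2 : l = 2
    · obtain ⟨d, h1, h2, h3⟩ := htan k hk i 2
      have hc := ((hu.mem i).deriv 2).comp h1
      rw [add_comm] at hc
      rw [hl2]
      exact ⟨d, ((hu.mem i).deriv k).of_comp hc, h2, h3⟩
    · exact htan l hl2 i k
  have hsm := memLp_sig hl hm hG
  have hst : ∀ k : Fin 3, k ≠ 2 → ∀ i j, WD k (sig lam mu G i j) (20 * B * R) := fun k hk i j =>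
    exists_weakDeriv_of_dq_bound hk (hsm i j) (DqBound.sig hk hB.le hl hm hG hGR (hdqR k hk) i j)
  have hf2 : ∀ i, MemLp (f i) 2 hsVol := fun i => memLp_of_rho_mul (hf i)
  have hBR : 0 ≤ B * R := by positivity
  -- The equation gives the normal derivative of the traction as `f i` minus two tangential
  -- derivatives, each bounded by `20 * B * R`.
  have hS : ∀ i, W1 (sig lam mu G i 2) (F + 40 * B * R) := by
    intro i
    refine ⟨hsm i 2, (nrm_sig_le hB.le hl hm hG hGR i 2).trans (by linarith), fun l => ?_⟩
    by_cases hl2 : l = 2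
    · obtain ⟨d0, a0, b0, c0⟩ := hst 0 (by decide) i 0
      obtain ⟨d1, a1, b1, c1⟩ := hst 1 (by decide) i 1
      have hd := hu.normal_deriv hl hm hf2 i a0 a1 (memLp_of_rho_mul b0) (memLp_of_rho_mul b1)
      rw [hl2]
      have e : (fun x => rho x * (f i x - (d0 x + d1 x))) =
          fun x => rho x * f i x - (rho x * d0 x + rho x * d1 x) := by ext x; ring
      refine ⟨_, hd, ?_, ?_⟩
      · rw [e]; exact (hf i).sub (b0.add b1)
      · rw [e]
        have n1 := nrm_sub_le (hf i) (b0.add b1)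
        have n2 := nrm_add_le b0 b1
        simp only [Pi.add_apply] at n1
        have := hF0 i
        refine n1.trans ?_
        change _ + nrm hsVol (fun x => rho x * d0 x + rho x * d1 x) ≤ _
        linarith
    · exact (hst l hl2 i 2).mono (by linarith)
  obtain ⟨hinv, hpos⟩ := hL.inv_lam_mu
  have hfin : C1 * F + 2 * B1 * (1 + 40 * B * C1 + 4 * B * C1) * F =
      R + 2 * B1 * (F + 40 * B * R + 4 * B * R) := by rw [hR]; ring
  have hle : R + 2 * B1 * (F + 40 * B * R + 4 * B * R) ≤
      |C1 + 2 * B1 * (1 + 40 * B * C1 + 4 * B * C1)| * F := by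
    rw [← hfin, ← add_mul]
    exact mul_le_mul_of_nonneg_right (le_abs_self _) hF
  have hK : 0 ≤ B1 * (F + 40 * B * R) := mul_nonneg hB1 (by linarith)
  have hK' : 0 ≤ B1 * (B * R) := mul_nonneg hB1 hBR
  -- For tangential `k`, `σ_{k2} = μ (G k 2 + G 2 k)`, hence `G k 2 = σ_{k2}/μ - G 2 k`.
  have hmix : ∀ k : Fin 3, k ≠ 2 → W1 (G k 2) (2 * B1 * (F + 40 * B * R) + R) := by
    intro k hk
    refine (((hS k).coef_mul hB1 hL.inv_mu).sub (hW k hk 2)).congr ?_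
    filter_upwards [ae_restrict_mem measurableSet_halfSpace] with x hx
    have : mu x ≠ 0 := (hα.trans_le (hL.lower x hx)).ne'
    simp only [sig, symPart, hk, if_false]
    field_simp; ring
  intro i j
  by_cases hj : j = 2
  · rw [hj]
    by_cases hi : i = 2
    · rw [hi]
      -- The last entry: `G 2 2 = (σ_{22} - λ (G 0 0 + G 1 1))/(λ + 2μ)`.
      have h1 := (((hW 0 (by decide) 0).add (hW 1 (by decide) 1)).coef_mul hB.le hl)
      have h2 := ((hS 2).sub h1).coef_mul hB1 hinv
      refine (h2.congr ?_).mono (le_trans ?_ hle)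
      · filter_upwards [ae_restrict_mem measurableSet_halfSpace] with x hx
        have : lam x + 2 * mu x ≠ 0 := (hα.trans_le (hpos x hx)).ne'
        simp only [sig, symPart, if_true]
        field_simp; ring
      · linarith
    · exact (hmix i hi).mono (le_trans (by linarith) hle)
  · exact (hW j hj i).mono (le_trans (by linarith) hle)

/-! ### The spaces `H^2_1`, `H^1_1`, `H^0_1` -/

theorem memH_zero_one {f : E3 → ℝ} (h : MemH 0 1 halfSpace f) :
    MemLp (fun x => rho x * f x) 2 hsVol ∧
      normSqH 0 1 halfSpace f = nrm hsVol (fun x => rho x * f x) ^ 2 := by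
  obtain ⟨g, hg, hm⟩ := h 0 (by simp [mlen])
  have he : f =ᵐ[hsVol] g := (isWeakDeriv_zero_idx hg.1).unique isOpen_halfSpace hg
  have hw : weakDeriv halfSpace 0 f =ᵐ[hsVol] f :=
    (isWeakDeriv_zero_idx hg.1).weakDeriv_ae isOpen_halfSpace
  constructor
  · refine hm.ae_eq ?_
    filter_upwards [he] with x hx
    simp [mlen, hx]
  · have hp : Finset.piAntidiag (Finset.univ : Finset (Fin 3)) 0 = {0} :=
      Finset.piAntidiag_zero _
    rw [normSqH, Finset.sum_range_one, hp, Finset.sum_singleton]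
    congr 1
    refine nrm_congr ?_
    filter_upwards [hw] with x hx
    simp [mlen, hx]

theorem W1.memH {g : E3 → ℝ} {R : ℝ} (h : W1 g R) : MemH 1 1 halfSpace g := by
  intro κ hκ
  have hl : LocallyIntegrableOn g halfSpace := h.mem.locInt
  have h0 : mlen κ = 0 → κ = 0 := fun h => by
    ext i; simpa using (Finset.sum_eq_zero_iff.1 h) i (Finset.mem_univ i)
  rcases multiindex_cases (hκ.trans one_le_two) with rfl | ⟨j, rfl⟩ | ⟨j, k, rfl⟩
  · exact ⟨g, isWeakDeriv_zero_idx hl, by simpa [mlen] using h.mem⟩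
  · obtain ⟨d, h1, h2, -⟩ := h.wd j
    exact ⟨d, h1, by simpa [mlen_idx] using h2⟩
  · rw [mlen_idx_add] at hκ; omega

theorem exists_weakDeriv_two {u : E3 → ℝ} {G : Fin 3 → E3 → ℝ} (h : H1 halfSpace u G) {R : ℝ}
    (hG : ∀ j, W1 (G j) R) (hR : nrm hsVol (fun x => (rho x)⁻¹ * u x) ≤ R)
    {κ : Fin 3 → ℕ} (hκ : mlen κ ≤ 2) : ∃ g, IsWeakDeriv halfSpace κ u g ∧
      MemLp (fun x => rho x ^ ((1:ℝ) - (2:ℕ) + mlen κ) * g x) 2 hsVol ∧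
      nrm hsVol (fun x => rho x ^ ((1:ℝ) - (2:ℕ) + mlen κ) * g x) ≤ R := by
  rcases multiindex_cases hκ with rfl | ⟨j, rfl⟩ | ⟨j, k, rfl⟩
  · have e : (fun x => rho x ^ ((1:ℝ) - (2:ℕ) + mlen 0) * u x) = fun x => (rho x)⁻¹ * u x := by
      ext x
      rw [← Real.rpow_neg_one]
      norm_num [mlen]
    exact ⟨u, isWeakDeriv_zero_idx (h.deriv 0).1, by rw [e]; exact h.mem, by rw [e]; exact hR⟩
  · have e : (fun x => rho x ^ ((1:ℝ) - (2:ℕ) + mlen (idx j)) * G j x) = G j := by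
      ext x; rw [mlen_idx]; norm_num
    exact ⟨G j, h.deriv j, by rw [e]; exact (hG j).mem, by rw [e]; exact (hG j).le⟩
  · obtain ⟨d, h1, h2, h3⟩ := (hG j).wd k
    have e : (fun x => rho x ^ ((1:ℝ) - (2:ℕ) + mlen (idx j + idx k)) * d x) =
        fun x => rho x * d x := by
      ext x; rw [mlen_idx_add]; norm_num
    exact ⟨d, (h.deriv j).comp h1, by rw [e]; exact h2, by rw [e]; exact h3⟩

/-- Every term of the norm is at most `R²`, so the factor is the number of multi-indices of length
at most two. -/
theorem memH_two_of_W1 {u : E3 → ℝ} {G : Fin 3 → E3 → ℝ} (h : H1 halfSpace u G) {R : ℝ}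
    (hG : ∀ j, W1 (G j) R) (hR : nrm hsVol (fun x => (rho x)⁻¹ * u x) ≤ R) :
    MemH 2 1 halfSpace u ∧ normSqH 2 1 halfSpace u ≤
      (∑ k ∈ Finset.range 3, (Finset.piAntidiag (Finset.univ : Finset (Fin 3)) k).card : ℕ) *
        R ^ 2 := by
  constructor
  · intro κ hκ
    obtain ⟨g, h1, h2, -⟩ := exists_weakDeriv_two h hG hR hκ
    exact ⟨g, h1, h2⟩
  · rw [normSqH, Nat.cast_sum, Finset.sum_mul]
    refine Finset.sum_le_sum fun k hk => ?_
    rw [← nsmul_eq_mul]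
    refine Finset.sum_le_card_nsmul _ _ _ fun κ hκ => ?_
    have hκ2 : mlen κ ≤ 2 := by
      have h1 := (Finset.mem_piAntidiag.1 hκ).1
      have h2 := Finset.mem_range.1 hk
      exact h1.le.trans (by omega)
    obtain ⟨g, h1, h2, h3⟩ := exists_weakDeriv_two h hG hR hκ2
    have e : nrm hsVol (fun x => rho x ^ ((1:ℝ) - (2:ℕ) + mlen κ) * weakDeriv halfSpace κ u x) ≤
        R := by
      refine (nrm_congr ?_).trans_le h3
      filter_upwards [h1.weakDeriv_ae isOpen_halfSpace] with x hx
      rw [hx]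
    exact pow_le_pow_left₀ (nrm_nonneg _ _) e 2

theorem exists_W1_of_memH_two {u : E3 → ℝ} (h : MemH 2 1 halfSpace u) :
    ∃ G : Fin 3 → E3 → ℝ, H1 halfSpace u G ∧ ∀ j, ∃ R, W1 (G j) R := by
  obtain ⟨g0, hg0, hm0⟩ := h 0 (by simp [mlen])
  choose G hG hGm using fun j : Fin 3 => h (idx j) (by simp [mlen_idx])
  choose D hD hDm using fun j k : Fin 3 => h (idx j + idx k) (by simp [mlen_idx_add])
  have hGm' : ∀ j, MemLp (G j) 2 hsVol := fun j => by
    have e : (fun x => rho x ^ ((1:ℝ) - (2:ℕ) + mlen (idx j)) * G j x) = G j := by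
      ext x; rw [mlen_idx]; norm_num
    have := hGm j
    rwa [e] at this
  refine ⟨G, ⟨hG, ?_, hGm'⟩, fun j => ?_⟩
  · have he : u =ᵐ[hsVol] g0 := (isWeakDeriv_zero_idx hg0.1).unique isOpen_halfSpace hg0
    refine hm0.ae_eq ?_
    filter_upwards [he] with x hx
    rw [hx, ← Real.rpow_neg_one]
    norm_num [mlen]
  · have hDm' : ∀ k, MemLp (fun x => rho x * D j k x) 2 hsVol := fun k => by
      have e : (fun x => rho x ^ ((1:ℝ) - (2:ℕ) + mlen (idx j + idx k)) * D j k x) =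
          fun x => rho x * D j k x := by
        ext x; rw [mlen_idx_add]; norm_num
      have := hDm j k
      rwa [e] at this
    refine ⟨nrm hsVol (G j) + ∑ k, nrm hsVol (fun x => rho x * D j k x), hGm' j, ?_, fun k =>
      ⟨D j k, (hG j).of_comp (hD j k), hDm' k, ?_⟩⟩
    · have : 0 ≤ ∑ k, nrm hsVol (fun x => rho x * D j k x) :=
        Finset.sum_nonneg fun _ _ => nrm_nonneg _ _
      linarith
    · have := Finset.single_le_sum (f := fun k => nrm hsVol (fun x => rho x * D j k x))
        (fun _ _ => nrm_nonneg _ _) (Finset.mem_univ k)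
      have := nrm_nonneg hsVol (G j)
      linarith

/-! ### Weak and strong solutions -/

section Solutions
variable {lam mu : E3 → ℝ} {B α₀ β₀ : ℝ} {f u : E3 → E3} {G : Fin 3 → Fin 3 → E3 → ℝ}

theorem strain_ae (hu : ∀ i, H1 halfSpace (fun x => u x i) (G i)) :
    ∀ᵐ x ∂hsVol, ∀ i j, strain u x i j = symPart G i j x := by
  have : ∀ᵐ x ∂hsVol, ∀ i j, weakDeriv halfSpace (idx j) (fun y => u y i) x = G i j x :=
    ae_all_iff.2 fun i => ae_all_iff.2 fun j => ((hu i).deriv j).weakDeriv_ae isOpen_halfSpace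
  filter_upwards [this] with x hx i j
  simp only [strain, Matrix.of_apply, hx, symPart]

theorem stress_ae (hu : ∀ i, H1 halfSpace (fun x => u x i) (G i)) :
    ∀ᵐ x ∂hsVol, ∀ i j, stress lam mu u x i j = sig lam mu G i j x := by
  filter_upwards [strain_ae hu] with x hx i j
  simp only [stress, elasticity, sig, Matrix.add_apply, Matrix.smul_apply, Matrix.one_apply,
    Matrix.trace, Matrix.diag_apply, hx, Fin.sum_univ_three, smul_eq_mul]
  split_ifs <;> ring

theorem memHVec_one_zero {v : E3 → E3} :
    MemHVec 1 0 halfSpace v ↔ ∃ F : Fin 3 → Fin 3 → E3 → ℝ,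
      ∀ i, H1 halfSpace (fun x => v x i) (F i) := by
  simp only [MemHVec, memH_one_zero isOpen_halfSpace]
  exact ⟨fun h => ⟨fun i => (h i).choose, fun i => (h i).choose_spec⟩,
    fun ⟨F, hF⟩ i => ⟨F i, hF i⟩⟩

theorem integral_load_eq (hf : ∀ i, MemLp (fun x => rho x * f x i) 2 hsVol) {v : E3 → E3}
    {F : Fin 3 → Fin 3 → E3 → ℝ} (hv : ∀ i, H1 halfSpace (fun x => v x i) (F i)) :
    ∫ x in halfSpace, ∑ i, f x i * v x i = ∑ i, ∫ x in halfSpace, f x i * v x i := by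
  refine integral_finsetSum _ fun i _ => ?_
  refine (integrable_mul (hf i) (hv i).mem).congr (Eventually.of_forall fun x => ?_)
  have := (rho_pos x).ne'
  field_simp

theorem integral_stress_strain {v : E3 → E3} {F : Fin 3 → Fin 3 → E3 → ℝ}
    (hu : ∀ i, H1 halfSpace (fun x => u x i) (G i))
    (hv : ∀ i, H1 halfSpace (fun x => v x i) (F i)) :
    ∫ x in halfSpace, ∑ i, ∑ j, stress lam mu u x i j * strain v x i j =
      energy lam mu (symPart G) (symPart F) := by
  refine integral_congr_ae ?_
  filter_upwards [stress_ae (lam := lam) (mu := mu) hu, strain_ae hv] with x h1 h2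
  simp [h1, h2, density, sig, Fin.sum_univ_three]
  ring

theorem isWeakSolution_iff (hf : ∀ i, MemLp (fun x => rho x * f x i) 2 hsVol) :
    IsWeakSolution lam mu f u ↔ ∃ G, WeakSol lam mu (fun i x => f x i) (fun i x => u x i) G := by
  constructor
  · rintro ⟨hm, he⟩
    obtain ⟨G, hG⟩ := memHVec_one_zero.1 hm
    refine ⟨G, hG, fun v F hv => ?_⟩
    have hv' : ∀ i, H1 halfSpace (fun x => (WithLp.toLp 2 fun i => v i x : E3) i) (F i) := hv
    have h1 := he (fun x => WithLp.toLp 2 fun i => v i x) (memHVec_one_zero.2 ⟨F, hv'⟩)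
    rw [integral_stress_strain hG hv', integral_load_eq hf hv'] at h1
    exact h1
  · rintro ⟨G, hG⟩
    refine ⟨memHVec_one_zero.2 ⟨G, hG.mem⟩, fun v hv => ?_⟩
    obtain ⟨F, hF⟩ := memHVec_one_zero.1 hv
    rw [integral_stress_strain hG.mem hF, integral_load_eq hf hF]
    exact hG.eq _ _ hF

/-- A strong solution is a weak solution. -/
theorem IsStrongSolution.weakSol (hl : Coef lam B) (hm : Coef mu B) (hB : 0 ≤ B)
    (hf : ∀ i, MemLp (fun x => rho x * f x i) 2 hsVol) (h : IsStrongSolution lam mu f u) :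
    ∃ G, WeakSol lam mu (fun i x => f x i) (fun i x => u x i) G := by
  obtain ⟨h2, ⟨d, hd, hdf⟩, htr⟩ := h
  choose G hG hW using fun i => exists_W1_of_memH_two (h2 i)
  choose R hW using hW
  have hW' : ∀ i j, W1 (G i j) (∑ i, ∑ j, R i j) := fun i j => (hW i j).mono <| by
    have hR : ∀ i j, 0 ≤ R i j := fun i j => (nrm_nonneg _ _).trans (hW i j).le
    exact (Finset.single_le_sum (f := fun j => R i j) (fun j _ => hR i j)
      (Finset.mem_univ j)).trans (Finset.single_le_sum (f := fun i => ∑ j, R i j)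
        (fun i _ => Finset.sum_nonneg fun j _ => hR i j) (Finset.mem_univ i))
  choose R' hS using fun i j => W1.sig hB hl hm hW' i j
  have hsm := fun i j => (hS i j).mem
  have hae : ∀ i j, (fun x => stress lam mu u x i j) =ᵐ[hsVol] sig lam mu G i j := fun i j =>
    (stress_ae hG).mono fun x hx => hx i j
  have hd' : ∀ i j, IsWeakDeriv halfSpace (idx j) (sig lam mu G i j) (d i j) := fun i j =>
    (hd i j).congr (hae i j) (ae_eq_refl _)
  have hdm : ∀ i j, MemLp (d i j) 2 hsVol := fun i j => by
    obtain ⟨d', h1, h2, -⟩ := (hS i j).wd j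
    exact (memLp_of_rho_mul h2).ae_eq (h1.unique isOpen_halfSpace (hd' i j))
  have hli : ∀ {g : E3 → ℝ}, MemLp g 2 hsVol → LocallyIntegrable g hsVol := fun hg =>
    hg.locallyIntegrable (by norm_num)
  -- Green's formula for smooth `φ`, with no condition at the boundary: the tangential integrations
  -- leave no boundary term, and the normal one leaves the trace of the traction, which is zero.
  have htest : ∀ i φ, ContDiff ℝ ∞ φ → HasCompactSupport φ →
      ∑ j, ∫ x in halfSpace, sig lam mu G i j x * pderiv j φ x =
        - ∫ x in halfSpace, f x i * φ x := by
    intro i φ hφ hc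
    have hφ2 : MemLp φ 2 hsVol := hφ.continuous.memLp_of_hasCompactSupport hc
    have t := fun k (hk : k ≠ 2) => integral_mul_pderiv_tangential hk (hd' i k) (hli (hsm i k))
      (hli (hdm i k)) hφ hc
    have n1 := (htr i).2.2 φ hφ hc
    have n2 : ∫ x in halfSpace, (stress lam mu u x i 2 * pderiv 2 φ x +
        weakDeriv halfSpace (idx 2) (fun x => stress lam mu u x i 2) x * φ x) =
        (∫ x in halfSpace, sig lam mu G i 2 x * pderiv 2 φ x) +
          ∫ x in halfSpace, d i 2 x * φ x := by
      rw [← integral_add (integrable_mul (hsm i 2) (memLp_pderiv hφ hc 2))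
        (integrable_mul (hdm i 2) hφ2)]
      refine integral_congr_ae ?_
      filter_upwards [hae i 2, (hd i 2).weakDeriv_ae isOpen_halfSpace] with x h1 h2
      simp only [h1, h2]
    rw [n2] at n1
    simp only [Pi.zero_apply, zero_mul, integral_zero] at n1
    have n3 : ∫ x in halfSpace, f x i * φ x = ∑ j, ∫ x in halfSpace, d i j x * φ x := by
      rw [← integral_finsetSum _ fun j _ => integrable_mul (hdm i j) hφ2]
      refine integral_congr_ae ?_
      filter_upwards [hdf i] with x hx
      rw [← hx, Finset.sum_mul]
    rw [n3, Fin.sum_univ_three, Fin.sum_univ_three, t 0 (by decide), t 1 (by decide)]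
    linarith
  refine ⟨G, hG, fun v F hv => ?_⟩
  have e1 : energy lam mu (symPart G) (symPart F) =
      ∑ i, ∑ j, ∫ x in halfSpace, sig lam mu G i j x * F i j x := by
    have hi := fun i j => integrable_mul (hsm i j) ((hv i).gmem j)
    unfold energy
    simp only [density_symPart]
    rw [integral_finsetSum _ fun i _ => integrable_finsetSum _ fun j _ => hi i j]
    exact Finset.sum_congr rfl fun i _ => integral_finsetSum _ fun j _ => hi i j
  rw [e1, ← Finset.sum_neg_distrib]
  refine Finset.sum_congr rfl fun i _ => ?_
  -- Density extends the identity to all of `H^1_0`: the stress is paired with converging gradients,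
  -- and `ϱ f` with converging `φ n / ϱ`.
  obtain ⟨φ, hφ⟩ := (hv i).exists_approx
  have l1 : Tendsto (fun n => ∑ j, ∫ x in halfSpace, sig lam mu G i j x * pderiv j (φ n) x) atTop
      (𝓝 (∑ j, ∫ x in halfSpace, sig lam mu G i j x * F i j x)) :=
    tendsto_finsetSum _ fun j _ => tendsto_integral_mul
      (fun n => memLp_pderiv (hφ.smooth n) (hφ.compact n) j) ((hv i).gmem j) (hsm i j) (hφ.glim j)
  have hlim : Tendsto (fun n => nrm hsVol (fun x => (rho x)⁻¹ * φ n x - (rho x)⁻¹ * v i x)) atTop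
      (𝓝 0) := by simpa only [mul_sub] using hφ.lim
  have l2 := tendsto_integral_mul
    (fun n => memLp_rho_inv_mul (μ := hsVol) (hφ.smooth n) (hφ.compact n)) (hv i).mem (hf i) hlim
  have e2 : ∀ p : E3 → ℝ, ∫ x in halfSpace, (rho x * f x i) * ((rho x)⁻¹ * p x) =
      ∫ x in halfSpace, f x i * p x := fun p => by
    congr 1; ext x
    have := (rho_pos x).ne'
    field_simp
  simp only [e2] at l2
  have l3 := l1.congr fun n => htest i _ (hφ.smooth n) (hφ.compact n)
  exact tendsto_nhds_unique l3 l2.neg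

/-- A weak solution with weighted second derivatives is a strong solution. -/
theorem WeakSol.isStrongSolution (hl : Coef lam B) (hm : Coef mu B) (hB : 0 ≤ B)
    (hf : ∀ i, MemLp (fun x => rho x * f x i) 2 hsVol)
    (h : WeakSol lam mu (fun i x => f x i) (fun i x => u x i) G) {R : ℝ}
    (hW : ∀ i j, W1 (G i j) R) : IsStrongSolution lam mu f u := by
  have hG := h.mem
  choose R' hS using fun i j => W1.sig hB hl hm hW i j
  choose d hd hdm _ using fun i j => (hS i j).wd j
  have hsm := fun i j => (hS i j).mem
  have hae : ∀ i j, sig lam mu G i j =ᵐ[hsVol] fun x => stress lam mu u x i j := fun i j =>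
    (stress_ae hG).mono fun x hx => (hx i j).symm
  have hd' : ∀ i j, IsWeakDeriv halfSpace (idx j) (fun x => stress lam mu u x i j) (d i j) :=
    fun i j => (hd i j).congr (hae i j) (ae_eq_refl _)
  have hd2 : ∀ i j, MemLp (d i j) 2 hsVol := fun i j => memLp_of_rho_mul (hdm i j)
  have hf2 : ∀ i, MemLp (fun x => f x i) 2 hsVol := fun i => memLp_of_rho_mul (hf i)
  have hsum : ∀ i, ∀ᵐ x ∂hsVol, ∑ j, d i j x = f x i := fun i => by
    have h1 := h.normal_deriv hl hm hf2 i (hd i 0) (hd i 1) (hd2 i 0) (hd2 i 1)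
    filter_upwards [(hd i 2).unique isOpen_halfSpace h1] with x hx
    rw [Fin.sum_univ_three, hx]; ring
  have hli : ∀ {g : E3 → ℝ}, MemLp g 2 hsVol → LocallyIntegrable g hsVol := fun hg =>
    hg.locallyIntegrable (by norm_num)
  refine ⟨fun i => ?_, ⟨d, hd', hsum⟩, fun i => ⟨((hS i 2).congr (hae i 2)).memH,
    locallyIntegrable_zero, fun φ hφ hc => ?_⟩⟩
  · refine (memH_two_of_W1 (hG i) (R := max R (nrm hsVol fun x => (rho x)⁻¹ * u x i))
      (fun j => (hW i j).mono (le_max_left _ _)) (le_max_right _ _)).1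
  · have hφ2 : MemLp φ 2 hsVol := hφ.continuous.memLp_of_hasCompactSupport hc
    have t := fun k (hk : k ≠ 2) => integral_mul_pderiv_tangential hk (hd i k) (hli (hsm i k))
      (hli (hd2 i k)) hφ hc
    have n2 : ∫ x in halfSpace, (stress lam mu u x i 2 * pderiv 2 φ x +
        weakDeriv halfSpace (idx 2) (fun x => stress lam mu u x i 2) x * φ x) =
        (∫ x in halfSpace, sig lam mu G i 2 x * pderiv 2 φ x) +
          ∫ x in halfSpace, d i 2 x * φ x := by
      rw [← integral_add (integrable_mul (hsm i 2) (memLp_pderiv hφ hc 2))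
        (integrable_mul (hd2 i 2) hφ2)]
      refine integral_congr_ae ?_
      filter_upwards [hae i 2, (hd' i 2).weakDeriv_ae isOpen_halfSpace] with x h1 h2
      simp only [← h1, h2]
    have n3 : ∫ x in halfSpace, f x i * φ x = ∑ j, ∫ x in halfSpace, d i j x * φ x := by
      rw [← integral_finsetSum _ fun j _ => integrable_mul (hd2 i j) hφ2]
      refine integral_congr_ae ?_
      filter_upwards [hsum i] with x hx
      rw [← hx, Finset.sum_mul]
    -- Here `φ` need not vanish on the boundary. Subtracting the equation in the interior from the
    -- weak form leaves exactly the boundary integral of the traction, so the trace is zero.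
    have ht := h.test hl hm hφ hc i
    rw [n3, Fin.sum_univ_three, Fin.sum_univ_three, t 0 (by decide), t 1 (by decide)] at ht
    rw [n2]
    simp only [Pi.zero_apply, zero_mul, integral_zero]
    linarith

end Solutions

/-! ### The coefficients -/

/-- By continuity the set where the bound fails is open, so it has positive measure as soon as it is
nonempty. -/
theorem abs_le_of_eLpNorm_top_le {g : E3 → ℝ} (hg : IsLip g) {M : ℝ} (hM : 0 ≤ M)
    (h : eLpNorm g ⊤ hsVol ≤ ENNReal.ofReal M) : ∀ x ∈ halfSpace, |g x| ≤ M := by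
  intro x hx
  by_contra! hcon
  obtain ⟨L, hL⟩ := hg
  have hopen : IsOpen (halfSpace ∩ g ⁻¹' {t | M < |t|}) :=
    hL.continuousOn.isOpen_inter_preimage isOpen_halfSpace
      (isOpen_lt continuous_const continuous_abs)
  have hpos := hopen.measure_pos volume ⟨x, hx, hcon⟩
  have hae : ∀ᵐ y ∂hsVol, |g y| ≤ M := by
    rw [eLpNorm_exponent_top] at h
    filter_upwards [enorm_ae_le_eLpNormEssSup g hsVol] with y hy
    have := hy.trans h
    rw [Real.enorm_eq_ofReal_abs] at this
    exact (ENNReal.ofReal_le_ofReal_iff hM).1 this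
  rw [ae_restrict_iff' measurableSet_halfSpace] at hae
  refine hpos.ne' (measure_mono_null (t := {y | ¬ (y ∈ halfSpace → |g y| ≤ M)}) ?_
    (ae_iff.1 hae))
  exact fun y hy hcon' => absurd (hcon' hy.1) (not_le.2 hy.2)

theorem coef_of_normC01_le {g : E3 → ℝ} (hg : IsLip g) {M K : ℝ} (hM : 0 ≤ M)
    (h : normC01 g ≤ ENNReal.ofReal M) (hK : ∀ᵐ x ∂hsVol, ‖fderiv ℝ g x‖ ≤ K / rho x) :
    Coef g (max M K) := by
  refine ⟨hg, fun x hx => (abs_le_of_eLpNorm_top_le hg hM (le_self_add.trans h) x hx).trans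
    (le_max_left _ _), hK.mono fun x hx => hx.trans ?_⟩
  have := rho_pos x
  gcongr
  exact le_max_right _ _

end LameHalfSpace

end

/-! ### Existence, uniqueness and the a priori estimate for the original problem -/

theorem mainTheorem6 (M K α₀ β₀ : ℝ) (hM : 0 < M) (hK : 0 < K) (hα : 0 < α₀) (hβ : 0 < β₀) :
    ∃ C : ℝ, 0 < C ∧ ∀ lam mu : E3 → ℝ,
      IsLip lam → IsLip mu →
      normC01 mu + normC01 lam ≤ ENNReal.ofReal M →
      (∀ᵐ x ∂(volume.restrict halfSpace), ‖fderiv ℝ lam x‖ ≤ K / rho x) →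
      (∀ᵐ x ∂(volume.restrict halfSpace), ‖fderiv ℝ mu x‖ ≤ K / rho x) →
      (∀ x ∈ halfSpace, α₀ ≤ mu x) →
      (∀ x ∈ halfSpace, β₀ ≤ 3 * lam x + 2 * mu x) →
      ∀ f : E3 → E3, MemHVec 0 1 halfSpace f →
        ∃ u : E3 → E3,
          IsStrongSolution lam mu f u ∧
          IsWeakSolution lam mu f u ∧
          normHVec 2 1 halfSpace u ≤ C * normHVec 0 1 halfSpace f ∧
          (∀ w, IsStrongSolution lam mu f w → w =ᵐ[volume.restrict halfSpace] u) ∧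
          (∀ w, IsWeakSolution lam mu f w → w =ᵐ[volume.restrict halfSpace] u) := by
  obtain ⟨C, hC, H⟩ := exists_regularity (max M K) α₀ β₀
  obtain ⟨N, hN⟩ : ∃ N : ℕ, N =
    ∑ k ∈ Finset.range 3, (Finset.piAntidiag (Finset.univ : Finset (Fin 3)) k).card := ⟨_, rfl⟩
  -- Hardy's constant 4 over three derivatives gives `12 C` as a bound for all terms of the norm.
  -- With `N` multi-indices and three components, `√(3N) ≤ 3N + 1`. The further 3 compares the sum
  -- of the component norms of `f` with its norm, and the added 1 keeps the constant positive.
  refine ⟨(3 * (N:ℝ) + 1) * (12 * C * 3) + 1, by positivity, ?_⟩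
  intro lam mu hlam hmu hnorm hKl hKm hlow hlow' f hf
  have hB : 0 < max M K := lt_max_of_lt_left hM
  have hL : Lame lam mu (max M K) α₀ β₀ :=
    ⟨coef_of_normC01_le hlam hM.le (le_add_self.trans hnorm) hKl,
      coef_of_normC01_le hmu hM.le (le_self_add.trans hnorm) hKm, hα, hβ, hB, hlow, hlow'⟩
  have hf1 : ∀ i, MemLp (fun x => rho x * f x i) 2 hsVol := fun i => (memH_zero_one (hf i)).1
  have hfn : normHVec 0 1 halfSpace f =
      Real.sqrt (∑ i, nrm hsVol (fun x => rho x * f x i) ^ 2) := by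
    unfold normHVec
    congr 1
    exact Finset.sum_congr rfl fun i _ => (memH_zero_one (hf i)).2
  have hF : ∑ i, nrm hsVol (fun x => rho x * f x i) ≤ 3 * normHVec 0 1 halfSpace f := by
    have h1 : ∀ i, nrm hsVol (fun x => rho x * f x i) ≤ normHVec 0 1 halfSpace f := fun i => by
      rw [hfn]
      refine Real.le_sqrt_of_sq_le ?_
      exact Finset.single_le_sum (f := fun i => nrm hsVol (fun x => rho x * f x i) ^ 2)
        (fun _ _ => sq_nonneg _) (Finset.mem_univ i)
    refine (Finset.sum_le_sum fun i _ => h1 i).trans ?_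
    simp
  obtain ⟨v, G, hv⟩ := exists_weakSol hL hf1
  have hW := H lam mu hL _ v G hv hf1
  generalize hFdef : (∑ i, nrm hsVol fun x => rho x * f x i) = F at *
  have hF0 : 0 ≤ F := by
    rw [← hFdef]; exact Finset.sum_nonneg fun i _ => nrm_nonneg _ _
  have hCF : 0 ≤ C * F := mul_nonneg hC hF0
  have hu : WeakSol lam mu (fun i x => f x i)
      (fun i x => (WithLp.toLp 2 fun i => v i x : E3) i) G := hv
  have hweak : ∀ w, IsWeakSolution lam mu f w →
      w =ᵐ[volume.restrict halfSpace] fun x => (WithLp.toLp 2 fun i => v i x : E3) := by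
    intro w hw
    obtain ⟨G', hG'⟩ := (isWeakSolution_iff hf1).1 hw
    filter_upwards [ae_all_iff.2 fun i => hG'.unique hL hu i] with x hx
    ext i
    exact hx i
  refine ⟨fun x => WithLp.toLp 2 fun i => v i x,
    WeakSol.isStrongSolution hL.lamCoef hL.muCoef hB.le hf1 hu hW,
    (isWeakSolution_iff hf1).2 ⟨G, hu⟩, ?_, fun w hw => hweak w ?_, hweak⟩
  · have h1 : ∀ i, normSqH 2 1 halfSpace (v i) ≤ (N:ℝ) * (12 * C * F) ^ 2 := fun i => by
      rw [hN]
      refine (memH_two_of_W1 (hv.mem i) (fun j => (hW i j).mono ?_) ?_).2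
      · linarith
      · refine (hardy (hv.mem i)).trans ?_
        have := Finset.sum_le_sum fun j (_ : j ∈ Finset.univ) => (hW i j).le
        simp only [Finset.sum_const, Finset.card_univ, Fintype.card_fin, nsmul_eq_mul] at this
        push_cast at this
        linarith
    have h2 : normHVec 2 1 halfSpace (fun x => WithLp.toLp 2 fun i => v i x) ≤
        (3 * (N:ℝ) + 1) * (12 * C * F) := by
      refine Real.sqrt_le_iff.2 ⟨by positivity, ?_⟩
      refine (Finset.sum_le_sum fun i _ => h1 i).trans ?_
      simp only [Finset.sum_const, Finset.card_univ, Fintype.card_fin, nsmul_eq_mul]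
      push_cast
      have h3 : (0:ℝ) ≤ N := Nat.cast_nonneg N
      have h4 : 0 ≤ (12 * C * F) ^ 2 := sq_nonneg _
      rw [mul_pow (3 * (N:ℝ) + 1), ← mul_assoc]
      refine mul_le_mul_of_nonneg_right ?_ h4
      nlinarith
    have hn : 0 ≤ normHVec 0 1 halfSpace f := Real.sqrt_nonneg _
    calc _ ≤ (3 * (N:ℝ) + 1) * (12 * C * F) := h2
      _ ≤ (3 * (N:ℝ) + 1) * (12 * C * (3 * normHVec 0 1 halfSpace f)) := by gcongr
      _ ≤ _ := by linarith
  -- Strong uniqueness: every strong solution is weak, and weak solutions are unique.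
  · exact (isWeakSolution_iff hf1).2 (hw.weakSol hL.lamCoef hL.muCoef hB.le hf1)
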